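/- Let $d>1$ be squarefree, let $\Delta$ be the discriminant of $\mathbb{Q}(\sqrt d)$ and let $\chi_d=\left(\frac{\Delta}{\cdot}\right)$ be the Kronecker symbol, a Dirichlet character modulo $\Delta$. For $f=\zeta$ or $f=L(\cdot,\chi_d)$ let $\rho=\beta+i\gamma$ run over the zeros of $f$ with $0<\beta<1$ and $\gamma>0$, counted with multiplicity, and put $$w(\rho)=\frac{2(\beta(1-\beta)+\gamma^2)}{(\beta(1-\beta)+\gamma^2)^2+4\gamma^2(\tfrac12-\beta)^2},$$ which is $2/(\tfrac14+\gamma^2)$ if $\beta=\tfrac12$. Let $$S_f(\delta)=\sum_\rho w(\rho)\cos(\gamma\delta)\quad(\delta\in\mathbb{R}),\qquad W_1(\zeta)=\sum_{\rho:\,\zeta(\rho)=0}w(\rho),\qquad N_d(\delta)=S_\zeta(\delta)^2-d\,S_{L(\cdot,\chi_d)}(\delta)^2 .$$ Let $0<\gamma_1'<\gamma_2'<\cdots$ be the distinct positive ordinates of the zeros $\rho$ of $L(\cdot,\chi_d)$, and let $b_k$ be the sum of $w(\rho)$ over the zeros of $L(\cdot,\chi_d)$ with ordinate $\gamma_k'$,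 with multiplicity. Let $$\Lambda_\infty=\Bigl\{n\in\bigoplus_{k\ge1}\mathbb{Z}:\ \sum_k n_k\gamma_k'=0\Bigr\},\qquad d_\infty=\operatorname{rank}\Lambda_\infty,\qquad R_3=\frac1\pi\int_0^\infty\prod_{k=1}^3|J_0(b_kt)|\,dt,$$ where $J_0$ is the Bessel function of order $0$; the objects $\gamma_k',b_k,\Lambda_\infty,d_\infty,R_3$ depend on $d$. Write $\overline{\mathrm{dens}}(A)=\limsup_{T\to\infty}\frac1T\operatorname{meas}(A\cap[0,T])$ for the upper Cesàro density, which is the Cesàro density whenever the latter exists. All the series above converge absolutely, the ordinates $\gamma_k'$ do form an infinite increasing sequence that exhausts all positive ordinates, and the integral $R_3$ converges. Moreover: (i) If $d_\infty=0$, then $$\overline{\mathrm{dens}}\{\delta: N_d(\delta)>0\}\le\frac{4\,R_3\,W_1(\zeta)}{\sqrt d}.$$ (ii) For every integer $r\ge0$ there is a constant $C_r$, depending only on $r$, such that for every squarefree $d>1$ with $d_\infty\le r$ $$\overline{\mathrm{dens}}\{\delta: N_d(\delta)>0\}\le\frac{C_r}{\sqrt d}.$$ In particular $\overline{\mathrm{dens}}\{N_d>0\}=O(1/\sqrt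 d)$, uniformly in $d$, as long as the rank stays bounded. -/

import Mathlib

open scoped NumberTheorySymbols

/-! ### The Kronecker symbol and the quadratic character of a real quadratic field -/

/-- The Kronecker symbol `(a / n)` for an integer `a` and a natural number `n = 2 ^ v * m` with `m`
odd: it is `(a / 2) ^ v` times the Jacobi symbol `(a / m)`, where `(a / 2)` is `0` for even `a`, `1`
for `a ≡ ±1 mod 8` and `-1` for `a ≡ ±3 mod 8`; moreover `(a / 0)` is `1` if `a = ±1` and `0`
otherwise. -/
def kroneckerSym (a : ℤ) (n : ℕ) : ℤ :=
  if n = 0 then (if a.natAbs = 1 then 1 else 0)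
  else ZMod.χ₈ (a : ZMod 8) ^ padicValNat 2 n * J(a | n / 2 ^ padicValNat 2 n)

theorem kroneckerSym_of_odd (a : ℤ) {n : ℕ} (hn : Odd n) : kroneckerSym a n = J(a | n) := by
  have h0 : n ≠ 0 := by rintro rfl; simp at hn
  have h2 : padicValNat 2 n = 0 :=
    padicValNat.eq_zero_of_not_dvd (by rw [← even_iff_two_dvd]; simpa using hn)
  simp [kroneckerSym, h0, h2]

/-- The discriminant of the real quadratic field generated by the square root of the squarefree
number `d > 1`. -/
def fundDisc (d : ℕ) : ℕ := if d % 4 = 1 then d else 4 * d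

instance fundDisc_neZero (d : ℕ) [NeZero d] : NeZero (fundDisc d) :=
  ⟨by have := NeZero.ne d; unfold fundDisc; split_ifs <;> omega⟩

theorem kroneckerSym_one_mod_four {D : ℕ} (hD : D % 4 = 1) (n : ℕ) :
    kroneckerSym D n = J(n | D) := by
  have hDo : Odd D := Nat.odd_iff.2 (by omega)
  rcases eq_or_ne n 0 with rfl | h0
  · rcases eq_or_ne D 1 with rfl | h1
    · simp [kroneckerSym]
    · have : 1 < D := by omega
      simp [kroneckerSym, h1, jacobiSym.zero_left this]
  · obtain ⟨m, hm⟩ : 2 ^ padicValNat 2 n ∣ n := pow_padicValNat_dvd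
    set v := padicValNat 2 n with hv
    have hpos : 0 < 2 ^ v := by positivity
    have hmo : Odd m := by
      rw [← Nat.not_even_iff_odd, even_iff_two_dvd]
      rintro ⟨k, rfl⟩
      refine pow_succ_padicValNat_not_dvd (p := 2) h0 ⟨k, ?_⟩
      rw [← hv]
      conv_lhs => rw [hm]
      ring
    have hdiv : n / 2 ^ v = m := by
      conv_lhs => rw [hm]
      exact Nat.mul_div_cancel_left _ hpos
    have hn : (n : ℤ) = 2 ^ v * m := by exact_mod_cast hm
    rw [hn, jacobiSym.mul_left, jacobiSym.pow_left, jacobiSym.at_two hDo]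
    simp only [kroneckerSym, h0, if_false, ← hv, hdiv]
    rw [jacobiSym.quadratic_reciprocity_one_mod_four hD hmo]
    simp

theorem kroneckerSym_four_mul_even (d : ℕ) {n : ℕ} (hn : Even n) :
    kroneckerSym ((4 * d : ℕ) : ℤ) n = 0 := by
  rcases eq_or_ne n 0 with rfl | h0
  · have : 4 * d ≠ 1 := by omega
    have h' : (((4 * d : ℕ) : ℤ)).natAbs ≠ 1 := by rwa [Int.natAbs_natCast]
    rw [kroneckerSym, if_pos rfl, if_neg h']
  · have hv : padicValNat 2 n ≠ 0 := by
      have := one_le_padicValNat_of_dvd h0 (even_iff_two_dvd.1 hn)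
      omega
    have h8 : ZMod.χ₈ (((4 * d : ℕ) : ℤ) : ZMod 8) = 0 := by
      rw [ZMod.χ₈_int_eq_if_mod_eight, if_pos]
      push_cast
      omega
    rw [kroneckerSym, if_neg h0, h8, zero_pow hv, zero_mul]

theorem kroneckerSym_four_mul_odd (d : ℕ) {n : ℕ} (hn : Odd n) :
    kroneckerSym ((4 * d : ℕ) : ℤ) n = J(d | n) := by
  rw [kroneckerSym_of_odd _ hn]
  push_cast
  rw [jacobiSym.mul_left, jacobiSym.at_four hn, one_mul]

/-- `n ↦ (Δ / n)` is periodic modulo `Δ` when `Δ = fundDisc d`. -/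
theorem kroneckerSym_mod (d n : ℕ) :
    kroneckerSym (fundDisc d) n = kroneckerSym (fundDisc d) (n % fundDisc d) := by
  unfold fundDisc
  split_ifs with h
  · rw [kroneckerSym_one_mod_four h, kroneckerSym_one_mod_four h, jacobiSym.mod_left,
      Int.natCast_mod]
  · rcases Nat.even_or_odd n with hn | hn
    · have hn' : Even (n % (4 * d)) := by
        rw [Nat.even_iff] at hn ⊢
        rw [Nat.mod_mod_of_dvd _ ⟨2 * d, by ring⟩, hn]
      rw [kroneckerSym_four_mul_even d hn, kroneckerSym_four_mul_even d hn']
    · have hn' : Odd (n % (4 * d)) := by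
        rw [Nat.odd_iff] at hn ⊢
        rw [Nat.mod_mod_of_dvd _ ⟨2 * d, by ring⟩, hn]
      rw [kroneckerSym_four_mul_odd d hn, kroneckerSym_four_mul_odd d hn',
        jacobiSym.mod_right' d hn]

theorem kroneckerSym_mul (d m n : ℕ) :
    kroneckerSym (fundDisc d) (m * n)
      = kroneckerSym (fundDisc d) m * kroneckerSym (fundDisc d) n := by
  unfold fundDisc
  split_ifs with h
  · simp only [kroneckerSym_one_mod_four h]
    push_cast
    rw [jacobiSym.mul_left]
  · rcases Nat.even_or_odd m with hm | hm
    · rw [kroneckerSym_four_mul_even d hm, kroneckerSym_four_mul_even d (hm.mul_right n), zero_mul]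
    · rcases Nat.even_or_odd n with hn | hn
      · rw [kroneckerSym_four_mul_even d hn, kroneckerSym_four_mul_even d (hn.mul_left m), mul_zero]
      · rw [kroneckerSym_four_mul_odd d hm, kroneckerSym_four_mul_odd d hn,
          kroneckerSym_four_mul_odd d (hm.mul hn), jacobiSym.mul_right']
        · rintro rfl; simp at hm
        · rintro rfl; simp at hn

theorem kroneckerSym_eq_zero (d : ℕ) [NeZero d] {n : ℕ} (hn : ¬ n.Coprime (fundDisc d)) :
    kroneckerSym (fundDisc d) n = 0 := by
  have hd := NeZero.ne d
  unfold fundDisc at *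
  split_ifs at hn ⊢ with h
  · rw [kroneckerSym_one_mod_four h, jacobiSym.eq_zero_iff]
    exact ⟨hd, by simpa [Nat.Coprime] using hn⟩
  · rcases Nat.even_or_odd n with hn2 | hn2
    · exact kroneckerSym_four_mul_even d hn2
    · rw [kroneckerSym_of_odd _ hn2, jacobiSym.eq_zero_iff]
      refine ⟨by rintro rfl; simp at hn2, ?_⟩
      rwa [Nat.coprime_comm, Nat.Coprime, ← Int.gcd_natCast_natCast] at hn

/-- The quadratic character `χ_d` modulo `Δ = fundDisc d`: the Dirichlet character
`n ↦ (Δ / n)`. -/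
noncomputable def quadChar (d : ℕ) [NeZero d] : DirichletCharacter ℂ (fundDisc d) where
  toFun x := (kroneckerSym (fundDisc d) x.val : ℂ)
  map_one' := by
    have h : kroneckerSym (fundDisc d) (1 % fundDisc d) = 1 := by
      rw [← kroneckerSym_mod, kroneckerSym_of_odd _ odd_one, jacobiSym.one_right]
    rw [ZMod.val_one_eq_one_mod, h, Int.cast_one]
  map_mul' x y := by
    rw [ZMod.val_mul, ← kroneckerSym_mod, kroneckerSym_mul, Int.cast_mul]
  map_nonunit' x hx := by
    have : kroneckerSym (fundDisc d) x.val = 0 := by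
      apply kroneckerSym_eq_zero
      intro hc
      apply hx
      rw [← ZMod.natCast_zmod_val x]
      exact (ZMod.isUnit_iff_coprime _ _).2 hc
    simpa using this

theorem quadChar_natCast (d : ℕ) [NeZero d] (n : ℕ) :
    quadChar d (n : ZMod (fundDisc d)) = (kroneckerSym (fundDisc d) n : ℂ) := by
  change ((kroneckerSym (fundDisc d) (n : ZMod (fundDisc d)).val : ℤ) : ℂ) = _
  rw [ZMod.val_natCast, ← kroneckerSym_mod]

/-- The Dirichlet `L`-function `s ↦ L(s, χ_d)`, analytically continued. -/
noncomputable def quadL (d : ℕ) [NeZero d] : ℂ → ℂ :=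
  DirichletCharacter.LFunction (quadChar d)

/-! ### Nontrivial zeros, Lorentzian weights, shifted zero sums -/

/-- The nontrivial zeros of `f` in the upper half-plane. -/
def upperZeros (f : ℂ → ℂ) : Set ℂ := {ρ | f ρ = 0 ∧ 0 < ρ.re ∧ ρ.re < 1 ∧ 0 < ρ.im}

/-- The Lorentzian weight `w(ρ)` of a zero `ρ = β + iγ`, on or off the critical line. -/
noncomputable def lorentzWeight (ρ : ℂ) : ℝ :=
  2 * (ρ.re * (1 - ρ.re) + ρ.im ^ 2) /
    ((ρ.re * (1 - ρ.re) + ρ.im ^ 2) ^ 2 + 4 * ρ.im ^ 2 * (1 / 2 - ρ.re) ^ 2)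

/-- On the critical line the weight is `2 / (1/4 + γ²)`. -/
theorem lorentzWeight_of_re_eq_half {ρ : ℂ} (h : ρ.re = 1 / 2) :
    lorentzWeight ρ = 2 / (1 / 4 + ρ.im ^ 2) := by
  have h0 : (0 : ℝ) < 1 / 4 + ρ.im ^ 2 := by positivity
  have h1 : (1 / 2 : ℝ) * (1 - 1 / 2) + ρ.im ^ 2 = 1 / 4 + ρ.im ^ 2 := by ring
  rw [lorentzWeight, h, h1, sub_self]
  field_simp
  ring

/-- The weight of `ρ` counted with the multiplicity of `ρ` as a zero of `f`. -/
noncomputable def multWeight (f : ℂ → ℂ) (ρ : ℂ) : ℝ :=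
  (analyticOrderNatAt f ρ : ℝ) * lorentzWeight ρ

/-- `W₁(f) = ∑_ρ w(ρ)`, zeros counted with multiplicity. -/
noncomputable def weightSum (f : ℂ → ℂ) : ℝ := ∑' ρ : upperZeros f, multWeight f ρ

/-- `S_f(δ) = ∑_ρ w(ρ) cos(γ δ)`, zeros counted with multiplicity. -/
noncomputable def shiftedSum (f : ℂ → ℂ) (δ : ℝ) : ℝ :=
  ∑' ρ : upperZeros f, multWeight f ρ * Real.cos ((ρ : ℂ).im * δ)

/-- The norm-form energy `N_d(δ) = S_ζ(δ)² - d S_L(δ)²` with `L = L(·, χ_d)`. -/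
noncomputable def normForm (d : ℕ) [NeZero d] (δ : ℝ) : ℝ :=
  shiftedSum riemannZeta δ ^ 2 - d * shiftedSum (quadL d) δ ^ 2

/-! ### Ordinates and the resonance lattice -/

/-- The set of positive ordinates of the nontrivial zeros of `f`. -/
def ordinateSet (f : ℂ → ℂ) : Set ℝ := Complex.im '' upperZeros f

/-- The positive ordinates of `f` in increasing order, without repetition; `ordinate f k` is the
`(k + 1)`-st one. -/
noncomputable def ordinate (f : ℂ → ℂ) : ℕ → ℝ
  | 0 => sInf (ordinateSet f)
  | k + 1 => sInf {γ | γ ∈ ordinateSet f ∧ ordinate f k < γ}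

/-- The coefficient `b_k` of `cos(γ_k δ)` in `S_f(δ)`: the total weight of the zeros of `f` whose
ordinate is `ordinate f k`. It is `2 / (1/4 + γ_k²)` if there is one such zero and that zero is simple
and lies on the critical line. -/
noncomputable def ordinateWeight (f : ℂ → ℂ) (k : ℕ) : ℝ :=
  ∑' ρ : {ρ : ℂ // ρ ∈ upperZeros f ∧ ρ.im = ordinate f k}, multWeight f ρ

/-- The lattice of integer relations `∑ n_k γ_k = 0` among the terms of a real sequence, inside the
group of finitely supported integer sequences. -/
noncomputable def resonanceLattice (γ : ℕ → ℝ) : Submodule ℤ (ℕ →₀ ℤ) :=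
  LinearMap.ker (Finsupp.linearCombination ℤ γ)

/-! ### Bessel function, the constant `R₃`, Cesàro density -/

/-- The Bessel function `J₀`, by Bessel's integral. -/
noncomputable def besselJZero (x : ℝ) : ℝ :=
  (1 / Real.pi) * ∫ θ in (0 : ℝ)..Real.pi, Real.cos (x * Real.sin θ)

/-- The integrand `∏_{k ≤ 3} |J₀(b_k t)|`. -/
noncomputable def besselProd (b : ℕ → ℝ) (t : ℝ) : ℝ :=
  ∏ k ∈ Finset.range 3, |besselJZero (b k * t)|

/-- `R₃ = (1/π) ∫_0^∞ ∏_{k ≤ 3} |J₀(b_k t)| dt`. -/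
noncomputable def besselR (b : ℕ → ℝ) : ℝ :=
  (1 / Real.pi) * ∫ t in Set.Ioi (0 : ℝ), besselProd b t

/-- The upper Cesàro density: the upper limit of `meas(A ∩ [0, T]) / T` as `T → ∞`. It is the
Cesàro density of `A` whenever the limit exists. -/
noncomputable def upperCesaroDensity (A : Set ℝ) : ℝ :=
  Filter.limsup (fun T : ℝ => MeasureTheory.volume.real (A ∩ Set.Icc 0 T) / T) Filter.atTop

/-! ### Growth of `L`-functions in vertical strips. -/

section

open Complex MeasureTheory Set Filter Topology
open scoped ComplexConjugate

/-! Since `|S_ζ| ≤ W₁(ζ)`, positivity of `N_d(δ)` forces `|S_L(δ)| ≤ W₁(ζ)/√d`. The theorem is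
therefore a small-ball estimate: the almost periodic function `S_L(δ) = ∑ b_k cos(γ_k δ)` may spend
only a proportion `O(ε)` of its time in `[-ε, ε]`. The tail beyond `K` terms is uniformly small, and
by Weyl equidistribution (`IsRelationMeasure.tendsto_average_real`) time averages of the truncated
sum are integrals over a torus, against a measure `μ` whose Fourier coefficients are the indicator
of the integer relations among `γ_0, …, γ_{K-1}`. What is needed is a bound `∫ f(∑ b_k cos θ_k) dμ ≤
2 · rOut · D` for bump functions `f`, with `D` independent of `K`
(`upperCesaroDensity_abs_shiftedSum_le`).

Rank zero: `μ` is invariant under all translations, the angles are independent, and the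
characteristic function of the sum is `∏ J₀(b_k s)`. Fourier inversion bounds the integral by the
`L¹` norm of `f` times `R₃` (`integral_bump_cosSum_le`).

Rank at most `r`: deleting at most `r` of `9r + 8` indices leaves `8(r + 1)` independent angles,
grouped into eight blocks of `r + 1`. In each block some real direction is orthogonal to every
relation, so `μ` is invariant along it. Integrating by parts along these eight directions bounds the
density of the sum by a negative moment of its directional derivatives, and that moment is finite
because the derivatives belong to independent blocks (`integral_comp_cosSum_le`,
`integral_prod_sinSum_rpow_le`, `integral_bump_cosSum_le_of_rank_le`).

The constant is uniform in `d` because the first `9r + 8` weights are bounded below uniformly. This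
rests on `exists_mem_upperZeros_quadL_near`: above an absolute height, every window of fixed length
contains an ordinate of `L(s, χ_d)`, whatever `d` is. Convergence of the zero sums comes from
polynomial growth and Jensen's formula (`summable_multWeight`). -/

theorem WeakFEPair.exists_norm_Λ₀_le (P : WeakFEPair ℂ) (a b : ℝ) :
    ∃ C, ∀ s : ℂ, a ≤ s.re → s.re ≤ b → ‖P.Λ₀ s‖ ≤ C := by
  have hconv (s : ℂ) : MellinConvergent P.f_modif s :=
    mellinConvergent_of_isBigO_rpow (a := s.re + 1) (b := s.re - 1) P.hf_modif_int
      (by simpa using P.hf_modif_top (-(s.re + 1))) (by linarith)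
      (P.isStrongFEPair_toStrongFEPair.hf_zero (-(s.re - 1))) (by linarith)
  have hint (c : ℝ) : IntegrableOn (fun t : ℝ => t ^ (c - 1) * ‖P.f_modif t‖) (Ioi 0) := by
    refine IntegrableOn.congr_fun (hconv c).norm (fun t ht => ?_) measurableSet_Ioi
    simp only [mem_Ioi] at ht
    simp [norm_cpow_eq_rpow_re_of_pos ht]
  refine ⟨∫ t in Ioi (0 : ℝ), (t ^ (a - 1) * ‖P.f_modif t‖ + t ^ (b - 1) * ‖P.f_modif t‖),
    fun s ha hb => ?_⟩
  refine norm_integral_le_of_norm_le ((hint a).add (hint b)) ?_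
  filter_upwards [ae_restrict_mem measurableSet_Ioi] with t ht
  simp only [mem_Ioi] at ht
  rw [norm_smul, norm_cpow_eq_rpow_re_of_pos ht, ← add_mul]
  gcongr
  simp only [sub_re, one_re]
  -- The power `t ^ (Re s - 1)` is dominated by the endpoint power at `a` for `t ≤ 1` and by the one
  -- at `b` for `t ≥ 1`.
  rcases le_total t 1 with h | h
  · have := Real.rpow_le_rpow_of_exponent_ge ht h (by linarith : a - 1 ≤ s.re - 1)
    have := Real.rpow_nonneg ht.le (b - 1)
    linarith
  · have := Real.rpow_le_rpow_of_exponent_le h (by linarith : s.re - 1 ≤ b - 1)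
    have := Real.rpow_nonneg ht.le (a - 1)
    linarith

/-- Apart from an entire function bounded on strips there are only the polar terms at `0` and `1`,
each at most `1` in size once `1 ≤ |Im s|`. -/
theorem exists_norm_completedHurwitzZetaEven_le (x : UnitAddCircle) (a b : ℝ) :
    ∃ C, ∀ s : ℂ, a ≤ s.re → s.re ≤ b → 1 ≤ |s.im| →
      ‖HurwitzZeta.completedHurwitzZetaEven x s‖ ≤ C := by
  obtain ⟨C, hC⟩ := (HurwitzZeta.hurwitzEvenFEPair x).exists_norm_Λ₀_le (a / 2) (b / 2)
  refine ⟨C / 2 + 1 + 1, fun s ha hb ht => ?_⟩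
  have h1 : 1 ≤ ‖s‖ := ht.trans (abs_im_le_norm s)
  have h2 : 1 ≤ ‖1 - s‖ := ht.trans (by simpa using abs_im_le_norm (1 - s))
  rw [HurwitzZeta.completedHurwitzZetaEven_eq]
  refine (norm_sub_le _ _).trans (add_le_add ((norm_sub_le _ _).trans (add_le_add ?_ ?_)) ?_)
  · rw [HurwitzZeta.completedHurwitzZetaEven₀, norm_div, norm_ofNat]
    have := hC (s / 2) (by simpa using by linarith) (by simpa using by linarith)
    linarith
  · rw [norm_div]
    split_ifs <;> simp [inv_le_one_of_one_le₀, h1]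
  · rw [norm_div, norm_one]
    exact div_le_one_of_le₀ h2 (by positivity)

theorem Complex.norm_Gammaℝ_le {s : ℂ} (hs : 0 < s.re) : ‖Gammaℝ s‖ ≤ ‖Gammaℝ s.re‖ := by
  rw [Gammaℝ_def, Gammaℝ_def, norm_mul, norm_mul]
  gcongr ?_ * ?_
  · rw [norm_cpow_eq_rpow_re_of_pos Real.pi_pos, norm_cpow_eq_rpow_re_of_pos Real.pi_pos]
    simp
  · have h2 : 0 < (s / 2).re := by simpa using hs
    have : ((s.re : ℂ) / 2) = (((s / 2).re : ℝ) : ℂ) := by simp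
    rw [this, Gamma_ofReal, Gamma_eq_integral h2]
    rw [norm_real, Real.norm_of_nonneg (Real.Gamma_pos_of_pos h2).le, Real.Gamma_eq_integral h2]
    refine norm_integral_le_of_norm_le (Real.GammaIntegral_convergent h2) ?_
    filter_upwards [ae_restrict_mem measurableSet_Ioi] with t ht
    simp only [mem_Ioi] at ht
    rw [norm_mul, norm_cpow_eq_rpow_re_of_pos ht, norm_real,
      Real.norm_of_nonneg (Real.exp_pos _).le]
    simp

theorem Complex.norm_cos_le_exp (z : ℂ) : ‖cos z‖ ≤ Real.exp |z.im| := by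
  rw [cos, norm_div, norm_ofNat, div_le_iff₀ two_pos]
  refine (norm_add_le _ _).trans ?_
  rw [norm_exp, norm_exp]
  have h1 : (z * I).re ≤ |z.im| := by simpa using neg_le_abs z.im
  have h2 : (-z * I).re ≤ |z.im| := by simpa using le_abs_self z.im
  linarith [Real.exp_le_exp.2 h1, Real.exp_le_exp.2 h2]

/-- The reflection formula moves `1 / Γ_ℝ` to the right half-plane, where `|Γ_ℝ|` is controlled by
its values on the real axis. The price is a cosine of exponential size. -/
theorem Complex.inv_Gammaℝ_eq {s : ℂ} (hs : s.re < 2) :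
    (Gammaℝ s)⁻¹ = Gammaℝ (2 - s) * cos (Real.pi * (1 - s) / 2) := by
  have h := Gammaℝ_one_sub_mul_Gammaℝ_one_add (1 - s)
  rw [sub_sub_cancel, ← add_sub_assoc, one_add_one_eq_two] at h
  rw [← inv_inv (cos _), ← h]
  have h2 : Gammaℝ (2 - s) ≠ 0 := Gammaℝ_ne_zero_of_re_pos (by simpa using hs)
  rw [mul_inv, mul_comm, mul_assoc, inv_mul_cancel₀ h2, mul_one]

theorem Complex.exists_norm_inv_Gammaℝ_le {a b : ℝ} (hb : b < 2) :
    ∃ C, ∀ s : ℂ, a ≤ s.re → s.re ≤ b → ‖(Gammaℝ s)⁻¹‖ ≤ C * Real.exp (2 * |s.im|) := by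
  have hcont : ContinuousOn (fun x : ℝ => ‖Gammaℝ x‖) (Icc (2 - b) (2 - a)) := by
    intro x hx
    have h0 : 0 < (x : ℂ).re := by simp; linarith [hx.1]
    have h1 : DifferentiableAt ℂ Gammaℝ x := by
      have := (differentiable_Gammaℝ_inv x).inv (inv_ne_zero (Gammaℝ_ne_zero_of_re_pos h0))
      rwa [show (fun s => (Gammaℝ s)⁻¹)⁻¹ = Gammaℝ from funext fun s => inv_inv _] at this
    exact ((h1.continuousAt.comp continuous_ofReal.continuousAt).norm).continuousWithinAt
  obtain ⟨C, hC⟩ := isCompact_Icc.exists_bound_of_continuousOn hcont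
  refine ⟨C, fun s ha hb' => ?_⟩
  rw [inv_Gammaℝ_eq (by linarith), norm_mul]
  have hre : (2 - s).re = 2 - s.re := by simp
  have h1 : ‖Gammaℝ (2 - s)‖ ≤ C := by
    refine (norm_Gammaℝ_le (by rw [hre]; linarith)).trans ?_
    have := hC (2 - s).re (by rw [hre]; exact ⟨by linarith, by linarith⟩)
    simpa using this
  refine mul_le_mul h1 ((norm_cos_le_exp _).trans (Real.exp_le_exp.2 ?_)) (norm_nonneg _)
    ((norm_nonneg _).trans h1)
  have : ((Real.pi : ℂ) * (1 - s) / 2).im = Real.pi / 2 * (- s.im) := by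
    rw [mul_div_right_comm, ← ofReal_ofNat, ← ofReal_div, im_ofReal_mul]
    simp
  rw [this, abs_mul, abs_neg, abs_of_pos (by positivity)]
  gcongr
  linarith [Real.pi_lt_four]

theorem Complex.Gammaℝ_conj (s : ℂ) : Gammaℝ (conj s) = conj (Gammaℝ s) := by
  have h : (Real.pi : ℂ).arg ≠ Real.pi := by
    rw [arg_ofReal_of_nonneg Real.pi_pos.le]
    exact Real.pi_pos.ne
  have h2 : conj s / 2 = conj (s / 2) := by rw [map_div₀, conj_ofNat]
  have h3 : -conj s / 2 = conj (-s / 2) := by rw [map_div₀, map_neg, conj_ofNat]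
  rw [Gammaℝ_def, Gammaℝ_def, map_mul, h2, h3, Gamma_conj, cpow_conj _ _ h, conj_ofReal]

/-- On this line `1 - z = conj z + 4`, so the recursion and conjugation give the modulus exactly,
without Stirling's formula. The line `Re z = -5/2` works in the same way with `conj z + 6`. -/
theorem Complex.norm_Gammaℝ_one_sub_div {z : ℂ} (hz : z.re = -3 / 2) :
    ‖Gammaℝ (1 - z) / Gammaℝ z‖ = ‖z‖ * ‖z + 2‖ / (2 * Real.pi) ^ 2 := by
  have h0 : Gammaℝ z ≠ 0 := by
    rw [Ne, Gammaℝ_eq_zero_iff]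
    rintro ⟨n, hn⟩
    rw [hn] at hz
    have h : (2 * 2 * n : ℝ) = 3 := by simp at hz; linarith
    norm_cast at h
    omega
  have e : 1 - z = conj z + 2 + 2 := by
    apply Complex.ext
    · simp; linarith
    · simp
  have h1 : conj z ≠ 0 := fun h => by have := congrArg re h; simp at this; linarith
  have h2 : conj z + 2 ≠ 0 := fun h => by have := congrArg re h; simp at this; linarith
  have h3 : ‖conj z + 2‖ = ‖z + 2‖ := by rw [← norm_conj, map_add, conj_conj, conj_ofNat]
  rw [e, Gammaℝ_add_two h2, Gammaℝ_add_two h1, Gammaℝ_conj]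
  simp only [norm_div, norm_mul, norm_conj, h3, norm_ofNat, norm_real,
    Real.norm_of_nonneg Real.pi_pos.le]
  have := norm_ne_zero_iff.2 h0
  field_simp
  
theorem Complex.norm_Gammaℝ_one_sub_div' {z : ℂ} (hz : z.re = -5 / 2) :
    ‖Gammaℝ (1 - z) / Gammaℝ z‖ = ‖z‖ * ‖z + 2‖ * ‖z + 4‖ / (2 * Real.pi) ^ 3 := by
  have h0 : Gammaℝ z ≠ 0 := by
    rw [Ne, Gammaℝ_eq_zero_iff]
    rintro ⟨n, hn⟩
    rw [hn] at hz
    have h : (2 * 2 * n : ℝ) = 5 := by simp at hz; linarith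
    norm_cast at h
    omega
  have e : 1 - z = conj z + 2 + 2 + 2 := by
    apply Complex.ext
    · simp; linarith
    · simp
  have h1 : conj z ≠ 0 := fun h => by have := congrArg re h; simp at this; linarith
  have h2 : conj z + 2 ≠ 0 := fun h => by have := congrArg re h; simp at this; linarith
  have h3 : ‖conj z + 2‖ = ‖z + 2‖ := by rw [← norm_conj, map_add, conj_conj, conj_ofNat]
  have h4 : conj z + 2 + 2 ≠ 0 := fun h => by have := congrArg re h; simp at this; linarith
  have h5 : ‖conj z + 2 + 2‖ = ‖z + 4‖ := by
    rw [← norm_conj, map_add, map_add, conj_conj, conj_ofNat, add_assoc]; norm_num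
  rw [e, Gammaℝ_add_two h4, Gammaℝ_add_two h2, Gammaℝ_add_two h1, Gammaℝ_conj]
  simp only [norm_div, norm_mul, norm_conj, h3, h5, norm_ofNat, norm_real,
    Real.norm_of_nonneg Real.pi_pos.le]
  have := norm_ne_zero_iff.2 h0
  field_simp

namespace DirichletCharacter

theorem norm_LSeries_term_le {N : ℕ} (χ : DirichletCharacter ℂ N) {s : ℂ} {σ : ℝ} (hσ : σ ≤ s.re)
    (hσ0 : 0 < σ) (n : ℕ) : ‖LSeries.term (fun n : ℕ => χ n) s n‖ ≤ 1 / (n : ℝ) ^ σ := by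
  rcases Nat.eq_zero_or_pos n with rfl | hn
  · simp [Real.zero_rpow hσ0.ne']
  rw [LSeries.term_of_ne_zero hn.ne', norm_div, norm_natCast_cpow_of_pos hn]
  have h1 : (1 : ℝ) ≤ n := by exact_mod_cast hn
  gcongr
  exact χ.norm_le_one _

variable {N : ℕ} [NeZero N]

theorem exists_norm_LFunction_le {σ : ℝ} (hσ : 1 < σ) :
    ∃ C, ∀ (N : ℕ) [NeZero N] (χ : DirichletCharacter ℂ N) (s : ℂ), σ ≤ s.re →
      ‖LFunction χ s‖ ≤ C := by
  refine ⟨∑' n : ℕ, 1 / (n : ℝ) ^ σ, fun N _ χ s hs => ?_⟩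
  rw [χ.LFunction_eq_LSeries (hσ.trans_le hs), LSeries]
  exact tsum_of_norm_bounded (Real.summable_one_div_nat_rpow.2 hσ).hasSum
    (χ.norm_LSeries_term_le hs (by linarith))

/-- The terms after the first are dominated by `ζ(2) - 1 = π² / 6 - 1 < 0.65`. -/
theorem norm_LFunction_sub_one_le (χ : DirichletCharacter ℂ N) {s : ℂ} (hs : 2 ≤ s.re) :
    ‖LFunction χ s - 1‖ ≤ 65 / 100 := by
  have hs1 : 1 < s.re := by linarith
  have hsum : LSeriesSummable (fun n : ℕ => χ n) s := χ.LSeriesSummable_of_one_lt_re hs1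
  have h1 : LSeries.term (fun n : ℕ => χ n) s 1 = 1 := by simp [LSeries.term]
  have h2 := (hasSum_zeta_two.summable).tsum_eq_add_tsum_ite 1
  rw [hasSum_zeta_two.tsum_eq] at h2
  rw [χ.LFunction_eq_LSeries hs1, LSeries, hsum.tsum_eq_add_tsum_ite 1, h1, add_sub_cancel_left]
  have h3 : ‖∑' n, ite (n = 1) 0 (LSeries.term (fun n : ℕ => χ n) s n)‖ ≤
      ∑' n : ℕ, ite (n = 1) 0 (1 / (n : ℝ) ^ 2) := by
    refine tsum_of_norm_bounded (Summable.hasSum ?_) (fun n => ?_)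
    · refine Summable.of_nonneg_of_le (fun n => by split_ifs <;> positivity) (fun n => ?_)
        hasSum_zeta_two.summable
      split_ifs
      · positivity
      · exact le_rfl
    · split_ifs
      · simp
      · simpa using χ.norm_LSeries_term_le hs two_pos n
  refine h3.trans ?_
  have : Real.pi ^ 2 / 6 ≤ 165 / 100 := by
    nlinarith [Real.pi_lt_d4, Real.pi_gt_three]
  norm_num at h2
  norm_num
  linarith

theorem one_third_le_norm_LFunction (χ : DirichletCharacter ℂ N) {s : ℂ} (hs : 2 ≤ s.re) :
    1 / 3 ≤ ‖LFunction χ s‖ := by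
  have h := χ.norm_LFunction_sub_one_le hs
  have := norm_sub_norm_le (1 : ℂ) (LFunction χ s)
  rw [norm_sub_rev, norm_one] at this
  linarith

/-- For a self-dual character, applying the functional equation at `2` and again at `-1` returns to
the start, so the root number squares to `1`; the completed function does not vanish at `2`. -/
theorem norm_rootNumber {χ : DirichletCharacter ℂ N} (hχ : χ.IsPrimitive)
    (hinv : χ⁻¹ = χ) : ‖rootNumber χ‖ = 1 := by
  have hN : (N : ℂ) ≠ 0 := Nat.cast_ne_zero.2 (NeZero.ne N)
  have h1 := hχ.completedLFunction_one_sub 2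
  have h2 := hχ.completedLFunction_one_sub (-1)
  rw [hinv] at h1 h2
  have h0 : completedLFunction χ 2 ≠ 0 := by
    have := χ.LFunction_eq_completed_div_gammaFactor 2 (Or.inl two_ne_zero)
    intro h
    have h3 := χ.one_third_le_norm_LFunction (s := 2) (by simp)
    rw [this, h] at h3
    norm_num at h3
  rw [show (1 : ℂ) - 2 = -1 by norm_num] at h1
  rw [show (1 : ℂ) - -1 = 2 by norm_num, h1] at h2
  have h4 : (N : ℂ) ^ (-1 - 1 / 2 : ℂ) * (N : ℂ) ^ (2 - 1 / 2 : ℂ) = 1 := by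
    rw [← cpow_add _ _ hN]; norm_num
  have h5 : rootNumber χ ^ 2 = 1 := by
    have : completedLFunction χ 2 * (rootNumber χ ^ 2 - 1) = 0 := by
      linear_combination (-1 : ℂ) * h2 - completedLFunction χ 2 * rootNumber χ ^ 2 * h4
    exact sub_eq_zero.1 ((mul_eq_zero.1 this).resolve_left h0)
  have := congrArg norm h5
  rw [norm_pow, norm_one] at this
  exact (pow_eq_one_iff_of_nonneg (norm_nonneg _) two_ne_zero).1 this

theorem norm_LFunction_eq_norm_one_sub {χ : DirichletCharacter ℂ N} (hχ : χ.IsPrimitive)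
    (he : χ.Even) (hinv : χ⁻¹ = χ) {z : ℂ} (hz : z.re < 1) (hz0 : z ≠ 0) :
    ‖LFunction χ z‖ =
      (N : ℝ) ^ (1 / 2 - z.re) * ‖Gammaℝ (1 - z) / Gammaℝ z‖ * ‖LFunction χ (1 - z)‖ := by
  have hz1 : (1 - z) ≠ 0 := by
    intro h; have := congrArg re h; simp at this; linarith
  have h1 := hχ.completedLFunction_one_sub (1 - z)
  rw [sub_sub_cancel, hinv] at h1
  have h2 := χ.LFunction_eq_completed_div_gammaFactor z (Or.inl hz0)
  have h3 := χ.LFunction_eq_completed_div_gammaFactor (1 - z) (Or.inl hz1)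
  rw [he.gammaFactor_def] at h2 h3
  have hG : Gammaℝ (1 - z) ≠ 0 := Gammaℝ_ne_zero_of_re_pos (by simp; linarith)
  rw [h2, h1, h3]
  simp only [norm_div, norm_mul, norm_rootNumber hχ hinv]
  rw [norm_natCast_cpow_of_pos (NeZero.pos N)]
  have : (1 - z - 1 / 2).re = 1 / 2 - z.re := by simp; ring
  rw [this]
  have := norm_ne_zero_iff.2 hG
  field_simp

/-- A crude a priori bound, whose only purpose is to license Phragmén–Lindelöf. -/
theorem exists_norm_LFunction_le_exp {χ : DirichletCharacter ℂ N} (he : χ.Even) {a b : ℝ}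
    (hb : b < 2) : ∃ C, ∀ s : ℂ, a ≤ s.re → s.re ≤ b → 1 ≤ |s.im| →
      ‖LFunction χ s‖ ≤ C * Real.exp (2 * |s.im|) := by
  choose B hB using fun x => exists_norm_completedHurwitzZetaEven_le x a b
  obtain ⟨C, hC⟩ := exists_norm_inv_Gammaℝ_le (a := a) hb
  refine ⟨((N : ℝ) ^ (-a) * ∑ j : ZMod N, B (ZMod.toAddCircle j)) * C, fun s ha hb ht => ?_⟩
  have hs : s ≠ 0 := by rintro rfl; norm_num at ht
  have hN : (1 : ℝ) ≤ N := by exact_mod_cast NeZero.pos N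
  rw [χ.LFunction_eq_completed_div_gammaFactor s (Or.inl hs), he.gammaFactor_def, div_eq_mul_inv,
    norm_mul, completedLFunction, ZMod.completedLFunction_def_even he.to_fun, norm_mul, mul_assoc _ C,
    norm_natCast_cpow_of_pos (NeZero.pos N)]
  gcongr
  · refine mul_nonneg (by positivity) (Finset.sum_nonneg fun j _ => ?_)
    exact (norm_nonneg _).trans (hB _ s ha hb ht)
  · simpa using ha
  · refine (norm_sum_le _ _).trans (Finset.sum_le_sum fun j _ => ?_)
    rw [norm_mul]
    refine (mul_le_of_le_one_left (norm_nonneg _) (χ.norm_le_one _)).trans (hB _ s ha hb ht)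
  · exact hC s ha hb

end DirichletCharacter

/-- Phragmén–Lindelöf for `G z / (z + 6) ^ 4`. The exponent `4` leaves room for the cube produced by
the functional equation on the left line and for one factor `z - 1` that cancels the pole of zeta.
-/
theorem norm_le_of_norm_le_on_lines {G : ℂ → ℂ} (hG : Differentiable ℂ G) {K : ℝ}
    (hl : ∀ z : ℂ, z.re = -5 / 2 → ‖G z‖ ≤ K * ‖z + 6‖ ^ 4)
    (hr : ∀ z : ℂ, 3 / 2 ≤ z.re → ‖G z‖ ≤ K * ‖z + 6‖ ^ 4)
    (hgrow : ∃ C, ∀ z : ℂ, -5 / 2 ≤ z.re → z.re ≤ 3 / 2 → 1 ≤ |z.im| →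
      ‖G z‖ ≤ C * Real.exp (4 * |z.im|)) {z : ℂ} (hz : -5 / 2 ≤ z.re) :
    ‖G z‖ ≤ K * ‖z + 6‖ ^ 4 := by
  have hpos : ∀ z : ℂ, -5 / 2 ≤ z.re → 1 ≤ ‖z + 6‖ := fun z hz => by
    have := abs_re_le_norm (z + 6)
    have h2 := le_abs_self (z + 6).re
    simp at this h2
    linarith
  rcases le_total (3 / 2) z.re with h | h
  · exact hr z h
  have hiff : ∀ z : ℂ, -5 / 2 ≤ z.re → (‖G z / (z + 6) ^ 4‖ ≤ K ↔ ‖G z‖ ≤ K * ‖z + 6‖ ^ 4) := by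
    intro z hz
    have := hpos z hz
    rw [norm_div, norm_pow, div_le_iff₀ (by positivity)]
  rw [← hiff z hz]
  refine PhragmenLindelof.vertical_strip (f := fun z => G z / (z + 6) ^ 4) (a := -5 / 2)
    (b := 3 / 2) ?_ ?_ (fun z hz => (hiff z hz.ge).2 (hl z hz))
    (fun z hz => (hiff z (by rw [hz]; norm_num)).2 (hr z hz.ge)) hz h
  · refine DifferentiableOn.diffContOnCl fun w hw => ?_
    have hw' : -5 / 2 ≤ w.re := by
      have : closure (re ⁻¹' Ioo (-5 / 2) (3 / 2)) ⊆ re ⁻¹' Icc (-5 / 2 : ℝ) (3 / 2) :=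
        closure_minimal (preimage_mono Ioo_subset_Icc_self) (isClosed_Icc.preimage continuous_re)
      exact (this hw).1
    refine (DifferentiableAt.div (hG w) (by fun_prop) ?_).differentiableWithinAt
    have := hpos w hw'
    exact pow_ne_zero _ (norm_pos_iff.1 (by linarith))
  -- The strip has width `4`, so the growth exponent must be below `π / 4`; `1 / 2` qualifies, and
  -- `4 |t| ≤ 8 exp(|t| / 2)`.
  · obtain ⟨C, hC⟩ := hgrow
    refine ⟨1 / 2, ?_, 8, Asymptotics.IsBigO.of_bound C ?_⟩
    · rw [lt_div_iff₀ (by norm_num)]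
      linarith [Real.pi_gt_three]
    · rw [eventually_inf_principal]
      have : ∀ᶠ w : ℂ in comap (_root_.abs ∘ im) atTop, 1 ≤ |w.im| :=
        tendsto_comap.eventually (eventually_ge_atTop (1 : ℝ))
      filter_upwards [this] with w hw1 hw2
      have h1 := hC w hw2.1.le hw2.2.le hw1
      have h2 := hpos w hw2.1.le
      have hC0 : 0 ≤ C := by
        by_contra! hC0
        have := mul_neg_of_neg_of_pos hC0 (Real.exp_pos (4 * |w.im|))
        linarith [norm_nonneg (G w)]
      rw [norm_div, norm_pow]
      refine (div_le_self (norm_nonneg _) (one_le_pow₀ h2)).trans (h1.trans ?_)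
      rw [Real.norm_of_nonneg (Real.exp_pos _).le]
      have := Real.add_one_le_exp (1 / 2 * |w.im|)
      refine mul_le_mul_of_nonneg_left (Real.exp_le_exp.2 ?_) hC0
      linarith

namespace DirichletCharacter

theorem exists_norm_LFunction_le_on_left_line : ∃ K : ℝ, 0 < K ∧ ∀ (N : ℕ) [NeZero N]
    (χ : DirichletCharacter ℂ N), χ.IsPrimitive → χ.Even → χ⁻¹ = χ → ∀ z : ℂ, z.re = -5 / 2 →
      ‖LFunction χ z‖ ≤ K * N ^ 3 * ‖z + 6‖ ^ 3 := by
  refine ⟨2, by norm_num, fun N _ χ hχ he hinv z hz => ?_⟩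
  have h0 : ‖LFunction χ (1 - z)‖ ≤ 2 := by
    have h := χ.norm_LFunction_sub_one_le (s := 1 - z) (by simp; linarith)
    have := norm_sub_norm_le (LFunction χ (1 - z)) 1
    rw [norm_one] at this
    linarith
  rw [norm_LFunction_eq_norm_one_sub hχ he hinv (by linarith) (by rintro rfl; norm_num at hz), norm_Gammaℝ_one_sub_div' hz, hz,
    show (1 / 2 - -5 / 2 : ℝ) = (3 : ℕ) by norm_num, Real.rpow_natCast]
  have hsq : ∀ a : ℝ, |a - 5 / 2| ≤ 7 / 2 → ‖z + a‖ ≤ ‖z + 6‖ := fun a ha => by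
    rw [← sq_le_sq₀ (norm_nonneg _) (norm_nonneg _), ← normSq_eq_norm_sq, ← normSq_eq_norm_sq,
      normSq_apply, normSq_apply]
    have := abs_le.1 ha
    simp [hz]
    nlinarith
  have h1 : ‖z‖ ≤ ‖z + 6‖ := by simpa using hsq 0 (by norm_num [abs_le])
  have h2 : ‖z + 2‖ ≤ ‖z + 6‖ := by simpa using hsq 2 (by norm_num [abs_le])
  have h4 : ‖z + 4‖ ≤ ‖z + 6‖ := by simpa using hsq 4 (by norm_num [abs_le])
  have h5 : 1 ≤ (2 * Real.pi) ^ 3 := one_le_pow₀ (by linarith [Real.pi_gt_three])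
  calc _ ≤ (N : ℝ) ^ 3 * (‖z + 6‖ * ‖z + 6‖ * ‖z + 6‖ / 1) * 2 := by gcongr
    _ = _ := by ring

theorem exists_norm_LFunction_le_polynomial : ∃ K : ℝ, 0 < K ∧ ∀ (N : ℕ) [NeZero N]
    (χ : DirichletCharacter ℂ N), χ.IsPrimitive → χ.Even → χ⁻¹ = χ → χ ≠ 1 →
      ∀ z : ℂ, -5 / 2 ≤ z.re → ‖LFunction χ z‖ ≤ K * N ^ 3 * ‖z + 6‖ ^ 4 := by
  obtain ⟨K, hK, h1⟩ := exists_norm_LFunction_le_on_left_line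
  obtain ⟨B, h2⟩ := exists_norm_LFunction_le (σ := 3 / 2) (by norm_num)
  refine ⟨max K B, lt_max_of_lt_left hK, fun N _ χ hχ he hinv hne z hz => ?_⟩
  have hN : (1 : ℝ) ≤ (N : ℝ) ^ 3 := one_le_pow₀ (by exact_mod_cast NeZero.pos N)
  have hpos : ∀ z : ℂ, -5 / 2 ≤ z.re → 1 ≤ ‖z + 6‖ := fun z hz => by
    have := abs_re_le_norm (z + 6)
    have h2 := le_abs_self (z + 6).re
    simp at this h2
    linarith
  refine norm_le_of_norm_le_on_lines (differentiable_LFunction hne) (fun z hz => ?_)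
    (fun z hz => ?_) ?_ hz
  · refine (h1 N χ hχ he hinv z hz).trans ?_
    have := hpos z hz.ge
    gcongr
    · exact le_max_left _ _
    · norm_num
  · refine (h2 N χ z hz).trans ?_
    have h4 := one_le_pow₀ (n := 4) (hpos z (by linarith))
    have hm : 0 ≤ max K B := (lt_max_of_lt_left hK).le
    calc B ≤ max K B := le_max_right _ _
      _ = max K B * 1 * 1 := by ring
      _ ≤ _ := by gcongr
  · obtain ⟨C, hC⟩ := exists_norm_LFunction_le_exp he (a := -5 / 2) (b := 3 / 2) (by norm_num)
    refine ⟨C, fun z ha hb ht => (hC z ha hb ht).trans ?_⟩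
    have hC0 : 0 ≤ C := by
      by_contra! hC0
      have := mul_neg_of_neg_of_pos hC0 (Real.exp_pos (2 * |z.im|))
      linarith [norm_nonneg (LFunction χ z), hC z ha hb ht]
    gcongr
    norm_num

theorem exists_norm_LFunctionTrivChar₁_le_polynomial : ∃ K : ℝ, 0 < K ∧
    ∀ z : ℂ, -5 / 2 ≤ z.re → ‖LFunctionTrivChar₁ 1 z‖ ≤ K * ‖z + 6‖ ^ 4 := by
  obtain ⟨K, hK, h1⟩ := exists_norm_LFunction_le_on_left_line
  obtain ⟨B, h2⟩ := exists_norm_LFunction_le (σ := 3 / 2) (by norm_num)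
  have hprim : (1 : DirichletCharacter ℂ 1).IsPrimitive := isPrimitive_one_level_one
  have heven : (1 : DirichletCharacter ℂ 1).Even := MulChar.one_apply isUnit_one.neg
  have heq : ∀ z : ℂ, z ≠ 1 → LFunctionTrivChar₁ 1 z =
      (z - 1) * LFunction (1 : DirichletCharacter ℂ 1) z := fun z hz => by
    rw [LFunctionTrivChar₁, Function.update_of_ne hz, LFunctionTrivChar]
  have hB1 : ∃ B₁, ∀ z : ℂ, 3 / 2 ≤ z.re → ‖LFunction (1 : DirichletCharacter ℂ 1) z‖ ≤ B₁ :=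
    ⟨B, fun z hz => h2 1 1 z hz⟩
  refine ⟨max K B, lt_max_of_lt_left hK, fun z hz => ?_⟩
  have hpos : ∀ z : ℂ, -5 / 2 ≤ z.re → 1 ≤ ‖z + 6‖ := fun z hz => by
    have := abs_re_le_norm (z + 6)
    have h2 := le_abs_self (z + 6).re
    simp at this h2
    linarith
  have hsub : ∀ z : ℂ, -5 / 2 ≤ z.re → ‖z - 1‖ ≤ ‖z + 6‖ := fun z hz => by
    rw [← sq_le_sq₀ (norm_nonneg _) (norm_nonneg _), ← normSq_eq_norm_sq, ← normSq_eq_norm_sq,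
      normSq_apply, normSq_apply]
    simp
    nlinarith
  have hne : ∀ z : ℂ, z.re ≠ 1 → z ≠ 1 := fun z hz h => hz (by simp [h])
  have hm : 0 ≤ max K B := (lt_max_of_lt_left hK).le
  refine norm_le_of_norm_le_on_lines (differentiable_LFunctionTrivChar₁ 1) (fun z hz => ?_)
    (fun z hz => ?_) ?_ hz
  · rw [heq z (hne z (by rw [hz]; norm_num)), norm_mul]
    have h := h1 1 1 hprim heven inv_one z hz
    rw [Nat.cast_one, one_pow, mul_one] at h
    calc _ ≤ ‖z + 6‖ * (max K B * ‖z + 6‖ ^ 3) := by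
          gcongr
          · exact hsub z hz.ge
          · refine h.trans ?_
            gcongr
            exact le_max_left _ _
      _ = _ := by ring
  · rw [heq z (hne z (by linarith)), norm_mul]
    have h6 := hpos z (by linarith)
    calc _ ≤ ‖z + 6‖ * max K B := by
          gcongr
          · exact hsub z (by linarith)
          · exact (h2 1 1 z hz).trans (le_max_right _ _)
      _ ≤ ‖z + 6‖ ^ 4 * max K B := by
          gcongr
          exact le_self_pow₀ h6 (by norm_num)
      _ = _ := by ring
  · obtain ⟨C, hC⟩ := exists_norm_LFunction_le_exp heven (a := -5 / 2) (b := 3 / 2) (by norm_num)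
    refine ⟨5 * C, fun z ha hb ht => ?_⟩
    have hz1 : z ≠ 1 := by rintro rfl; norm_num at ht
    have h := hC z ha hb ht
    have hC0 : 0 ≤ C := by
      by_contra! hC0
      have := mul_neg_of_neg_of_pos hC0 (Real.exp_pos (2 * |z.im|))
      linarith [norm_nonneg (LFunction (1 : DirichletCharacter ℂ 1) z)]
    rw [heq z hz1, norm_mul]
    have h5 : ‖z - 1‖ ≤ 5 * Real.exp (2 * |z.im|) := by
      refine (norm_le_abs_re_add_abs_im _).trans ?_
      have : |(z - 1).re| ≤ 4 := by
        rw [abs_le]; simp; constructor <;> linarith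
      have h6 := Real.add_one_le_exp (2 * |z.im|)
      simp only [sub_im, one_im, sub_zero]
      linarith
    calc _ ≤ (5 * Real.exp (2 * |z.im|)) * (C * Real.exp (2 * |z.im|)) := by gcongr
      _ = 5 * C * Real.exp (4 * |z.im|) := by
          rw [mul_mul_mul_comm, ← Real.exp_add]; ring_nf

end DirichletCharacter

end

/-! ### Primitivity, parity and self-duality of the quadratic character. -/

section

open scoped NumberTheorySymbols

/-- Primitivity prime by prime: a character induced from a modulus dividing `Δ / p` would equal `1`
at such an `a`. For odd `p` a nonresidue modulo `p` is glued to `1` modulo `Δ / p`; for `p = 2` the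
witness is `1 + 4 e` if `d = 2 e`, and `1 + 2 d` if `d` is odd. -/
theorem exists_kroneckerSym_eq_neg_one {d p : ℕ} (hd : Squarefree d) (hp : p.Prime)
    (hpd : p ∣ fundDisc d) :
    ∃ a : ℕ, a ≡ 1 [MOD fundDisc d / p] ∧ kroneckerSym (fundDisc d) a = -1 := by
  have hd0 : 0 < d := hd.ne_zero.bot_lt
  have key : ∀ m, d = p * m → p ≠ 2 → m.Coprime p ∧ ∃ b : ℕ, J(b | p) = -1 := by
    rintro m rfl hp2
    refine ⟨((Nat.squarefree_mul_iff.1 hd).1).symm, ?_⟩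
    have := Fact.mk hp
    obtain ⟨b, hb⟩ := quadraticChar_exists_neg_one (F := ZMod p)
      (by rwa [ZMod.ringChar_zmod_n])
    refine ⟨b.val, ?_⟩
    rw [← jacobiSym.legendreSym.to_jacobiSym, legendreSym]
    simpa using hb
  unfold fundDisc at hpd ⊢
  split_ifs at hpd ⊢ with h
  · obtain ⟨m, rfl⟩ := hpd
    have hp2 : p ≠ 2 := by rintro rfl; omega
    obtain ⟨hc, b, hb⟩ := key m rfl hp2
    obtain ⟨a, ha1, ha2⟩ := Nat.chineseRemainder hc 1 b
    refine ⟨a, by rwa [Nat.mul_div_cancel_left _ hp.pos], ?_⟩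
    have : NeZero p := ⟨hp.ne_zero⟩
    have : NeZero m := ⟨by rintro rfl; simp at hd0⟩
    rw [kroneckerSym_one_mod_four h, jacobiSym.mul_right, jacobiSym.mod_left' (b := m) (a₂ := 1),
      jacobiSym.mod_left' (b := p) (a₂ := b), hb, jacobiSym.one_left, mul_one]
    · exact_mod_cast ha2
    · exact_mod_cast ha1
  · rcases eq_or_ne p 2 with rfl | hp2
    · rw [show 4 * d / 2 = 2 * d by omega]
      rcases Nat.even_or_odd d with he | ho
      · obtain ⟨e, rfl⟩ := even_iff_two_dvd.1 he
        have hodd : e % 2 = 1 := by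
          have := (Nat.squarefree_mul_iff.1 hd).1
          exact Nat.odd_iff.1 (Nat.coprime_two_left.1 this)
        refine ⟨1 + 4 * e, by simp [Nat.ModEq, ← mul_assoc], ?_⟩
        have hn : Odd (1 + 4 * e) := by rw [Nat.odd_iff]; omega
        rw [kroneckerSym_four_mul_odd _ hn]
        push_cast
        rw [jacobiSym.mul_left, jacobiSym.at_two hn, jacobiSym.mod_right' e hn,
          Nat.add_mod_right, Nat.mod_eq_of_lt (by omega), jacobiSym.one_right, mul_one,
          ZMod.χ₈_nat_eq_if_mod_eight, if_neg (by omega), if_neg (by omega)]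
      · refine ⟨1 + 2 * d, by simp [Nat.ModEq], ?_⟩
        have hd3 : d % 4 = 3 := by
          have := Nat.odd_iff.1 ho
          omega
        rw [kroneckerSym_four_mul_odd _ (by rw [Nat.odd_iff]; omega),
          jacobiSym.quadratic_reciprocity_three_mod_four hd3 (by omega),
          jacobiSym.mod_left' (a₂ := 1), jacobiSym.one_left]
        simp
    · have hpd' : p ∣ d := by
        refine (Nat.Coprime.dvd_mul_left ?_).1 hpd
        exact Nat.Coprime.pow_right (m := 2) 2
          ((Nat.coprime_primes hp Nat.prime_two).2 hp2)
      obtain ⟨m, rfl⟩ := hpd'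
      have hm0 : 0 < m := Nat.pos_of_mul_pos_left hd0 
      obtain ⟨hc, b, hb⟩ := key m rfl hp2
      have hpo : Odd p := hp.odd_of_ne_two hp2
      have hc' : (4 * m).Coprime p := by
        refine Nat.Coprime.mul_left ?_ hc
        exact Nat.Coprime.pow_left (m := 2) 2
          ((Nat.coprime_primes Nat.prime_two hp).2 hp2.symm)
      obtain ⟨a, ha1, ha2⟩ := Nat.chineseRemainder hc' 1 b
      have ha4 : a % 4 = 1 := by
        have := ha1.of_dvd (Dvd.intro m rfl : 4 ∣ 4 * m)
        simpa [Nat.ModEq] using this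
      have hao : Odd a := by rw [Nat.odd_iff]; omega
      refine ⟨a, ?_, ?_⟩
      · rwa [show 4 * (p * m) = p * (4 * m) by ring, Nat.mul_div_cancel_left _ hp.pos]
      · rw [kroneckerSym_four_mul_odd _ hao]
        push_cast
        have h1 : a % (4 * m) = 1 := by
          rw [ha1, Nat.mod_eq_of_lt (by omega)]
        rw [jacobiSym.mul_left, jacobiSym.mod_right' m hao, h1, jacobiSym.one_right, mul_one,
          jacobiSym.quadratic_reciprocity_one_mod_four' hpo ha4,
          jacobiSym.mod_left' (a₂ := b), hb]
        exact_mod_cast ha2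

theorem one_lt_fundDisc {d : ℕ} (h : 1 < d) : 1 < fundDisc d := by
  unfold fundDisc; split_ifs <;> omega

section

variable {d : ℕ} [NeZero d]

theorem isPrimitive_quadChar (hd : Squarefree d) : (quadChar d).IsPrimitive := by
  set N := fundDisc d with hN
  have hN0 : 0 < N := NeZero.pos N
  by_contra hne
  obtain ⟨k, hk⟩ := (quadChar d).conductor_dvd_level
  have hk1 : k ≠ 1 := by
    rintro rfl
    rw [mul_one] at hk
    exact hne hk.symm
  obtain ⟨p, hp, hpk⟩ := Nat.exists_prime_and_dvd hk1
  obtain ⟨a, ha, hka⟩ := exists_kroneckerSym_eq_neg_one hd hp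
    (hpk.trans (Dvd.intro_left _ hk.symm))
  obtain ⟨hdvd, χ₀, hχ⟩ := (quadChar d).factorsThrough_conductor
  set c := (quadChar d).conductor with hc
  have hac : a ≡ 1 [MOD c] := by
    refine ha.of_dvd ?_
    obtain ⟨l, rfl⟩ := hpk
    rw [hk, show c * (p * l) = p * (c * l) by ring, Nat.mul_div_cancel_left _ hp.pos]
    exact Dvd.intro _ rfl
  have hcop : a.Coprime N := by
    by_contra hcop
    rw [kroneckerSym_eq_zero d hcop] at hka
    norm_num at hka
  have h1 : quadChar d (a : ZMod N) = -1 := by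
    rw [quadChar_natCast, hka]; norm_num
  have h2 : quadChar d (a : ZMod N) = 1 := by
    rw [hχ, ← ZMod.coe_unitOfCoprime a hcop, DirichletCharacter.changeLevel_eq_cast_of_dvd,
      ZMod.coe_unitOfCoprime, ZMod.cast_natCast hdvd, (ZMod.natCast_eq_natCast_iff _ _ _).2 hac,
      Nat.cast_one, map_one]
  rw [h1] at h2
  norm_num at h2

theorem isQuadratic_quadChar : (quadChar d).IsQuadratic := by
  intro x
  rw [← ZMod.natCast_zmod_val x, quadChar_natCast]
  generalize x.val = n
  have : kroneckerSym (fundDisc d) n = 0 ∨ kroneckerSym (fundDisc d) n = 1 ∨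
      kroneckerSym (fundDisc d) n = -1 := by
    unfold fundDisc
    split_ifs with h
    · rw [kroneckerSym_one_mod_four h]
      exact jacobiSym.trichotomy _ _
    · rcases Nat.even_or_odd n with hn | hn
      · exact Or.inl (kroneckerSym_four_mul_even d hn)
      · rw [kroneckerSym_four_mul_odd d hn]
        exact jacobiSym.trichotomy _ _
  rcases this with h | h | h <;> simp [h]

theorem inv_quadChar : (quadChar d)⁻¹ = quadChar d := isQuadratic_quadChar.inv

theorem even_quadChar : (quadChar d).Even := by
  have h0 : 0 < fundDisc d := NeZero.pos _
  have h1 : (-1 : ZMod (fundDisc d)) = ((fundDisc d - 1 : ℕ) : ZMod (fundDisc d)) := by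
    rw [Nat.cast_sub h0]; simp
  rw [DirichletCharacter.Even, h1, quadChar_natCast]
  norm_cast
  unfold fundDisc at h0 ⊢
  split_ifs at h0 ⊢ with h
  · have : NeZero d := ⟨by omega⟩
    have ho : Odd d := by rw [Nat.odd_iff]; omega
    rw [kroneckerSym_one_mod_four h, jacobiSym.mod_left' (a₂ := -1), jacobiSym.at_neg_one ho,
      ZMod.χ₄_nat_one_mod_four h]
    rw [Nat.cast_sub h0]
    exact (Int.modEq_iff_dvd.2 ⟨-1, by push_cast; ring⟩)
  · have ho : Odd (4 * d - 1) := by rw [Nat.odd_iff]; omega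
    have h4 : J(4 | 4 * d - 1) * J(d | 4 * d - 1) = 1 := by
      rw [← jacobiSym.mul_left, jacobiSym.mod_left' (a₂ := 1), jacobiSym.one_left]
      rw [Nat.cast_sub h0]
      exact (Int.modEq_iff_dvd.2 ⟨-1, by push_cast; ring⟩)
    rwa [jacobiSym.at_four ho, one_mul, ← kroneckerSym_four_mul_odd d ho] at h4

theorem quadChar_ne_one (hd : Squarefree d) (h : 1 < d) : quadChar d ≠ 1 := by
  intro h1
  have := isPrimitive_quadChar hd
  rw [DirichletCharacter.IsPrimitive, h1, DirichletCharacter.conductor_one] at this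
  exact (one_lt_fundDisc h).ne this

end

end

/-! ### Counting zeros and summability of the weights. -/

section

open Complex Metric Set Filter Topology

/-- An entire function of polynomial growth on `-5/2 ≤ Re z` which stays away from zero on
`2 ≤ Re z`. -/
structure HasPolynomialGrowth (G : ℂ → ℂ) : Prop where
  differentiable : Differentiable ℂ G
  bound : ∃ K : ℝ, 0 < K ∧ ∀ z : ℂ, -5 / 2 ≤ z.re → ‖G z‖ ≤ K * ‖z + 6‖ ^ 4
  lower : ∀ z : ℂ, 2 ≤ z.re → 1 / 3 ≤ ‖G z‖

namespace HasPolynomialGrowth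

variable {G : ℂ → ℂ}

theorem analyticOnNhd (hG : HasPolynomialGrowth G) (s : Set ℂ) : AnalyticOnNhd ℂ G s :=
  fun z _ => hG.differentiable.analyticAt z

theorem analyticOrderAt_ne_top (hG : HasPolynomialGrowth G) (z : ℂ) : analyticOrderAt G z ≠ ⊤ := by
  intro h
  have h1 := (hG.analyticOnNhd univ).eqOn_zero_of_preconnected_of_eventuallyEq_zero
    isPreconnected_univ (mem_univ z) (analyticOrderAt_eq_top.1 h)
  have h2 := hG.lower 2 (by simp)
  rw [h1 (mem_univ 2)] at h2
  norm_num at h2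

theorem analyticOrderNatAt_pos (hG : HasPolynomialGrowth G) {z : ℂ} (hz : G z = 0) :
    0 < analyticOrderNatAt G z := by
  have h1 := Nat.cast_analyticOrderNatAt (hG.analyticOrderAt_ne_top z)
  refine Nat.pos_of_ne_zero fun h => ?_
  rw [h] at h1
  exact (hG.differentiable.analyticAt z).analyticOrderAt_eq_zero.1 (by simpa using h1.symm) hz

theorem divisor_eq (hG : HasPolynomialGrowth G) {U : Set ℂ} {z : ℂ} (hz : z ∈ U) :
    MeromorphicOn.divisor G U z = analyticOrderNatAt G z := by
  rw [MeromorphicOn.AnalyticOnNhd.divisor_apply (hG.analyticOnNhd U) hz,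
    ← Nat.cast_analyticOrderNatAt (hG.analyticOrderAt_ne_top z)]
  rfl

theorem finite_zeros (hG : HasPolynomialGrowth G) {U : Set ℂ} (hU : IsCompact U) :
    {z | G z = 0 ∧ z ∈ U}.Finite := by
  refine ((MeromorphicOn.divisor G U).finiteSupport hU).subset fun z hz => ?_
  rw [Function.mem_support, hG.divisor_eq hz.2]
  exact_mod_cast (hG.analyticOrderNatAt_pos hz.1).ne'

/-- Jensen's formula on discs of radii `4` and `11 / 2` about `3 + t i`: the larger disc stays in
`Re z ≥ -5/2`, and `|G|` is at least `1/3` at the centre. The method yields `O(log t)`; a square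
root is enough against weights of size `2 / γ²`. -/
theorem exists_sum_order_le (hG : HasPolynomialGrowth G) : ∃ C : ℝ, 0 ≤ C ∧ ∀ t : ℝ, 0 ≤ t →
    ∀ u : Finset ℂ, (∀ z ∈ u, G z = 0 ∧ ‖z - (3 + t * I)‖ ≤ 4) →
      ∑ z ∈ u, (analyticOrderNatAt G z : ℝ) ≤ C * √(t + 1) := by
  obtain ⟨K, hK, hb⟩ := hG.bound
  have hlog : 0 < Real.log (11 / 2 / 4) := Real.log_pos (by norm_num)
  set A : ℝ := |Real.log (3 * K)| + 4 * (2 * 4) + Real.log 3 with hA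
  have hA0 : 0 ≤ A := by positivity
  refine ⟨A / Real.log (11 / 2 / 4), by positivity, fun t ht u hu => ?_⟩
  set c : ℂ := 3 + t * I with hc
  set M : ℝ := max 1 (K * (t + 16) ^ 4) with hM
  have hcre : c.re = 3 := by simp [hc]
  have hGc := hG.lower c (by rw [hcre]; norm_num)
  have hbd : ∀ z ∈ sphere c |(11 / 2 : ℝ)|, ‖G z‖ ≤ M := by
    intro z hz
    rw [abs_of_pos (by norm_num), mem_sphere, dist_eq_norm] at hz
    have h1 : |(z - c).re| ≤ 11 / 2 := hz ▸ abs_re_le_norm _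
    rw [sub_re, hcre, abs_le] at h1
    refine (hb z (by linarith)).trans (le_max_of_le_right ?_)
    gcongr
    calc ‖z + 6‖ = ‖(z - c) + (9 + t * I)‖ := by rw [hc]; ring_nf
      _ ≤ 11 / 2 + (9 + t) := by
        refine (norm_add_le _ _).trans (add_le_add hz.le ((norm_add_le _ _).trans ?_))
        simp [abs_of_nonneg ht]
      _ ≤ t + 16 := by linarith
  have h := AnalyticOnNhd.sum_divisor_le (c := c) (r := 4) (R := 11 / 2) (M := M) (f := G)
    (by norm_num) (by norm_num [abs_of_pos]) (le_max_left _ _) (hG.analyticOnNhd _)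
    (norm_pos_iff.1 (by linarith)) hbd
  have h2 : ((∑ z ∈ u, (analyticOrderNatAt G z : ℤ) : ℤ) : ℝ) ≤
      (∑ᶠ z, MeromorphicOn.divisor G (closedBall c |(4 : ℝ)|) z : ℤ) := by
    have hfin := (MeromorphicOn.divisor G (closedBall c |(4 : ℝ)|)).finiteSupport
      (isCompact_closedBall ..)
    have hmem : ∀ z ∈ u, z ∈ closedBall c |(4 : ℝ)| := fun z hz => by
      rw [mem_closedBall, dist_eq_norm, abs_of_pos (by norm_num)]
      exact (hu z hz).2
    have hpos : ∀ z, 0 ≤ MeromorphicOn.divisor G (closedBall c |(4 : ℝ)|) z := fun z => by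
      by_cases hz : z ∈ closedBall c |(4 : ℝ)|
      · rw [hG.divisor_eq hz]; positivity
      · rw [Function.locallyFinsuppWithin.apply_eq_zero_of_notMem _ hz]
    rw [finsum_eq_sum_of_support_subset (s := hfin.toFinset ∪ u) _ (by intro z hz; simp_all)]
    rw [Finset.sum_congr rfl fun z hz => (hG.divisor_eq (hmem z hz)).symm]
    exact_mod_cast Finset.sum_le_sum_of_subset_of_nonneg Finset.subset_union_right
      fun z _ _ => hpos z
  push_cast at h2
  refine (h2.trans h).trans ?_
  rw [div_mul_eq_mul_div]
  gcongr
  have ht16 : 0 < t + 16 := by linarith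
  have hs1 : 1 ≤ √(t + 1) := Real.one_le_sqrt.2 (by linarith)
  have hM0 : 0 < M := lt_max_of_lt_left one_pos
  have e1 : Real.log (M / ‖G c‖) ≤ Real.log (3 * M) := by
    apply Real.log_le_log (by positivity)
    rw [div_le_iff₀ (by linarith)]
    nlinarith
  have e2 : Real.log (3 * M) ≤ Real.log 3 + |Real.log (3 * K)| + 4 * Real.log (t + 16) := by
    have h16 : 0 ≤ Real.log (t + 16) := Real.log_nonneg (by linarith)
    rcases max_cases 1 (K * (t + 16) ^ 4) with ⟨h, -⟩ | ⟨h, -⟩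
    · rw [hM, h, mul_one]
      linarith [abs_nonneg (Real.log (3 * K))]
    · rw [hM, h, ← mul_assoc, Real.log_mul (by positivity) (by positivity), Real.log_pow]
      have := le_abs_self (Real.log (3 * K))
      have := Real.log_nonneg (show (1 : ℝ) ≤ 3 by norm_num)
      push_cast
      linarith
  have e3 : Real.log (t + 16) ≤ 2 * √(t + 16) := by
    have := Real.log_le_sub_one_of_pos (Real.sqrt_pos.2 ht16)
    have h3 : Real.log (t + 16) = 2 * Real.log √(t + 16) := by
      rw [Real.log_sqrt ht16.le]; ring
    linarith
  have e4 : √(t + 16) ≤ 4 * √(t + 1) := by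
    rw [Real.sqrt_le_left (by positivity), mul_pow, Real.sq_sqrt (by linarith)]
    linarith
  have e5 : 0 ≤ Real.log 3 + |Real.log (3 * K)| := by positivity
  have e6 := le_mul_of_one_le_right e5 hs1
  calc _ ≤ Real.log 3 + |Real.log (3 * K)| + 4 * (2 * (4 * √(t + 1))) := by linarith
    _ ≤ (Real.log 3 + |Real.log (3 * K)|) * √(t + 1) + 4 * (2 * (4 * √(t + 1))) := by linarith
    _ = A * √(t + 1) := by rw [hA]; ring

end HasPolynomialGrowth

section lorentzWeight

variable {ρ : ℂ}

theorem lorentzWeight_nonneg (h0 : 0 ≤ ρ.re) (h1 : ρ.re ≤ 1) : 0 ≤ lorentzWeight ρ := by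
  have : 0 ≤ 1 - ρ.re := by linarith
  unfold lorentzWeight
  positivity

theorem lorentzWeight_le (h0 : 0 < ρ.re) (h1 : ρ.re < 1) (hi : 0 < ρ.im) :
    lorentzWeight ρ ≤ 2 / ρ.im ^ 2 := by
  have h : 0 < ρ.re * (1 - ρ.re) := mul_pos h0 (by linarith)
  have hi2 : 0 < ρ.im ^ 2 := by positivity
  unfold lorentzWeight
  rw [div_le_div_iff₀ (by positivity) hi2]
  have : 0 ≤ 4 * ρ.im ^ 2 * (1 / 2 - ρ.re) ^ 2 := by positivity
  nlinarith

/-- With `A = β(1 - β) + γ²`, the second term of the denominator is at most `γ² ≤ A`, so the weight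
is at least `2 / (A + 1)`, and `A ≤ 1/4 + T²`. -/
theorem le_lorentzWeight (h0 : 0 < ρ.re) (h1 : ρ.re < 1) (hi : 0 < ρ.im) {T : ℝ}
    (hT : ρ.im ≤ T) : 2 / (5 / 4 + T ^ 2) ≤ lorentzWeight ρ := by
  have h : 0 < ρ.re * (1 - ρ.re) := mul_pos h0 (by linarith)
  have h4 : ρ.re * (1 - ρ.re) ≤ 1 / 4 := by nlinarith [sq_nonneg (ρ.re - 1 / 2)]
  have hT2 : ρ.im ^ 2 ≤ T ^ 2 := by gcongr
  set A := ρ.re * (1 - ρ.re) + ρ.im ^ 2 with hA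
  have hA0 : 0 < A := by positivity
  have h5 : 4 * ρ.im ^ 2 * (1 / 2 - ρ.re) ^ 2 ≤ A := by
    have : 4 * (1 / 2 - ρ.re) ^ 2 ≤ 1 := by nlinarith
    nlinarith [sq_nonneg ρ.im]
  unfold lorentzWeight
  rw [← hA, div_le_div_iff₀ (by positivity) (by positivity)]
  nlinarith

end lorentzWeight

section multWeight

variable {f G : ℂ → ℂ}

theorem multWeight_nonneg {ρ : ℂ} (hρ : ρ ∈ upperZeros f) : 0 ≤ multWeight f ρ :=
  mul_nonneg (Nat.cast_nonneg _) (lorentzWeight_nonneg hρ.2.1.le hρ.2.2.1.le)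

theorem summable_multWeight (hG : HasPolynomialGrowth G) (h0 : ∀ ρ ∈ upperZeros f, G ρ = 0)
    (hord : ∀ ρ ∈ upperZeros f, analyticOrderNatAt f ρ = analyticOrderNatAt G ρ) :
    Summable (fun ρ : upperZeros f => multWeight f ρ) := by
  classical
  obtain ⟨C, hC0, hC⟩ := hG.exists_sum_order_le
  -- The bound `2 / γ²` is useless for `γ < 1`, but those zeros lie in one disc and are finite in
  -- number. Zeros with `⌊γ⌋ = n ≥ 1` contribute `O(√n / n²)`.
  set Z : Finset ℂ := (hG.finite_zeros (isCompact_closedBall (3 : ℂ) 4)).toFinset with hZ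
  set B : ℕ → ℝ := fun n => (if n = 0 then ∑ z ∈ Z, |multWeight f z| else 0) +
    2 * C * √2 * (1 / (n : ℝ) ^ (3 / 2 : ℝ)) with hB
  have hBsum : Summable B := by
    refine Summable.add ?_ ((Real.summable_one_div_nat_rpow.2 (by norm_num)).mul_left _)
    exact (hasSum_ite_eq 0 (∑ z ∈ Z, |multWeight f z|)).summable
  have hball : ∀ ρ ∈ upperZeros f, ‖ρ - (3 + (⌊ρ.im⌋₊ : ℝ) * I)‖ ≤ 4 := by
    intro ρ hρ
    have h1 := Nat.floor_le hρ.2.2.2.le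
    have h2 := Nat.lt_floor_add_one ρ.im
    rw [← sq_le_sq₀ (norm_nonneg _) (by norm_num), ← normSq_eq_norm_sq, normSq_apply]
    have := hρ.2.1
    have := hρ.2.2.1
    simp
    nlinarith
  refine summable_of_sum_le (c := ∑' n, B n) (fun ρ => multWeight_nonneg ρ.2) fun u => ?_
  have hmaps : ∀ ρ ∈ u, ⌊(ρ : ℂ).im⌋₊ ∈ u.image (fun ρ : upperZeros f => ⌊(ρ : ℂ).im⌋₊) :=
    fun ρ hρ => Finset.mem_image_of_mem _ hρ
  rw [← Finset.sum_fiberwise_of_maps_to hmaps]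
  have hBnn : ∀ n, 0 ≤ B n := fun n => by
    simp only [hB]
    refine add_nonneg ?_ (by positivity)
    split_ifs
    · exact Finset.sum_nonneg fun _ _ => abs_nonneg _
    · exact le_rfl
  refine (Finset.sum_le_sum fun n _ => ?_).trans (hBsum.sum_le_tsum _ fun n _ => hBnn n)
  set v := (u.filter fun ρ : upperZeros f => ⌊(ρ : ℂ).im⌋₊ = n).image Subtype.val with hv
  have hvsum : ∑ ρ ∈ u.filter (fun ρ : upperZeros f => ⌊(ρ : ℂ).im⌋₊ = n), multWeight f ρ = ∑ z ∈ v, multWeight f z := by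
    rw [hv, Finset.sum_image Subtype.val_injective.injOn]
  have hvmem : ∀ z ∈ v, z ∈ upperZeros f ∧ ⌊z.im⌋₊ = n := by
    intro z hz
    obtain ⟨ρ, hρ, rfl⟩ := Finset.mem_image.1 hz
    exact ⟨ρ.2, (Finset.mem_filter.1 hρ).2⟩
  rw [hvsum]
  rcases Nat.eq_zero_or_pos n with rfl | hn
  · have hsub : v ⊆ Z := by
      intro z hz
      obtain ⟨h1, h2⟩ := hvmem z hz
      have h3 := hball z h1
      rw [h2] at h3
      simp only [hZ, Set.Finite.mem_toFinset, mem_ofPred_eq, mem_closedBall, dist_eq_norm]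
      exact ⟨h0 z h1, by simpa using h3⟩
    calc ∑ z ∈ v, multWeight f z ≤ ∑ z ∈ v, |multWeight f z| :=
          Finset.sum_le_sum fun _ _ => le_abs_self _
      _ ≤ ∑ z ∈ Z, |multWeight f z| :=
          Finset.sum_le_sum_of_subset_of_nonneg hsub fun _ _ _ => abs_nonneg _
      _ ≤ B 0 := by
          simp only [hB, if_true]
          exact le_add_of_nonneg_right (by positivity)
  · have hn1 : (1 : ℝ) ≤ n := by exact_mod_cast hn
    have hn0 : (0 : ℝ) < n := by linarith
    have h4 : ∑ z ∈ v, (analyticOrderNatAt G z : ℝ) ≤ C * √(n + 1) := by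
      refine hC n (by positivity) v fun z hz => ?_
      obtain ⟨h1, h2⟩ := hvmem z hz
      have h3 := hball z h1
      rw [h2] at h3
      exact ⟨h0 z h1, h3⟩
    calc ∑ z ∈ v, multWeight f z
        ≤ ∑ z ∈ v, (analyticOrderNatAt G z : ℝ) * (2 / (n : ℝ) ^ 2) := by
          refine Finset.sum_le_sum fun z hz => ?_
          obtain ⟨h1, h2⟩ := hvmem z hz
          have h5 : (n : ℝ) ≤ z.im := h2 ▸ Nat.floor_le h1.2.2.2.le
          rw [multWeight, hord z h1]
          gcongr
          refine (lorentzWeight_le h1.2.1 h1.2.2.1 h1.2.2.2).trans ?_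
          gcongr
      _ = (∑ z ∈ v, (analyticOrderNatAt G z : ℝ)) * (2 / (n : ℝ) ^ 2) := by
          rw [Finset.sum_mul]
      _ ≤ (C * (√2 * √n)) * (2 / (n : ℝ) ^ 2) := by
          gcongr
          refine h4.trans ?_
          gcongr
          rw [← Real.sqrt_mul (by norm_num)]
          exact Real.sqrt_le_sqrt (by linarith)
      _ = 2 * C * √2 * (1 / (n : ℝ) ^ (3 / 2 : ℝ)) := by
          have : (n : ℝ) ^ 2 = (n : ℝ) ^ (3 / 2 : ℝ) * √n := by
            rw [Real.sqrt_eq_rpow, ← Real.rpow_add hn0]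
            norm_num
          rw [this]
          have := Real.sqrt_pos.2 hn0
          have := Real.rpow_pos_of_pos hn0 (3 / 2)
          field_simp
      _ ≤ B n := by
          simp only [hB, hn.ne', if_false, zero_add, le_refl]

end multWeight

section applications

theorem hasPolynomialGrowth_LFunctionTrivChar₁ :
    HasPolynomialGrowth (DirichletCharacter.LFunctionTrivChar₁ 1) where
  differentiable := DirichletCharacter.differentiable_LFunctionTrivChar₁ 1
  bound := DirichletCharacter.exists_norm_LFunctionTrivChar₁_le_polynomial
  lower := fun z hz => by
    have hz1 : z ≠ 1 := by rintro rfl; norm_num at hz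
    rw [DirichletCharacter.LFunctionTrivChar₁, Function.update_of_ne hz1, norm_mul]
    have h1 := DirichletCharacter.one_third_le_norm_LFunction (1 : DirichletCharacter ℂ 1) hz
    have h2 : 1 ≤ ‖z - 1‖ := by
      have := (le_abs_self _).trans (abs_re_le_norm (z - 1))
      simp at this
      linarith
    calc (1 / 3 : ℝ) = 1 * (1 / 3) := by ring
      _ ≤ _ := by gcongr

/-- The entire function `(z - 1) ζ(z)` stands in for zeta: the linear factor does not vanish at
zeros in the upper half-plane, so orders agree there. -/
theorem summable_multWeight_riemannZeta :
    Summable (fun ρ : upperZeros riemannZeta => multWeight riemannZeta ρ) := by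
  have heq : ∀ z : ℂ, z ≠ 1 → DirichletCharacter.LFunctionTrivChar₁ 1 z =
      (z - 1) * riemannZeta z := fun z hz => by
    rw [DirichletCharacter.LFunctionTrivChar₁, Function.update_of_ne hz,
      DirichletCharacter.LFunctionTrivChar, DirichletCharacter.LFunction_modOne_eq]
  have hne : ∀ ρ ∈ upperZeros riemannZeta, ρ ≠ 1 := by
    rintro ρ hρ rfl
    simpa using hρ.2.2.2
  refine summable_multWeight hasPolynomialGrowth_LFunctionTrivChar₁ (fun ρ hρ => ?_)
    fun ρ hρ => ?_
  · rw [heq ρ (hne ρ hρ), hρ.1, mul_zero]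
  · have h1 : DirichletCharacter.LFunctionTrivChar₁ 1 =ᶠ[𝓝 ρ]
        (fun z => z - 1) * riemannZeta := by
      filter_upwards [isOpen_ne.mem_nhds (hne ρ hρ)] with z hz
      exact heq z hz
    have hζ : AnalyticAt ℂ riemannZeta ρ := by
      rw [analyticAt_iff_eventually_differentiableAt]
      filter_upwards [isOpen_ne.mem_nhds (hne ρ hρ)] with z hz
      exact differentiableAt_riemannZeta hz
    have hlin : AnalyticAt ℂ (fun z : ℂ => z - 1) ρ := by fun_prop
    have h2 : analyticOrderAt (fun z : ℂ => z - 1) ρ = 0 :=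
      hlin.analyticOrderAt_eq_zero.2 (sub_ne_zero.2 (hne ρ hρ))
    rw [analyticOrderNatAt, analyticOrderNatAt, analyticOrderAt_congr h1,
      analyticOrderAt_mul hlin hζ, h2, zero_add]

variable {d : ℕ} [NeZero d]

theorem hasPolynomialGrowth_quadL (hd : Squarefree d) (h : 1 < d) :
    HasPolynomialGrowth (quadL d) where
  differentiable := DirichletCharacter.differentiable_LFunction (quadChar_ne_one hd h)
  bound := by
    obtain ⟨K, hK, hb⟩ := DirichletCharacter.exists_norm_LFunction_le_polynomial
    have : (0 : ℝ) < fundDisc d := by exact_mod_cast NeZero.pos (fundDisc d)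
    exact ⟨K * (fundDisc d) ^ 3, by positivity, hb _ (quadChar d) (isPrimitive_quadChar hd)
      even_quadChar inv_quadChar (quadChar_ne_one hd h)⟩
  lower := fun z hz => (quadChar d).one_third_le_norm_LFunction hz

theorem summable_multWeight_quadL (hd : Squarefree d) (h : 1 < d) :
    Summable (fun ρ : upperZeros (quadL d) => multWeight (quadL d) ρ) :=
  summable_multWeight (hasPolynomialGrowth_quadL hd h) (fun _ hρ => hρ.1) fun _ _ => rfl

end applications

end

/-! ### Zeros of `L(s, χ_d)` near every large height, uniformly in `d`. -/

section

open Complex Metric Set Filter Topology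

theorem Complex.exists_eqOn_exp_ball {f : ℂ → ℂ} {c : ℂ} {R : ℝ} (hR : 0 < R)
    (hf : DifferentiableOn ℂ f (ball c R)) (h0 : ∀ z ∈ ball c R, f z ≠ 0) :
    ∃ F : ℂ → ℂ, F c = log (f c) ∧ (∀ z ∈ ball c R, HasDerivAt F (deriv f z / f z) z) ∧
      ∀ z ∈ ball c R, exp (F z) = f z := by
  have hc : c ∈ ball c R := mem_ball_self hR
  obtain ⟨F, hF0, hF⟩ := ((hf.deriv isOpen_ball).div hf h0).isExactOn_ball.with_val_at c
    (log (f c))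
  refine ⟨F, hF0, hF, fun z hz => ?_⟩
  have hd : ∀ w ∈ ball c R, HasDerivAt (fun z => exp (F z) / f z) 0 w := fun w hw => by
    have h1 := (hF w hw).cexp.div (hf.differentiableAt (isOpen_ball.mem_nhds hw)).hasDerivAt
      (h0 w hw)
    have hw0 := h0 w hw
    refine HasDerivAt.congr_deriv h1 ?_
    simp only [Pi.div_apply]
    field_simp
    ring
  have h2 := isOpen_ball.is_const_of_deriv_eq_zero (convex_ball c R).isPreconnected
    (fun w hw => (hd w hw).differentiableAt.differentiableWithinAt)
    (fun w hw => (hd w hw).deriv) hz hc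
  simp only [hF0, exp_log (h0 c hc), div_self (h0 c hc)] at h2
  exact (div_eq_one_iff_eq (h0 z hz)).1 h2

theorem Complex.norm_log_le_of_norm_sub_one_le {w : ℂ} (hw : ‖w - 1‖ ≤ 65 / 100) :
    w ∈ slitPlane ∧ ‖log w‖ ≤ 6 := by
  have h1 : 1 / 3 ≤ ‖w‖ := by
    have := norm_sub_norm_le 1 w
    rw [norm_sub_rev, norm_one] at this
    linarith
  have h2 : ‖w‖ ≤ 2 := by
    have := norm_sub_norm_le w 1
    rw [norm_one] at this
    linarith
  refine ⟨Or.inl ?_, ?_⟩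
  · have := (abs_le.1 (abs_re_le_norm (w - 1))).1
    simp at this
    linarith
  · have h3 : |Real.log ‖w‖| ≤ 2 := by
      rw [abs_le]
      constructor
      · have := Real.one_sub_inv_le_log_of_pos (by linarith : 0 < ‖w‖)
        have h4 : ‖w‖⁻¹ ≤ 3 := by
          rw [inv_le_comm₀ (by linarith) (by norm_num)]
          linarith
        linarith
      · have := Real.log_le_sub_one_of_pos (by linarith : 0 < ‖w‖)
        linarith
    have h4 := abs_arg_le_pi w
    have h5 := norm_le_abs_re_add_abs_im (log w)
    rw [log_re, log_im] at h5
    linarith [Real.pi_lt_four]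

/-- A holomorphic function without zeros on a disc which is close to one near the centre is much
smaller in logarithmic size on an intermediate disc than on the whole disc. -/
theorem Complex.exists_log_norm_le_of_ne_zero (ε : ℝ) (hε : 0 < ε) : ∃ C : ℝ,
    ∀ (f : ℂ → ℂ) (A : ℝ), 0 ≤ A → DifferentiableOn ℂ f (ball 0 (11 / 2)) →
      (∀ z ∈ ball (0 : ℂ) (11 / 2), f z ≠ 0 ∧ Real.log ‖f z‖ ≤ A) →
      (∀ z ∈ ball (0 : ℂ) 1, ‖f z - 1‖ ≤ 65 / 100) →
      ∀ z : ℂ, ‖z‖ ≤ 9 / 2 → Real.log ‖f z‖ ≤ C + ε * A := by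
  obtain ⟨m, hm⟩ := exists_pow_lt_of_lt_one (div_pos hε (by norm_num : (0 : ℝ) < 200))
    (by norm_num : (9 / 10 : ℝ) < 1)
  refine ⟨∑ n ∈ Finset.range m, 12 * (9 : ℝ) ^ n + 200 * 6 + 6,
    fun f A hA hf hb hone z hz => ?_⟩
  have hsub : ∀ {w : ℂ} {r : ℝ}, ‖w‖ < r → w ∈ ball (0 : ℂ) r := fun h => by simpa using h
  have h0 := hsub (w := 0) (r := 11 / 2) (by norm_num)
  obtain ⟨F, hF0, hF, hexp⟩ := exists_eqOn_exp_ball (by norm_num) hf fun z hz => (hb z hz).1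
  have hre : ∀ w ∈ ball (0 : ℂ) (11 / 2), (F w).re = Real.log ‖f w‖ := fun w hw => by
    rw [← hexp w hw, norm_exp, Real.log_exp]
  have hF0' : ‖F 0‖ ≤ 6 := hF0 ▸ (norm_log_le_of_norm_sub_one_le (hone 0 (by simp))).2
  set G : ℂ → ℂ := fun w => F w - F 0 with hG
  have hGd : DifferentiableOn ℂ G (ball 0 (11 / 2)) := fun w hw =>
    ((hF w hw).differentiableAt.sub_const _).differentiableWithinAt
  have hG0 : G 0 = 0 := sub_self _
  have hGre : MapsTo G (ball 0 (11 / 2)) {w | w.re ≤ A + 6} := fun w hw => by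
    have h1 := (hb w hw).2
    have h2 := (neg_le_abs _).trans ((abs_re_le_norm (F 0)).trans hF0')
    simp only [hG, mem_ofPred_eq, sub_re, hre w hw]
    linarith
  -- Borel–Carathéodory from radius `11 / 2` to radius `5` costs the factor `2 · 5 / (1/2) = 20`.
  have hG5 : ∀ w ∈ sphere (0 : ℂ) 5, ‖G w‖ ≤ 20 * (A + 6) := fun w hw => by
    have hw5 : ‖w‖ = 5 := by simpa using hw
    have := borelCaratheodory_zero (by linarith : 0 < A + 6) hGd hGre (by norm_num)
      (hsub (by rw [hw5]; norm_num)) hG0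
    rw [hw5] at this
    exact this.trans_eq (by ring)
  -- On the unit disc `f` stays in the slit plane, so the chosen branch is the principal logarithm
  -- there and is bounded independently of `A`.
  have hlog : EqOn F (fun w => log (f w)) (ball 0 1) := by
    have hmono : ball (0 : ℂ) 1 ⊆ ball 0 (11 / 2) := ball_subset_ball (by norm_num)
    have hd : ∀ w ∈ ball (0 : ℂ) 1, HasDerivAt (fun w => log (f w)) (deriv f w / f w) w :=
      fun w hw => (hf.differentiableAt (isOpen_ball.mem_nhds (hmono hw))).hasDerivAt.clog
        (norm_log_le_of_norm_sub_one_le (hone w hw)).1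
    exact isOpen_ball.eqOn_of_deriv_eq (convex_ball _ _).isPreconnected
      (fun w hw => (hF w (hmono hw)).differentiableAt.differentiableWithinAt)
      (fun w hw => (hd w hw).differentiableAt.differentiableWithinAt)
      (fun w hw => by rw [(hF w (hmono hw)).deriv, (hd w hw).deriv])
      (mem_ball_self one_pos) hF0
  have hG1 : ∀ w ∈ sphere (0 : ℂ) (1 / 2), ‖G w‖ ≤ 12 := fun w hw => by
    have hw1 : w ∈ ball (0 : ℂ) 1 := hsub (by
      have : ‖w‖ = 1 / 2 := by simpa using hw
      rw [this]; norm_num)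
    refine (norm_sub_le _ _).trans ?_
    rw [hlog hw1]
    linarith [(norm_log_le_of_norm_sub_one_le (hone w hw1)).2]
  have hdc : ∀ r : ℝ, r < 11 / 2 → DiffContOnCl ℂ G (ball 0 r) := fun r hr =>
    (hGd.mono ((closure_ball_subset_closedBall).trans
      (closedBall_subset_ball hr))).diffContOnCl
  have hsum := hasSum_taylorSeries_on_ball hGd (hsub (hz.trans_lt (by norm_num)))
  simp only [sub_zero, smul_eq_mul] at hsum
  -- Cauchy's estimates bound the Taylor terms at `z` in two ways: radius `5` gives geometric decay
  -- with a factor `A + 6`, radius `1 / 2` gives geometric growth free of `A`. The second is used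
  -- for `n < m`, the first for the tail, where `(9/10) ^ m < ε / 200`.
  set a : ℕ → ℂ := fun n => (n.factorial : ℂ)⁻¹ * (z ^ n * iteratedDeriv n G 0) with ha
  have hcoef : ∀ (r B : ℝ) (n : ℕ), 0 < r → r < 11 / 2 → (∀ w ∈ sphere (0 : ℂ) r, ‖G w‖ ≤ B) →
      0 ≤ B → ‖a n‖ ≤ B * (9 / 2 / r) ^ n := fun r B n hr hr' hB hB0 => by
    have h1 := norm_iteratedDeriv_le_of_forall_mem_sphere_norm_le n hr (hdc r hr') hB
    have h2 : (0 : ℝ) < n.factorial := by exact_mod_cast n.factorial_pos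
    simp only [ha, norm_mul, norm_inv, norm_natCast, norm_pow]
    calc (n.factorial : ℝ)⁻¹ * (‖z‖ ^ n * ‖iteratedDeriv n G 0‖)
        ≤ (n.factorial : ℝ)⁻¹ * ((9 / 2) ^ n * (n.factorial * B / r ^ n)) := by gcongr
      _ = B * (9 / 2 / r) ^ n := by
          rw [div_pow (9 / 2) r]
          generalize (9 / 2 : ℝ) ^ n = q
          field_simp
  have hbig : ∀ n, ‖a n‖ ≤ 20 * (A + 6) * (9 / 10) ^ n := fun n => by
    have := hcoef 5 _ n (by norm_num) (by norm_num) hG5 (by linarith)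
    norm_num at this ⊢
    exact this
  have hsmall : ∀ n, ‖a n‖ ≤ 12 * 9 ^ n := fun n => by
    have := hcoef (1 / 2) _ n (by norm_num) (by norm_num) hG1 (by norm_num)
    norm_num at this ⊢
    exact this
  have htail : ‖∑' n, a (n + m)‖ ≤ 200 * (A + 6) * (9 / 10) ^ m := by
    have hgeo := (hasSum_geometric_of_lt_one (r := (9 / 10 : ℝ)) (by norm_num)
      (by norm_num)).mul_left (20 * (A + 6) * (9 / 10) ^ m)
    refine (tsum_of_norm_bounded hgeo fun n => (hbig _).trans_eq (by ring)).trans_eq ?_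
    norm_num
    ring
  have hGz : ‖G z‖ ≤ ∑ n ∈ Finset.range m, 12 * (9 : ℝ) ^ n + 200 * (A + 6) * (9 / 10) ^ m := by
    rw [← hsum.tsum_eq, ← hsum.summable.sum_add_tsum_nat_add m]
    refine (norm_add_le _ _).trans (add_le_add ?_ htail)
    exact (norm_sum_le _ _).trans (Finset.sum_le_sum fun n _ => hsmall n)
  have hz' := hsub (hz.trans_lt (by norm_num : (9 / 2 : ℝ) < 11 / 2))
  rw [← hre z hz']
  have h1 : (F z).re ≤ ‖G z‖ + ‖F 0‖ := by
    have e : F z = G z + F 0 := by simp [hG]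
    rw [e]
    exact (re_le_norm _).trans (norm_add_le _ _)
  have h2 : 200 * (A + 6) * (9 / 10) ^ m ≤ ε * A + 200 * 6 := by
    have h3 : (9 / 10 : ℝ) ^ m ≤ 1 := pow_le_one₀ (by norm_num) (by norm_num)
    have h4 : 200 * (9 / 10 : ℝ) ^ m ≤ ε := by
      rw [lt_div_iff₀ (by norm_num)] at hm
      linarith
    nlinarith
  linarith

section

variable {d : ℕ} [NeZero d]

theorem mem_upperZeros_quadL (hd : Squarefree d) (h : 1 < d) {z : ℂ} (hz : quadL d z = 0)
    (him : 0 < z.im) : z ∈ upperZeros (quadL d) := by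
  have h1 : ∀ {w : ℂ}, 1 ≤ w.re → quadL d w ≠ 0 := fun hw =>
    DirichletCharacter.LFunction_ne_zero_of_one_le_re _ (Or.inl (quadChar_ne_one hd h)) hw
  refine ⟨hz, ?_, ?_, him⟩
  · by_contra! hre
    have hz0 : z ≠ 0 := by rintro rfl; simp at him
    have h2 := DirichletCharacter.norm_LFunction_eq_norm_one_sub (isPrimitive_quadChar hd)
      even_quadChar inv_quadChar (by linarith : z.re < 1) hz0
    have h3 : quadL d (1 - z) ≠ 0 := h1 (by simpa using hre)
    have h4 : Gammaℝ (1 - z) ≠ 0 := Gammaℝ_ne_zero_of_re_pos (by simp; linarith)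
    have h5 : Gammaℝ z ≠ 0 := by
      rw [Ne, Gammaℝ_eq_zero_iff]
      rintro ⟨n, rfl⟩
      simp at him
    have hN : (0 : ℝ) < fundDisc d := by exact_mod_cast NeZero.pos (fundDisc d)
    change ‖quadL d z‖ = _ * ‖quadL d (1 - z)‖ at h2
    rw [hz, norm_zero] at h2
    have : 0 < (fundDisc d : ℝ) ^ (1 / 2 - z.re) * ‖Gammaℝ (1 - z) / Gammaℝ z‖ *
      ‖quadL d (1 - z)‖ :=
      mul_pos (mul_pos (Real.rpow_pos_of_pos hN _) (norm_pos_iff.2 (div_ne_zero h4 h5)))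
        (norm_pos_iff.2 h3)
    exact this.ne h2
  · by_contra! hre
    exact h1 hre hz

end

/-- Put `ℓ = log (N (t + 16))`. Without zeros nearby, `log |L| ≤ 4 ℓ + O(1)` on the disc of radius
`11 / 2` about `3 + t i`, and the preceding lemma with `ε = 1/4` improves this to `ℓ + O(1)` on `Re
z = -3/2`. The functional equation forces `log |L| ≥ 2 ℓ - O(1)` there, so `ℓ` would be bounded. The
conductor enters only through `ℓ`, hence the uniformity. -/
theorem exists_mem_upperZeros_quadL_near : ∃ T₁ : ℝ, 6 ≤ T₁ ∧ ∀ (d : ℕ) [NeZero d],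
    Squarefree d → 1 < d → ∀ t : ℝ, T₁ ≤ t → ∃ ρ ∈ upperZeros (quadL d), |ρ.im - t| < 6 := by
  obtain ⟨K, hK, hpoly⟩ := DirichletCharacter.exists_norm_LFunction_le_polynomial
  obtain ⟨C, hC⟩ := Complex.exists_log_norm_le_of_ne_zero (1 / 4) (by norm_num)
  set B : ℝ := C + 1 / 4 * |Real.log K| + Real.log 2000 with hB
  refine ⟨max 6 (Real.exp (B + 1)), le_max_left _ _, fun d _ hd h t ht => ?_⟩
  have ht6 : 6 ≤ t := (le_max_left _ _).trans ht
  by_contra! hno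
  set N : ℝ := ((fundDisc d : ℕ) : ℝ) with hN
  have hN1 : 1 ≤ N := by
    rw [hN, Nat.one_le_cast]
    exact NeZero.pos (fundDisc d)
  set c : ℂ := 3 + t * I with hc
  have hcre : c.re = 3 := by simp [hc]
  have hcim : c.im = t := by simp [hc]
  set ℓ : ℝ := Real.log (N * (t + 16)) with hℓ
  have hℓ0 : 0 ≤ ℓ := Real.log_nonneg (by nlinarith)
  have hre : ∀ w : ℂ, ‖w‖ < 11 / 2 → -5 / 2 ≤ (c + w).re ∧ |(c + w).im - t| < 6 := fun w hw => by
    have h1 := (abs_le.1 (abs_re_le_norm w)).1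
    have h2 := (abs_im_le_norm w)
    rw [add_re, add_im, hcre, hcim, add_sub_cancel_left]
    exact ⟨by linarith, by linarith⟩
  have hne : ∀ w : ℂ, ‖w‖ < 11 / 2 → quadL d (c + w) ≠ 0 := fun w hw h0 => by
    have h1 := (hre w hw).2
    refine absurd h1 (not_lt.2 (hno _ (mem_upperZeros_quadL hd h h0 ?_)))
    linarith [(abs_lt.1 h1).1]
  have hup : ∀ w : ℂ, ‖w‖ < 11 / 2 → Real.log ‖quadL d (c + w)‖ ≤ |Real.log K| + 4 * ℓ :=
    fun w hw => by
      have h1 := hpoly _ (quadChar d) (isPrimitive_quadChar hd) even_quadChar inv_quadChar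
        (quadChar_ne_one hd h) (c + w) (hre w hw).1
      have h2 : ‖c + w + 6‖ ≤ t + 16 := by
        calc ‖c + w + 6‖ = ‖(9 + t * I) + w‖ := by rw [hc]; ring_nf
          _ ≤ (9 + t) + 11 / 2 := by
            refine (norm_add_le _ _).trans (add_le_add ((norm_add_le _ _).trans ?_) hw.le)
            simp [abs_of_nonneg (by linarith : 0 ≤ t)]
          _ ≤ t + 16 := by linarith
      have h3 : ‖quadL d (c + w)‖ ≤ K * (N * (t + 16)) ^ 4 := by
        refine h1.trans ?_
        rw [mul_pow, ← mul_assoc]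
        gcongr
        norm_num
      have h4 := Real.log_le_log (norm_pos_iff.2 (hne w hw)) h3
      rw [Real.log_mul hK.ne' (by positivity), Real.log_pow] at h4
      push_cast at h4
      linarith [le_abs_self (Real.log K)]
  -- The displacement `-9 / 2` leads from the centre, of real part `3`, to the line `Re z = -3/2`,
  -- where the gamma quotient is explicit.
  have hkey := hC (fun w => quadL d (c + w)) (|Real.log K| + 4 * ℓ) (by positivity)
    (((hasPolynomialGrowth_quadL hd h).differentiable.comp
      (differentiable_id.const_add c)).differentiableOn)
    (fun w hw => ⟨hne w (by simpa using hw), hup w (by simpa using hw)⟩)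
    (fun w hw => ?_) (-9 / 2) (by norm_num)
  swap
  · refine (quadChar d).norm_LFunction_sub_one_le ?_
    have h1 := (abs_le.1 (abs_re_le_norm w)).1
    have h2 : ‖w‖ < 1 := by simpa using hw
    rw [add_re, hcre]
    linarith
  set z : ℂ := c + -9 / 2 with hz
  have hzre : z.re = -3 / 2 := by
    rw [hz, add_re, hcre]; norm_num
  have hzim : z.im = t := by
    rw [hz, add_im, hcim]; norm_num
  have hFE := DirichletCharacter.norm_LFunction_eq_norm_one_sub (isPrimitive_quadChar hd)
    even_quadChar inv_quadChar (by linarith : z.re < 1) (by intro h0; norm_num [h0] at hzre)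
  rw [norm_Gammaℝ_one_sub_div hzre, hzre, show (1 / 2 - -3 / 2 : ℝ) = (2 : ℕ) by norm_num,
    Real.rpow_natCast] at hFE
  have hlow : (N * (t + 16)) ^ 2 / 2000 ≤ ‖quadL d z‖ := by
    rw [quadL, hFE]
    have h1 := (quadChar d).one_third_le_norm_LFunction (s := 1 - z) (by simp [hzre]; norm_num)
    have h2 : t ≤ ‖z‖ := by
      have := (le_abs_self _).trans (abs_im_le_norm z)
      rwa [hzim] at this
    have h3 : t ≤ ‖z + 2‖ := by
      have := (le_abs_self _).trans (abs_im_le_norm (z + 2))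
      rwa [add_im, im_ofNat, add_zero, hzim] at this
    have h4 : (2 * Real.pi) ^ 2 ≤ 40 := by nlinarith [Real.pi_lt_d2, Real.pi_gt_three]
    have h5 : (t + 16) ^ 2 / 2000 ≤ t * t / 40 * (1 / 3) := by nlinarith
    calc (N * (t + 16)) ^ 2 / 2000 = N ^ 2 * ((t + 16) ^ 2 / 2000) := by ring
      _ ≤ N ^ 2 * (t * t / 40 * (1 / 3)) := by gcongr
      _ = N ^ 2 * (t * t / 40) * (1 / 3) := by ring
      _ ≤ N ^ 2 * (‖z‖ * ‖z + 2‖ / (2 * Real.pi) ^ 2) *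
          ‖DirichletCharacter.LFunction (quadChar d) (1 - z)‖ := by gcongr
  have h1 := Real.log_le_log (by positivity) hlow
  rw [Real.log_div (by positivity) (by norm_num), Real.log_pow] at h1
  push_cast at h1
  have h2 : ℓ ≤ B := by
    linarith
  have h3 : B + 1 ≤ ℓ := by
    rw [hℓ, Real.le_log_iff_exp_le (by positivity)]
    have := (le_max_right _ _).trans ht
    nlinarith
  linarith

end

/-! ### Enumeration of the ordinates and lower bounds for their weights. -/

section

open Complex Metric Set Filter Topology

theorem isLeast_sInf_of_finite {S : Set ℝ} (hS : S.Nonempty) (hfin : ∀ T, {x ∈ S | x ≤ T}.Finite) :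
    IsLeast S (sInf S) := by
  obtain ⟨x₀, hx₀⟩ := hS
  obtain ⟨m, hm⟩ := (hfin x₀).exists_minimal ⟨x₀, hx₀, le_rfl⟩
  have : IsLeast S m := by
    refine ⟨hm.prop.1, fun x hx => ?_⟩
    by_contra! hlt
    exact hlt.not_ge (hm.le_of_le ⟨hx, hlt.le.trans hm.prop.2⟩ hlt.le)
  rwa [this.csInf_eq]

section

variable {f : ℂ → ℂ}

/-- There are infinitely many zeros of `f` in the upper half of the critical strip, and their
weights are summable. -/
structure HasInfinitelyManyOrdinates (f : ℂ → ℂ) : Prop where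
  summable : Summable (fun ρ : upperZeros f => multWeight f ρ)
  order_pos : ∀ ρ ∈ upperZeros f, 1 ≤ analyticOrderNatAt f ρ
  exists_gt : ∀ T : ℝ, ∃ x ∈ ordinateSet f, T < x

namespace HasInfinitelyManyOrdinates

theorem le_multWeight (hf : HasInfinitelyManyOrdinates f) {ρ : ℂ} (hρ : ρ ∈ upperZeros f) {T : ℝ}
    (hT : ρ.im ≤ T) : 2 / (5 / 4 + T ^ 2) ≤ multWeight f ρ := by
  refine (le_lorentzWeight hρ.2.1 hρ.2.2.1 hρ.2.2.2 hT).trans ?_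
  refine le_mul_of_one_le_left (lorentzWeight_nonneg hρ.2.1.le hρ.2.2.1.le) ?_
  exact_mod_cast hf.order_pos ρ hρ

/-- Zeros up to height `T` have weights bounded below by a positive constant, so summability leaves
only finitely many. -/
theorem finite_ordinateSet_le (hf : HasInfinitelyManyOrdinates f) (T : ℝ) :
    {x ∈ ordinateSet f | x ≤ T}.Finite := by
  have hc : 0 < 2 / (5 / 4 + T ^ 2) := by positivity
  have h1 := hf.summable.tendsto_cofinite_zero.eventually (gt_mem_nhds hc)
  rw [Filter.eventually_cofinite] at h1
  refine (h1.image fun ρ : upperZeros f => (ρ : ℂ).im).subset ?_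
  rintro x ⟨⟨ρ, hρ, rfl⟩, hx⟩
  exact ⟨⟨ρ, hρ⟩, not_lt.2 (hf.le_multWeight hρ hx), rfl⟩

theorem isLeast_ordinate_zero (hf : HasInfinitelyManyOrdinates f) :
    IsLeast (ordinateSet f) (ordinate f 0) :=
  isLeast_sInf_of_finite ((hf.exists_gt 0).imp fun _ h => h.1) hf.finite_ordinateSet_le

theorem isLeast_ordinate_succ (hf : HasInfinitelyManyOrdinates f) (k : ℕ) :
    IsLeast {γ | γ ∈ ordinateSet f ∧ ordinate f k < γ} (ordinate f (k + 1)) :=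
  isLeast_sInf_of_finite (hf.exists_gt _) fun T =>
    (hf.finite_ordinateSet_le T).subset fun _ h => ⟨h.1.1, h.2⟩

theorem ordinate_mem (hf : HasInfinitelyManyOrdinates f) : ∀ k, ordinate f k ∈ ordinateSet f
  | 0 => hf.isLeast_ordinate_zero.1
  | k + 1 => (hf.isLeast_ordinate_succ k).1.1

theorem strictMono_ordinate (hf : HasInfinitelyManyOrdinates f) : StrictMono (ordinate f) :=
  strictMono_nat_of_lt_succ fun k => (hf.isLeast_ordinate_succ k).1.2

/-- An ordinate missed by the enumeration would have infinitely many ordinates below it. -/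
theorem range_ordinate (hf : HasInfinitelyManyOrdinates f) :
    range (ordinate f) = ordinateSet f := by
  refine Subset.antisymm (range_subset_iff.2 hf.ordinate_mem) fun x hx => ?_
  by_contra hne
  have hlt : ∀ k, ordinate f k < x := by
    intro k
    induction k with
    | zero => exact lt_of_le_of_ne (hf.isLeast_ordinate_zero.2 hx) fun h => hne ⟨0, h⟩
    | succ k ih =>
      exact lt_of_le_of_ne ((hf.isLeast_ordinate_succ k).2 ⟨hx, ih⟩) fun h => hne ⟨k + 1, h⟩
  exact Set.infinite_range_of_injective hf.strictMono_ordinate.injective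
    ((hf.finite_ordinateSet_le x).subset
      (range_subset_iff.2 fun k => ⟨hf.ordinate_mem k, (hlt k).le⟩))

theorem ordinate_le_of_strictMono (hf : HasInfinitelyManyOrdinates f) {x : ℕ → ℝ}
    (hx : StrictMono x) (hmem : ∀ k, x k ∈ ordinateSet f) (k : ℕ) : ordinate f k ≤ x k := by
  induction k with
  | zero => exact hf.isLeast_ordinate_zero.2 (hmem 0)
  | succ k ih =>
    exact (hf.isLeast_ordinate_succ k).2 ⟨hmem _, ih.trans_lt (hx k.lt_succ_self)⟩

theorem tsum_fiber (f : ℂ → ℂ) (k : ℕ) (δ : ℝ) :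
    ∑' ρ : {ρ : ℂ // ρ ∈ upperZeros f ∧ ρ.im = ordinate f k},
      multWeight f ρ * Real.cos ((ρ : ℂ).im * δ) =
    ordinateWeight f k * Real.cos (ordinate f k * δ) := by
  rw [ordinateWeight, ← tsum_mul_right]
  exact tsum_congr fun ρ => by rw [ρ.2.2]

theorem summable_mul_cos (hf : HasInfinitelyManyOrdinates f) (δ : ℝ) :
    Summable (fun ρ : upperZeros f => multWeight f ρ * Real.cos ((ρ : ℂ).im * δ)) :=
  Summable.of_norm_bounded hf.summable fun ρ => by
    rw [norm_mul, Real.norm_of_nonneg (multWeight_nonneg ρ.2)]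
    exact mul_le_of_le_one_right (multWeight_nonneg ρ.2) (Real.abs_cos_le_one _)

theorem hasSum_ordinateWeight_mul_cos (hf : HasInfinitelyManyOrdinates f) (δ : ℝ) :
    HasSum (fun k => ordinateWeight f k * Real.cos (ordinate f k * δ)) (shiftedSum f δ) := by
  have hex : ∀ ρ : upperZeros f, ∃ k, ordinate f k = (ρ : ℂ).im := fun ρ => by
    have : (ρ : ℂ).im ∈ range (ordinate f) := by
      rw [hf.range_ordinate]
      exact ⟨ρ, ρ.2, rfl⟩
    exact this
  choose g hg using hex
  have h := (hf.summable_mul_cos δ).hasSum.tsum_fiberwise g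
  suffices heq : (fun k => ordinateWeight f k * Real.cos (ordinate f k * δ)) = fun k =>
      ∑' ρ : ↥(g ⁻¹' {k}), multWeight f (ρ : upperZeros f) *
        Real.cos (((ρ : upperZeros f) : ℂ).im * δ) by
    rw [heq]; exact h
  funext k
  rw [← tsum_fiber f k δ]
  have hiff : ∀ ρ : upperZeros f, g ρ = k ↔ (ρ : ℂ).im = ordinate f k := fun ρ => by
    rw [← hg ρ, hf.strictMono_ordinate.injective.eq_iff]
  let e : {ρ : ℂ // ρ ∈ upperZeros f ∧ ρ.im = ordinate f k} ≃ ↥(g ⁻¹' {k}) :=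
    { toFun := fun ρ => ⟨⟨ρ, ρ.2.1⟩, (hiff _).2 ρ.2.2⟩
      invFun := fun ρ => ⟨ρ.1, ρ.1.2, (hiff _).1 ρ.2⟩
      left_inv := fun _ => rfl
      right_inv := fun _ => rfl }
  exact e.tsum_eq fun ρ : ↥(g ⁻¹' {k}) =>
    multWeight f (ρ : upperZeros f) * Real.cos (((ρ : upperZeros f) : ℂ).im * δ)

theorem summable_ordinateWeight (hf : HasInfinitelyManyOrdinates f) :
    Summable (ordinateWeight f) := by
  simpa using (hf.hasSum_ordinateWeight_mul_cos 0).summable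

theorem le_tsum_multWeight (hf : HasInfinitelyManyOrdinates f) {γ T : ℝ}
    (hγ : γ ∈ ordinateSet f) (hT : γ ≤ T) :
    2 / (5 / 4 + T ^ 2) ≤ ∑' ρ : {ρ : ℂ // ρ ∈ upperZeros f ∧ ρ.im = γ}, multWeight f ρ := by
  obtain ⟨ρ, hρ, him⟩ := hγ
  let i : {ρ : ℂ // ρ ∈ upperZeros f ∧ ρ.im = γ} → upperZeros f := fun ρ => ⟨ρ.1, ρ.2.1⟩
  have hinj : Function.Injective i := fun a b h =>
    Subtype.ext (show (i a).val = (i b).val from congrArg _ h)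
  have hs : Summable (fun ρ : {ρ : ℂ // ρ ∈ upperZeros f ∧ ρ.im = γ} => multWeight f ρ) := by
    have := hf.summable.comp_injective hinj
    simpa only [Function.comp_def] using this
  exact (hf.le_multWeight hρ (him.le.trans hT)).trans
    (hs.le_tsum ⟨ρ, hρ, him⟩ fun j _ => multWeight_nonneg j.2.1)

theorem le_ordinateWeight (hf : HasInfinitelyManyOrdinates f) {k : ℕ} {T : ℝ}
    (hT : ordinate f k ≤ T) : 2 / (5 / 4 + T ^ 2) ≤ ordinateWeight f k := by
  rw [ordinateWeight]
  exact hf.le_tsum_multWeight (hf.ordinate_mem k) hT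

theorem ordinateWeight_pos (hf : HasInfinitelyManyOrdinates f) (k : ℕ) :
    0 < ordinateWeight f k :=
  lt_of_lt_of_le (by positivity) (hf.le_ordinateWeight le_rfl)

end HasInfinitelyManyOrdinates

end

/-- Windows of half-width `6` about points spaced `12` apart are disjoint, so one ordinate from each
gives an increasing sequence, with `T₁` independent of `d`. -/
theorem exists_strictMono_mem_ordinateSet_quadL : ∃ T₁ : ℝ, ∀ (d : ℕ) [NeZero d],
    Squarefree d → 1 < d → ∃ x : ℕ → ℝ, StrictMono x ∧ (∀ k, x k ∈ ordinateSet (quadL d)) ∧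
      ∀ k, |x k - (T₁ + 12 * k)| < 6 := by
  obtain ⟨T₁, -, h⟩ := exists_mem_upperZeros_quadL_near
  refine ⟨T₁, fun d _ hd hd1 => ?_⟩
  choose ρ hρ hlt using fun k : ℕ => h d hd hd1 (T₁ + 12 * k)
    (le_add_of_nonneg_right (by positivity))
  refine ⟨fun k => (ρ k).im, strictMono_nat_of_lt_succ fun k => ?_, fun k => ⟨_, hρ k, rfl⟩, hlt⟩
  have h1 := abs_lt.1 (hlt k)
  have h2 := abs_lt.1 (hlt (k + 1))
  push_cast at h2
  linarith

theorem hasInfinitelyManyOrdinates_quadL {d : ℕ} [NeZero d] (hd : Squarefree d) (h : 1 < d) :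
    HasInfinitelyManyOrdinates (quadL d) where
  summable := summable_multWeight_quadL hd h
  order_pos := fun _ hρ => (hasPolynomialGrowth_quadL hd h).analyticOrderNatAt_pos hρ.1
  exists_gt := fun T => by
    obtain ⟨T₁, hT⟩ := exists_strictMono_mem_ordinateSet_quadL
    obtain ⟨x, -, hx, hlt⟩ := hT d hd h
    obtain ⟨k, hk⟩ := exists_nat_gt (T + 6 - T₁)
    refine ⟨x k, hx k, ?_⟩
    have h1 := abs_lt.1 (hlt k)
    have : (0 : ℝ) ≤ k := by positivity
    linarith

/-- The first `n` ordinates lie below a height that depends only on `n`. This is the source of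
uniformity in `d` for the bounded-rank estimate. -/
theorem exists_le_ordinateWeight_quadL (n : ℕ) : ∃ c : ℝ, 0 < c ∧ ∀ (d : ℕ) [NeZero d],
    Squarefree d → 1 < d → ∀ k < n, c ≤ ordinateWeight (quadL d) k := by
  obtain ⟨T₁, hT⟩ := exists_strictMono_mem_ordinateSet_quadL
  refine ⟨2 / (5 / 4 + (T₁ + 12 * n + 6) ^ 2), by positivity, fun d _ hd h k hk => ?_⟩
  have hf := hasInfinitelyManyOrdinates_quadL hd h
  obtain ⟨x, hx, hmem, hlt⟩ := hT d hd h
  refine hf.le_ordinateWeight ((hf.ordinate_le_of_strictMono hx hmem k).trans ?_)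
  have h1 := abs_lt.1 (hlt k)
  have : (k : ℝ) ≤ n := by exact_mod_cast hk.le
  linarith

end

/-! ### Relation measures and equidistribution of a line in the torus. -/

section

open MeasureTheory UnitAddTorus Filter Topology

section Torus

variable {ι : Type*}

/-- The point of the torus with angles `v`. -/
noncomputable def torusMk (v : ι → ℝ) : UnitAddTorus ι :=
  fun k => ((v k / (2 * Real.pi) : ℝ) : UnitAddCircle)

theorem torusMk_apply (v : ι → ℝ) (k : ι) :
    torusMk v k = ((v k / (2 * Real.pi) : ℝ) : UnitAddCircle) := rfl

theorem torusMk_zero : torusMk (0 : ι → ℝ) = 0 := by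
  ext k; simp [torusMk]

theorem torusMk_add (v w : ι → ℝ) : torusMk (v + w) = torusMk v + torusMk w := by
  funext k
  simp only [torusMk, Pi.add_apply, add_div]
  exact AddCircle.coe_add _ _ _

theorem continuous_torusMk : Continuous (torusMk (ι := ι)) := by
  unfold torusMk
  refine continuous_pi fun k => ?_
  exact (AddCircle.continuous_mk' (1 : ℝ)).comp (by fun_prop)

theorem fourier_coe_angle (n : ℤ) (x : ℝ) :
    fourier n ((x / (2 * Real.pi) : ℝ) : UnitAddCircle) = Complex.exp (n * x * Complex.I) := by
  rw [fourier_coe_apply]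
  congr 1
  have : (Real.pi : ℂ) ≠ 0 := by exact_mod_cast Real.pi_ne_zero
  push_cast
  field_simp

variable [Fintype ι]

theorem mFourier_apply_add (n : ι → ℤ) (x y : UnitAddTorus ι) :
    mFourier n (x + y) = mFourier n x * mFourier n y := by
  simp only [mFourier, ContinuousMap.coe_mk, Pi.add_apply, ← Finset.prod_mul_distrib, fourier_apply]
  refine Finset.prod_congr rfl fun i _ => ?_
  rw [smul_add, AddCircle.toCircle_add, Circle.coe_mul]

theorem mFourier_torusMk (n : ι → ℤ) (v : ι → ℝ) :
    mFourier n (torusMk v) = Complex.exp ((∑ k, n k * v k : ℝ) * Complex.I) := by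
  simp only [mFourier, ContinuousMap.coe_mk, torusMk_apply, fourier_coe_angle]
  rw [← Complex.exp_sum]
  push_cast
  rw [Finset.sum_mul]

theorem mFourier_induction {p : C(UnitAddTorus ι, ℂ) → Prop} (hm : ∀ n, p (mFourier n))
    (hadd : ∀ Φ Ψ, p Φ → p Ψ → p (Φ + Ψ)) (hsmul : ∀ (c : ℂ) Φ, p Φ → p (c • Φ))
    (hlim : ∀ Φ, (∀ ε > 0, ∃ Ψ, p Ψ ∧ ∀ z, ‖Φ z - Ψ z‖ ≤ ε) → p Φ) (Φ : C(UnitAddTorus ι, ℂ)) :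
    p Φ := by
  have hspan : ∀ Ψ ∈ Submodule.span ℂ (Set.range (mFourier (d := ι))), p Ψ := by
    intro Ψ hΨ
    induction hΨ using Submodule.span_induction with
    | mem x h => obtain ⟨n, rfl⟩ := h; exact hm n
    | zero => exact zero_smul ℂ (mFourier (0 : ι → ℤ)) ▸ hsmul 0 _ (hm 0)
    | add x y _ _ hx hy => exact hadd x y hx hy
    | smul c x _ hx => exact hsmul c x hx
  refine hlim Φ fun ε hε => ?_
  have hΦ : Φ ∈ (Submodule.span ℂ (Set.range (mFourier (d := ι)))).topologicalClosure := by
    rw [span_mFourier_closure_eq_top]; trivial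
  obtain ⟨Ψ, hΨ, hd⟩ := Metric.mem_closure_iff.1 hΦ ε hε
  refine ⟨Ψ, hspan Ψ hΨ, fun z => ?_⟩
  rw [dist_eq_norm] at hd
  exact ((Φ - Ψ).norm_coe_le_norm z).trans hd.le

theorem integrable_continuous_torus {E : Type*} [NormedAddCommGroup E]
    {μ : Measure (UnitAddTorus ι)} [IsFiniteMeasure μ]
    {Φ : UnitAddTorus ι → E} (hΦ : Continuous Φ) : Integrable Φ μ := by
  refine (integrableOn_univ (μ := μ)).1 (hΦ.continuousOn.integrableOn_compact isCompact_univ)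

theorem measure_ext_of_mFourier {μ ν : Measure (UnitAddTorus ι)} [IsProbabilityMeasure μ]
    [IsProbabilityMeasure ν] (h : ∀ n, ∫ z, mFourier n z ∂μ = ∫ z, mFourier n z ∂ν) : μ = ν := by
  have key : ∀ Φ : C(UnitAddTorus ι, ℂ), ∫ z, Φ z ∂μ = ∫ z, Φ z ∂ν := by
    intro Φ
    induction Φ using mFourier_induction with
    | hm n => exact h n
    | hadd Φ Ψ h1 h2 =>
      simp only [ContinuousMap.add_apply]
      rw [integral_add (integrable_continuous_torus Φ.continuous)
        (integrable_continuous_torus Ψ.continuous), integral_add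
        (integrable_continuous_torus Φ.continuous)
        (integrable_continuous_torus Ψ.continuous), h1, h2]
    | hsmul c Φ h1 =>
      simp only [ContinuousMap.smul_apply, smul_eq_mul]
      rw [integral_const_mul, integral_const_mul, h1]
    | hlim Φ hΦ =>
      rw [← sub_eq_zero, ← norm_eq_zero]
      refine le_antisymm (le_of_forall_pos_le_add fun ε hε => ?_) (norm_nonneg _)
      obtain ⟨Ψ, hΨ, hd⟩ := hΦ (ε / 2) (by positivity)
      have b : ∀ (m : Measure (UnitAddTorus ι)) [IsProbabilityMeasure m],
          ‖∫ z, Φ z ∂m - ∫ z, Ψ z ∂m‖ ≤ ε / 2 := by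
        intro m _
        rw [← integral_sub (integrable_continuous_torus Φ.continuous)
          (integrable_continuous_torus Ψ.continuous)]
        simpa using norm_integral_le_of_norm_le_const (μ := m) (Eventually.of_forall hd)
      have h1 := b μ
      have h2 := b ν
      rw [hΨ] at h1
      rw [norm_sub_rev] at h2
      calc _ = ‖(∫ z, Φ z ∂μ - ∫ z, Ψ z ∂ν) + (∫ z, Ψ z ∂ν - ∫ z, Φ z ∂ν)‖ := by
            congr 1; ring
        _ ≤ _ := norm_add_le _ _
        _ ≤ 0 + ε := by linarith
  refine ext_of_forall_integral_eq_of_IsFiniteMeasure fun f => ?_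
  have := key ⟨fun z => (f z : ℂ), by fun_prop⟩
  simp only [ContinuousMap.coe_mk] at this
  rw [integral_complex_ofReal, integral_complex_ofReal] at this
  exact_mod_cast this

/-- A probability measure on the torus whose Fourier coefficients are the indicator function of the
lattice of integer relations between the entries of `γ`: the Haar measure of the closure of
the one-parameter group with velocity `γ`. -/
structure IsRelationMeasure (γ : ι → ℝ) (μ : Measure (UnitAddTorus ι)) : Prop where
  isProb : IsProbabilityMeasure μ
  integral_eq_one : ∀ n : ι → ℤ, ∑ k, n k * γ k = 0 → ∫ z, mFourier n z ∂μ = 1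
  integral_eq_zero : ∀ n : ι → ℤ, ∑ k, n k * γ k ≠ 0 → ∫ z, mFourier n z ∂μ = 0

/-- A character trivial on the line is trivial on its closure. Otherwise the point at time `π / (n ·
γ)` has character value `-1`, and invariance of Haar measure under it makes the integral equal to
its own negative. -/
theorem exists_isRelationMeasure (γ : ι → ℝ) :
    ∃ μ : Measure (UnitAddTorus ι), IsRelationMeasure γ μ := by
  let S : AddSubgroup (UnitAddTorus ι) :=
    { carrier := Set.range fun t : ℝ => torusMk (t • γ)
      add_mem' := by
        rintro _ _ ⟨s, rfl⟩ ⟨t, rfl⟩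
        exact ⟨s + t, by simp only [add_smul, torusMk_add]⟩
      zero_mem' := ⟨0, by simp only [zero_smul, torusMk_zero]⟩
      neg_mem' := by
        rintro _ ⟨s, rfl⟩
        refine ⟨-s, ?_⟩
        rw [eq_neg_iff_add_eq_zero]
        simp only [← torusMk_add, ← add_smul, neg_add_cancel, zero_smul, torusMk_zero] }
  let H : AddSubgroup (UnitAddTorus ι) := S.topologicalClosure
  have hHc : IsClosed (H : Set (UnitAddTorus ι)) := S.isClosed_topologicalClosure
  have : CompactSpace H := isCompact_iff_compactSpace.1 hHc.isCompact
  let m : Measure H := Measure.addHaarMeasure ⊤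
  have hmp : IsProbabilityMeasure m := ⟨by
    have := Measure.addHaarMeasure_self (G := H) (K₀ := ⊤)
    simpa using this⟩
  have hmeas : Measurable (Subtype.val : H → UnitAddTorus ι) := measurable_subtype_coe
  have hint : ∀ n, ∫ z, mFourier n z ∂(m.map Subtype.val) = ∫ z : H, mFourier n (z : UnitAddTorus ι) ∂m :=
    fun n => integral_map hmeas.aemeasurable (mFourier n).continuous.aestronglyMeasurable
  refine ⟨m.map Subtype.val, Measure.isProbabilityMeasure_map hmeas.aemeasurable, fun n hn => ?_,
    fun n hn => ?_⟩
  · rw [hint]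
    have h1 : ∀ z : H, mFourier n (z : UnitAddTorus ι) = 1 := by
      intro z
      have hcl : IsClosed {z | mFourier n z = 1} := isClosed_eq (mFourier n).continuous continuous_const
      refine closure_minimal ?_ hcl z.2
      rintro _ ⟨t, rfl⟩
      change mFourier n (torusMk (t • γ)) = 1
      rw [mFourier_torusMk]
      have : ∑ k, n k * (t • γ) k = 0 := by
        rw [← mul_zero t, ← hn, Finset.mul_sum]
        exact Finset.sum_congr rfl fun k _ => by simp; ring
      rw [this]; simp
    simp [h1]
  · rw [hint]
    set a := ∑ k, n k * γ k with ha
    let g : H := ⟨torusMk ((Real.pi / a) • γ), S.le_topologicalClosure ⟨Real.pi / a, rfl⟩⟩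
    have hg : mFourier n (g : UnitAddTorus ι) = -1 := by
      change mFourier n (torusMk ((Real.pi / a) • γ)) = -1
      rw [mFourier_torusMk]
      have : ∑ k, n k * ((Real.pi / a) • γ) k = Real.pi := by
        have : ∑ k, n k * ((Real.pi / a) • γ) k = Real.pi / a * a := by
          rw [ha, Finset.mul_sum]
          exact Finset.sum_congr rfl fun k _ => by simp; ring
        rw [this]; field_simp
      rw [this, Complex.exp_pi_mul_I]
    have h2 := integral_add_left_eq_self (μ := m) (fun z : H => mFourier n (z : UnitAddTorus ι)) g
    simp only [AddSubgroup.coe_add, mFourier_apply_add, hg, neg_one_mul] at h2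
    rw [integral_neg] at h2
    linear_combination (-1 / 2 : ℂ) * h2

/-- Translation multiplies each Fourier coefficient by a character value, which is `1` on relations;
the other coefficients vanish anyway. -/
theorem IsRelationMeasure.map_add {γ : ι → ℝ} {μ : Measure (UnitAddTorus ι)}
    (h : IsRelationMeasure γ μ) {v : ι → ℝ}
    (hv : ∀ n : ι → ℤ, ∑ k, n k * γ k = 0 → ∑ k, n k * v k = 0) :
    MeasurePreserving (fun z => z + torusMk v) μ μ := by
  have := h.isProb
  have hm : Measurable (fun z : UnitAddTorus ι => z + torusMk v) :=
    (continuous_id.add continuous_const).measurable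
  refine ⟨hm, ?_⟩
  have := Measure.isProbabilityMeasure_map (μ := μ) hm.aemeasurable
  refine measure_ext_of_mFourier fun n => ?_
  rw [integral_map hm.aemeasurable (mFourier n).continuous.aestronglyMeasurable]
  simp only [mFourier_apply_add]
  rw [integral_mul_const]
  by_cases hn : ∑ k, n k * γ k = 0
  · rw [mFourier_torusMk, hv n hn]; simp
  · rw [h.integral_eq_zero n hn, zero_mul]

/-- Characters of the smaller torus pull back to characters whose exponents are extended by zero, so
its relations are those of `γ` supported on the image of `σ`. -/
theorem IsRelationMeasure.map_comp {κ : Type*} [Fintype κ] {γ : ι → ℝ}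
    {μ : Measure (UnitAddTorus ι)} (h : IsRelationMeasure γ μ) {σ : κ → ι}
    (hσ : Function.Injective σ) : IsRelationMeasure (γ ∘ σ) (μ.map fun z => z ∘ σ) := by
  have := h.isProb
  have hc : Continuous (fun z : UnitAddTorus ι => z ∘ σ) :=
    continuous_pi fun j => continuous_apply _
  have hm := hc.measurable
  have key : ∀ n : κ → ℤ, ∃ n' : ι → ℤ, (∑ k, n' k * γ k = ∑ k, n k * (γ ∘ σ) k) ∧
      ∫ z, mFourier n z ∂(μ.map fun z => z ∘ σ) = ∫ z, mFourier n' z ∂μ := by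
    intro n
    have hex : ∀ k, Function.extend σ n (0 : ι → ℤ) (σ k) = n k := fun k => hσ.extend_apply n (0 : ι → ℤ) k
    have hex' : ∀ i, i ∉ Set.range σ → Function.extend σ n (0 : ι → ℤ) i = 0 := fun i hi =>
      Function.extend_apply' n (0 : ι → ℤ) i (by simpa using hi)
    refine ⟨Function.extend σ n (0 : ι → ℤ), ?_, ?_⟩
    · refine (Fintype.sum_of_injective σ hσ _ _ (fun i hi => ?_) fun k => ?_).symm
      · rw [hex' i hi]; simp
      · rw [hex]; rfl
    · rw [integral_map hm.aemeasurable (mFourier n).continuous.aestronglyMeasurable]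
      refine integral_congr_ae (Eventually.of_forall fun z => ?_)
      simp only [mFourier, ContinuousMap.coe_mk]
      refine Fintype.prod_of_injective σ hσ _ _ (fun i hi => ?_) fun k => ?_
      · rw [hex' i hi]; simp
      · rw [hex]; rfl
  refine ⟨Measure.isProbabilityMeasure_map hm.aemeasurable, fun n hn => ?_, fun n hn => ?_⟩
  · obtain ⟨n', h1, h2⟩ := key n
    rw [h2, h.integral_eq_one n' (h1.trans hn)]
  · obtain ⟨n', h1, h2⟩ := key n
    rw [h2, h.integral_eq_zero n' (h1 ▸ hn)]

theorem tendsto_average_exp (a : ℝ) :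
    Tendsto (fun T : ℝ => (T : ℂ)⁻¹ * ∫ t in (0 : ℝ)..T, Complex.exp ((t * a : ℝ) * Complex.I)) atTop
      (𝓝 (if a = 0 then 1 else 0)) := by
  split_ifs with h
  · subst h
    refine tendsto_const_nhds.congr' ?_
    filter_upwards [eventually_gt_atTop 0] with T hT
    have : (T : ℂ) ≠ 0 := by exact_mod_cast hT.ne'
    simp [this]
  · have hc : (a : ℂ) * Complex.I ≠ 0 := by simp [h]
    have h1 : ∀ T : ℝ, ∫ t in (0 : ℝ)..T, Complex.exp ((t * a : ℝ) * Complex.I)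
        = (Complex.exp ((T * a : ℝ) * Complex.I) - 1) / (a * Complex.I) := by
      intro T
      have := integral_exp_mul_complex (a := 0) (b := T) hc
      simp only [Complex.ofReal_zero, mul_zero, Complex.exp_zero] at this
      rw [show Complex.exp ((T * a : ℝ) * Complex.I) = Complex.exp (a * Complex.I * T) by
        push_cast; ring_nf, ← this]
      refine intervalIntegral.integral_congr fun t _ => ?_
      push_cast; ring_nf
    rw [tendsto_zero_iff_norm_tendsto_zero]
    have hle : ∀ᶠ T : ℝ in atTop,
        ‖(T : ℂ)⁻¹ * ∫ t in (0 : ℝ)..T, Complex.exp ((t * a : ℝ) * Complex.I)‖ ≤ T⁻¹ * (2 / |a|) := by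
      filter_upwards [eventually_gt_atTop 0] with T hT
      rw [h1, norm_mul, norm_inv, Complex.norm_of_nonneg hT.le, norm_div]
      simp only [norm_mul, Complex.norm_I, mul_one, Complex.norm_real, Real.norm_eq_abs]
      gcongr
      refine (norm_sub_le _ _).trans ?_
      rw [Complex.norm_exp_ofReal_mul_I]; norm_num
    refine squeeze_zero' (Eventually.of_forall fun _ => norm_nonneg _) hle ?_
    simpa using tendsto_inv_atTop_zero.mul_const (2 / |a|)

theorem continuous_line {ι : Type*} (γ : ι → ℝ) : Continuous fun t : ℝ => torusMk (t • γ) :=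
  continuous_torusMk.comp (by fun_prop)

/-- Weyl's criterion: the limit is explicit for characters, and uniform approximation by
trigonometric polynomials extends it to continuous functions. -/
theorem IsRelationMeasure.tendsto_average {γ : ι → ℝ} {μ : Measure (UnitAddTorus ι)}
    (h : IsRelationMeasure γ μ) (Φ : C(UnitAddTorus ι, ℂ)) :
    Tendsto (fun T : ℝ => (T : ℂ)⁻¹ * ∫ t in (0 : ℝ)..T, Φ (torusMk (t • γ))) atTop
      (𝓝 (∫ z, Φ z ∂μ)) := by
  have := h.isProb
  have hii : ∀ (Φ : C(UnitAddTorus ι, ℂ)) (T : ℝ),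
      IntervalIntegrable (fun t : ℝ => Φ (torusMk (t • γ))) volume 0 T := fun Φ T =>
    (Φ.continuous.comp (continuous_line γ)).intervalIntegrable _ _
  induction Φ using mFourier_induction with
  | hm n =>
    have h0 := tendsto_average_exp (∑ k, n k * γ k)
    have h1 : ∫ z, mFourier n z ∂μ = if ∑ k, n k * γ k = 0 then 1 else 0 := by
      split_ifs with hn
      · exact h.integral_eq_one n hn
      · exact h.integral_eq_zero n hn
    rw [h1]
    refine h0.congr fun T => ?_
    congr 1
    refine intervalIntegral.integral_congr fun t _ => ?_
    simp only [mFourier_torusMk]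
    congr 3
    rw [Finset.mul_sum]
    exact Finset.sum_congr rfl fun k _ => by simp; ring
  | hadd Φ Ψ h1 h2 =>
    simp only [ContinuousMap.add_apply]
    rw [integral_add (integrable_continuous_torus Φ.continuous)
      (integrable_continuous_torus Ψ.continuous)]
    refine (h1.add h2).congr fun T => ?_
    rw [intervalIntegral.integral_add (hii Φ T) (hii Ψ T), mul_add]
  | hsmul c Φ h1 =>
    simp only [ContinuousMap.smul_apply, smul_eq_mul]
    rw [integral_const_mul]
    refine (h1.const_mul c).congr fun T => ?_
    rw [intervalIntegral.integral_const_mul]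
    ring
  | hlim Φ hΦ =>
    rw [Metric.tendsto_nhds]
    intro ε hε
    obtain ⟨Ψ, hΨ, hd⟩ := hΦ (ε / 4) (by positivity)
    have hb : ‖∫ z, Φ z ∂μ - ∫ z, Ψ z ∂μ‖ ≤ ε / 4 := by
      rw [← integral_sub (integrable_continuous_torus Φ.continuous)
        (integrable_continuous_torus Ψ.continuous)]
      simpa using norm_integral_le_of_norm_le_const (μ := μ) (Eventually.of_forall hd)
    filter_upwards [(Metric.tendsto_nhds.1 hΨ) (ε / 4) (by positivity), eventually_gt_atTop 0]
      with T hT hT0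
    have hc : ‖(T : ℂ)⁻¹ * (∫ t in (0 : ℝ)..T, Φ (torusMk (t • γ)))
        - (T : ℂ)⁻¹ * ∫ t in (0 : ℝ)..T, Ψ (torusMk (t • γ))‖ ≤ ε / 4 := by
      rw [← mul_sub, ← intervalIntegral.integral_sub (hii Φ T) (hii Ψ T), norm_mul, norm_inv,
        Complex.norm_of_nonneg hT0.le, inv_mul_le_iff₀ hT0]
      refine (intervalIntegral.norm_integral_le_of_norm_le_const (fun t _ => hd _)).trans ?_
      rw [sub_zero, abs_of_pos hT0, mul_comm]
    rw [dist_eq_norm] at hT ⊢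
    rw [norm_sub_rev] at hb
    set A := (T : ℂ)⁻¹ * ∫ t in (0 : ℝ)..T, Φ (torusMk (t • γ))
    set B := (T : ℂ)⁻¹ * ∫ t in (0 : ℝ)..T, Ψ (torusMk (t • γ))
    set I := ∫ z, Φ z ∂μ
    set J := ∫ z, Ψ z ∂μ
    calc ‖A - I‖ = ‖(A - B) + (B - J) + (J - I)‖ := by congr 1; ring
      _ ≤ _ := norm_add₃_le
      _ < ε := by linarith

theorem IsRelationMeasure.tendsto_average_real {γ : ι → ℝ} {μ : Measure (UnitAddTorus ι)}
    (h : IsRelationMeasure γ μ) {Φ : UnitAddTorus ι → ℝ} (hΦ : Continuous Φ) :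
    Tendsto (fun T : ℝ => T⁻¹ * ∫ t in (0 : ℝ)..T, Φ (torusMk (t • γ))) atTop
      (𝓝 (∫ z, Φ z ∂μ)) := by
  have := h.tendsto_average ⟨fun z => (Φ z : ℂ), by fun_prop⟩
  simp only [ContinuousMap.coe_mk, intervalIntegral.integral_ofReal] at this
  rw [integral_complex_ofReal] at this
  have h2 := (Complex.continuous_re.tendsto _).comp this
  refine h2.congr fun T => ?_
  simp only [Function.comp, ← Complex.ofReal_inv, ← Complex.ofReal_mul, Complex.ofReal_re]

theorem intervalIntegral_integral_swap {E : Type*} [NormedAddCommGroup E] [NormedSpace ℝ E]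
    {μ : Measure (UnitAddTorus ι)} [IsFiniteMeasure μ] {a b : ℝ} (hab : a ≤ b)
    {F : ℝ → UnitAddTorus ι → E} (hF : Continuous (Function.uncurry F)) :
    ∫ s in a..b, ∫ z, F s z ∂μ = ∫ z, (∫ s in a..b, F s z) ∂μ := by
  simp only [intervalIntegral.integral_of_le hab]
  refine integral_integral_swap ?_
  have h1 : IntegrableOn (Function.uncurry F) (Set.Icc a b ×ˢ Set.univ) (volume.prod μ) :=
    hF.continuousOn.integrableOn_compact (isCompact_Icc.prod isCompact_univ)
  have h2 := h1.mono_set (Set.prod_mono Set.Ioc_subset_Icc_self (subset_refl Set.univ))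
  rwa [IntegrableOn, ← Measure.prod_restrict, Measure.restrict_univ] at h2

/-- Averaging one factor of a product over a direction in which the measure and the other factor are
invariant. -/
theorem integral_mul_eq_integral_average {𝕜 : Type*} [RCLike 𝕜] {μ : Measure (UnitAddTorus ι)}
    [IsFiniteMeasure μ] {v : ι → ℝ}
    (hμ : ∀ s : ℝ, MeasurePreserving (fun z => z + torusMk (s • v)) μ μ)
    {f P : UnitAddTorus ι → 𝕜} (hf : Continuous f) (hP : Continuous P)
    (hPv : ∀ z (s : ℝ), P (z + torusMk (s • v)) = P z) :
    (2 * Real.pi) • ∫ z, P z * f z ∂μ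
      = ∫ z, P z * (∫ s in (0 : ℝ)..2 * Real.pi, f (z + torusMk (s • v))) ∂μ := by
  have h1 : ∀ s : ℝ, ∫ z, P z * f (z + torusMk (s • v)) ∂μ = ∫ z, P z * f z ∂μ := by
    intro s
    have h2 : ∫ z, P z * f z ∂(μ.map fun z => z + torusMk (s • v)) = _ :=
      integral_map (hμ s).aemeasurable (hP.mul hf).aestronglyMeasurable
    rw [(hμ s).map_eq] at h2
    rw [h2]
    simp only [hPv]
  have h3 : (2 * Real.pi) • ∫ z, P z * f z ∂μ
      = ∫ s in (0 : ℝ)..2 * Real.pi, ∫ z, P z * f (z + torusMk (s • v)) ∂μ := by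
    simp only [h1, intervalIntegral.integral_const, sub_zero]
  rw [h3]
  have hc : Continuous fun p : ℝ × UnitAddTorus ι => P p.2 * f (p.2 + torusMk (p.1 • v)) := by
    refine (hP.comp continuous_snd).mul (hf.comp (continuous_snd.add ?_))
    exact (continuous_line v).comp continuous_fst
  rw [intervalIntegral_integral_swap Real.two_pi_pos.le hc]
  exact integral_congr_ae (Eventually.of_forall fun z =>
    intervalIntegral.integral_const_mul _ _)

/-- Integration by parts: the integral of a derivative along an invariant direction vanishes. -/
theorem integral_deriv_eq_zero {μ : Measure (UnitAddTorus ι)}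
    [IsFiniteMeasure μ] {v : ι → ℝ}
    (hμ : ∀ s : ℝ, MeasurePreserving (fun z => z + torusMk (s • v)) μ μ)
    {G G' : UnitAddTorus ι → ℝ} (hG : Continuous G) (hG' : Continuous G')
    (hder : ∀ z, HasDerivAt (fun s : ℝ => G (z + torusMk (s • v))) (G' z) 0) :
    ∫ z, G' z ∂μ = 0 := by
  have hinv : ∀ (f : UnitAddTorus ι → ℝ), Continuous f → ∀ s : ℝ,
      ∫ z, f (z + torusMk (s • v)) ∂μ = ∫ z, f z ∂μ := by
    intro f hf s
    have h2 : ∫ z, f z ∂(μ.map fun z => z + torusMk (s • v)) = _ :=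
      integral_map (hμ s).aemeasurable hf.aestronglyMeasurable
    rw [(hμ s).map_eq] at h2
    exact h2.symm
  have hder' : ∀ z (s : ℝ), HasDerivAt (fun s : ℝ => G (z + torusMk (s • v)))
      (G' (z + torusMk (s • v))) s := by
    intro z s
    have h1 := hder (z + torusMk (s • v))
    rw [← sub_self s] at h1
    have h2 := HasDerivAt.comp (h := fun x => id x - s) s h1 (HasDerivAt.sub_const s (hasDerivAt_id s))
    rw [mul_one] at h2
    refine h2.congr_of_eventuallyEq (Eventually.of_forall fun t => ?_)
    simp only [Function.comp, id, add_assoc, ← torusMk_add, ← add_smul, add_sub_cancel]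
  have hcz : ∀ z, Continuous fun s : ℝ => G' (z + torusMk (s • v)) := fun z =>
    hG'.comp (continuous_const.add (continuous_line v))
  have h1 : ∀ z, ∫ s in (0 : ℝ)..1, G' (z + torusMk (s • v)) = G (z + torusMk ((1 : ℝ) • v)) - G z := by
    intro z
    rw [intervalIntegral.integral_eq_sub_of_hasDerivAt (fun s _ => hder' z s)
      ((hcz z).intervalIntegrable _ _)]
    simp [torusMk_zero]
  have h2 : ∫ s in (0 : ℝ)..1, ∫ z, G' (z + torusMk (s • v)) ∂μ = 0 := by
    have hc : Continuous (Function.uncurry fun (s : ℝ) z => G' (z + torusMk (s • v))) :=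
      hG'.comp (continuous_snd.add ((continuous_line v).comp continuous_fst))
    rw [intervalIntegral_integral_swap zero_le_one hc]
    · simp only [h1]
      rw [integral_sub, hinv G hG 1, sub_self]
      · exact integrable_continuous_torus (hG.comp (continuous_id.add continuous_const))
      · exact integrable_continuous_torus hG
  simpa only [hinv G' hG', intervalIntegral.integral_const, sub_zero, one_smul] using h2

end Torus

end

/-! ### Bessel functions and the density bound for independent angles. -/

section

open MeasureTheory UnitAddTorus Filter Topology Real

section Coordinates

variable {ι : Type*}

/-- The cosine of the `k`-th angle of a point of the torus. -/
noncomputable def torusCos (k : ι) (z : UnitAddTorus ι) : ℝ := (fourier 1 (z k)).re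

/-- The sine of the `k`-th angle of a point of the torus. -/
noncomputable def torusSin (k : ι) (z : UnitAddTorus ι) : ℝ := (fourier 1 (z k)).im

@[fun_prop]
theorem continuous_torusCos (k : ι) : Continuous (torusCos k) :=
  Complex.continuous_re.comp ((fourier 1).continuous.comp (continuous_apply k))

@[fun_prop]
theorem continuous_torusSin (k : ι) : Continuous (torusSin k) :=
  Complex.continuous_im.comp ((fourier 1).continuous.comp (continuous_apply k))

theorem torusCos_torusMk (k : ι) (v : ι → ℝ) : torusCos k (torusMk v) = cos (v k) := by
  rw [torusCos, torusMk_apply, fourier_coe_angle]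
  simp [Complex.exp_ofReal_mul_I_re]

theorem torusSin_torusMk (k : ι) (v : ι → ℝ) : torusSin k (torusMk v) = sin (v k) := by
  rw [torusSin, torusMk_apply, fourier_coe_angle]
  simp [Complex.exp_ofReal_mul_I_im]

theorem torusMk_surjective : Function.Surjective (torusMk (ι := ι)) := by
  intro z
  have h : ∀ k, ∃ x : ℝ, (x : UnitAddCircle) = z k := fun k => QuotientAddGroup.mk_surjective (z k)
  choose x hx using h
  refine ⟨fun k => 2 * π * x k, ?_⟩
  funext k
  rw [torusMk_apply, mul_div_cancel_left₀ _ two_pi_pos.ne', hx]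

theorem torusCos_add (k : ι) (z : UnitAddTorus ι) (v : ι → ℝ) :
    torusCos k (z + torusMk v) = torusCos k z * cos (v k) - torusSin k z * sin (v k) := by
  obtain ⟨w, rfl⟩ := torusMk_surjective z
  rw [← torusMk_add]
  simp only [torusCos_torusMk, torusSin_torusMk, Pi.add_apply, cos_add]

theorem torusSin_add (k : ι) (z : UnitAddTorus ι) (v : ι → ℝ) :
    torusSin k (z + torusMk v) = torusSin k z * cos (v k) + torusCos k z * sin (v k) := by
  obtain ⟨w, rfl⟩ := torusMk_surjective z
  rw [← torusMk_add]
  simp only [torusCos_torusMk, torusSin_torusMk, Pi.add_apply, sin_add]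

theorem abs_torusCos_le_one (k : ι) (z : UnitAddTorus ι) : |torusCos k z| ≤ 1 := by
  obtain ⟨w, rfl⟩ := torusMk_surjective z
  rw [torusCos_torusMk]; exact abs_cos_le_one _

end Coordinates

section Bessel

theorem besselJZero_neg (x : ℝ) : besselJZero (-x) = besselJZero x := by
  simp [besselJZero]

theorem continuous_besselJZero : Continuous besselJZero := by
  unfold besselJZero
  refine continuous_const.mul ?_
  exact intervalIntegral.continuous_parametric_intervalIntegral_of_continuous' (by fun_prop) _ _

theorem abs_besselJZero_le_one (x : ℝ) : |besselJZero x| ≤ 1 := by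
  have h := intervalIntegral.norm_integral_le_of_norm_le_const (a := 0) (b := π) (C := 1)
    (f := fun θ => cos (x * sin θ)) (fun θ _ => abs_cos_le_one _)
  rw [sub_zero, abs_of_pos pi_pos, one_mul, Real.norm_eq_abs] at h
  rw [besselJZero, abs_mul, abs_of_pos (by positivity)]
  calc 1 / π * _ ≤ 1 / π * π := by gcongr
    _ = 1 := by field_simp

theorem integral_exp_mul_cos (x θ : ℝ) :
    ∫ τ in (0 : ℝ)..2 * π, Complex.exp ((x * cos (θ + τ) : ℝ) * Complex.I)
      = (2 * π * besselJZero x : ℝ) := by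
  have hper : Function.Periodic (fun τ : ℝ => Complex.exp ((x * sin τ : ℝ) * Complex.I)) (2 * π) :=
    fun τ => by simp only [sin_add_two_pi]
  have h1 : ∫ τ in (0 : ℝ)..2 * π, Complex.exp ((x * cos (θ + τ) : ℝ) * Complex.I)
      = ∫ τ in (0 : ℝ)..2 * π, Complex.exp ((x * sin τ : ℝ) * Complex.I) := by
    have h2 : ∀ τ, cos (θ + τ) = sin ((θ + π / 2) + τ) := fun τ => by
      rw [show θ + π / 2 + τ = (θ + τ) + π / 2 by ring, sin_add_pi_div_two]
    simp only [h2]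
    rw [intervalIntegral.integral_comp_add_left
      (fun τ : ℝ => Complex.exp ((x * sin τ : ℝ) * Complex.I)) (θ + π / 2), add_zero]
    rw [hper.intervalIntegral_add_eq (θ + π / 2) 0, zero_add]
  have hc : Continuous (fun τ : ℝ => Complex.exp ((x * sin τ : ℝ) * Complex.I)) := by fun_prop
  rw [h1, ← intervalIntegral.integral_add_adjacent_intervals (b := π)
    (hc.intervalIntegrable _ _) (hc.intervalIntegrable _ _)]
  have h3 : ∫ τ in π..2 * π, Complex.exp ((x * sin τ : ℝ) * Complex.I)
      = ∫ τ in (0 : ℝ)..π, Complex.exp (-(x * sin τ : ℝ) * Complex.I) := by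
    have := intervalIntegral.integral_comp_add_right (a := 0) (b := π)
      (fun τ : ℝ => Complex.exp ((x * sin τ : ℝ) * Complex.I)) π
    rw [zero_add, ← two_mul] at this
    rw [← this]
    refine intervalIntegral.integral_congr fun τ _ => ?_
    simp only [sin_add_pi]
    push_cast; ring_nf
  have hc' : Continuous (fun τ : ℝ => Complex.exp (-(x * sin τ : ℝ) * Complex.I)) := by fun_prop
  rw [h3, ← intervalIntegral.integral_add (hc.intervalIntegrable _ _) (hc'.intervalIntegrable _ _)]
  have h4 : ∀ τ : ℝ, Complex.exp ((x * sin τ : ℝ) * Complex.I)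
      + Complex.exp (-(x * sin τ : ℝ) * Complex.I) = ((2 * cos (x * sin τ) : ℝ) : ℂ) := by
    intro τ
    push_cast
    rw [Complex.two_cos]
  simp only [h4, intervalIntegral.integral_ofReal, intervalIntegral.integral_const_mul]
  rw [besselJZero]
  field_simp

/-- The phase is stationary at `π / 2`. The last stretch of length `1 / √x` is estimated trivially;
before it one integrates by parts against `1 / (x cos θ)`, which is monotone, so the remaining
integral is no larger than the boundary term. -/
theorem abs_integral_cos_mul_sin_le {x : ℝ} (hx : 1 ≤ x) :
    |∫ θ in (0 : ℝ)..π / 2, cos (x * sin θ)| ≤ (π + 1) / √x := by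
  have hx0 : 0 < x := by linarith
  have hs : 0 < √x := sqrt_pos.2 hx0
  set δ := 1 / √x with hδ
  have hδ0 : 0 < δ := by positivity
  have hδ1 : δ ≤ 1 := by
    rw [hδ, div_le_one hs]; exact one_le_sqrt.2 hx
  have hpi := pi_gt_three
  set c := π / 2 - δ with hc
  have hc0 : 0 ≤ c := by linarith
  have hcos : ∀ θ ∈ Set.uIcc 0 c, 0 < cos θ := by
    intro θ hθ
    rw [Set.uIcc_of_le hc0] at hθ
    exact cos_pos_of_mem_Ioo ⟨by linarith [hθ.1], by linarith [hθ.2]⟩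
  have hcont : Continuous fun θ : ℝ => cos (x * sin θ) := by fun_prop
  rw [← intervalIntegral.integral_add_adjacent_intervals (b := c)
    (hcont.intervalIntegrable _ _) (hcont.intervalIntegrable _ _)]
  have h2 : |∫ θ in c..π / 2, cos (x * sin θ)| ≤ δ := by
    have := intervalIntegral.norm_integral_le_of_norm_le_const (a := c) (b := π / 2) (C := 1)
      (f := fun θ => cos (x * sin θ)) (fun θ _ => abs_cos_le_one _)
    rw [one_mul, abs_of_nonneg (by linarith)] at this
    simpa [hc] using this
  have h3 : ∫ θ in (0 : ℝ)..c, cos (x * sin θ)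
      = sin (x * sin c) / (x * cos c)
        - ∫ θ in (0 : ℝ)..c, sin (x * sin θ) * (sin θ / (x * cos θ ^ 2)) := by
    have hu : ∀ θ ∈ Set.uIcc 0 c, HasDerivAt (fun θ => 1 / (x * cos θ)) (sin θ / (x * cos θ ^ 2)) θ := by
      intro θ hθ
      have := hcos θ hθ
      have h := (((hasDerivAt_cos θ).const_mul x).inv (by positivity))
      simp only [one_div]
      refine h.congr_deriv ?_
      field_simp
    have hv : ∀ θ ∈ Set.uIcc 0 c,
        HasDerivAt (fun θ => sin (x * sin θ)) (cos (x * sin θ) * (x * cos θ)) θ := by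
      intro θ _
      exact ((hasDerivAt_sin θ).const_mul x).sin
    have hci : ContinuousOn (fun θ => sin θ / (x * cos θ ^ 2)) (Set.uIcc 0 c) := by
      refine ContinuousOn.div (by fun_prop) (by fun_prop) fun θ hθ => ?_
      have := hcos θ hθ
      positivity
    have := intervalIntegral.integral_mul_deriv_eq_deriv_mul hu hv hci.intervalIntegrable
      (Continuous.intervalIntegrable (by fun_prop) _ _)
    simp only [sin_zero, mul_zero, sub_zero] at this
    have e : ∫ θ in (0 : ℝ)..c, 1 / (x * cos θ) * (cos (x * sin θ) * (x * cos θ))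
        = ∫ θ in (0 : ℝ)..c, cos (x * sin θ) := by
      refine intervalIntegral.integral_congr fun θ hθ => ?_
      have := hcos θ hθ
      field_simp
    rw [e] at this
    rw [this]
    congr 1
    · ring
    · exact intervalIntegral.integral_congr fun θ _ => mul_comm _ _
  have hcc : cos c = sin δ := by rw [hc, cos_pi_div_two_sub]
  have hsin : 2 / π * δ ≤ sin δ := mul_le_sin hδ0.le (by linarith)
  have hcc0 : 0 < cos c := hcos c Set.right_mem_uIcc
  have hb : 1 / (x * cos c) ≤ π / 2 / √x := by
    rw [hcc]
    calc 1 / (x * sin δ) ≤ 1 / (x * (2 / π * δ)) := by gcongr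
      _ = π / 2 / √x := by
        rw [hδ]
        have : x = √x * √x := (mul_self_sqrt hx0.le).symm
        field_simp
        nlinarith
  have h4 : |∫ θ in (0 : ℝ)..c, sin (x * sin θ) * (sin θ / (x * cos θ ^ 2))|
      ≤ 1 / (x * cos c) := by
    have hu : ∀ θ ∈ Set.uIcc 0 c, HasDerivAt (fun θ => 1 / (x * cos θ)) (sin θ / (x * cos θ ^ 2)) θ := by
      intro θ hθ
      have := hcos θ hθ
      have h := (((hasDerivAt_cos θ).const_mul x).inv (by positivity))
      simp only [one_div]
      refine h.congr_deriv ?_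
      field_simp
    have hci : ContinuousOn (fun θ => sin θ / (x * cos θ ^ 2)) (Set.uIcc 0 c) := by
      refine ContinuousOn.div (by fun_prop) (by fun_prop) fun θ hθ => ?_
      have := hcos θ hθ
      positivity
    have h5 := intervalIntegral.norm_integral_le_of_norm_le (μ := volume) hc0
      (f := fun θ => sin (x * sin θ) * (sin θ / (x * cos θ ^ 2)))
      (g := fun θ => sin θ / (x * cos θ ^ 2)) (Eventually.of_forall fun θ hθ => by
        have h6 : 0 ≤ sin θ := sin_nonneg_of_nonneg_of_le_pi hθ.1.le (by linarith [hθ.2])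
        rw [norm_mul, Real.norm_eq_abs, Real.norm_eq_abs, abs_of_nonneg (by positivity : 0 ≤ sin θ / (x * cos θ ^ 2))]
        exact mul_le_of_le_one_left (by positivity) (abs_sin_le_one _)) hci.intervalIntegrable
    rw [intervalIntegral.integral_eq_sub_of_hasDerivAt hu hci.intervalIntegrable] at h5
    refine h5.trans ?_
    have : 0 ≤ 1 / (x * cos 0) := by simp; positivity
    linarith
  have h7 : |sin (x * sin c) / (x * cos c)| ≤ 1 / (x * cos c) := by
    rw [abs_div, abs_of_pos (by positivity : 0 < x * cos c)]
    gcongr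
    exact abs_sin_le_one _
  rw [h3]
  calc _ ≤ |sin (x * sin c) / (x * cos c)
        - ∫ θ in (0 : ℝ)..c, sin (x * sin θ) * (sin θ / (x * cos θ ^ 2))|
        + |∫ θ in c..π / 2, cos (x * sin θ)| := abs_add_le _ _
    _ ≤ (|sin (x * sin c) / (x * cos c)|
        + |∫ θ in (0 : ℝ)..c, sin (x * sin θ) * (sin θ / (x * cos θ ^ 2))|) + δ :=
        add_le_add (abs_sub _ _) h2
    _ ≤ (π / 2 / √x + π / 2 / √x) + 1 / √x := by linarith
    _ = _ := by ring

theorem abs_besselJZero_le {x : ℝ} (hx : 0 < x) : |besselJZero x| ≤ 3 / √x := by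
  have hs : 0 < √x := sqrt_pos.2 hx
  rcases le_total x 1 with h | h
  · refine (abs_besselJZero_le_one x).trans ?_
    rw [le_div_iff₀ hs]
    have : √x ≤ 1 := sqrt_le_one.2 h
    linarith
  · have hcont : Continuous fun θ : ℝ => cos (x * sin θ) := by fun_prop
    have h1 : ∫ θ in π / 2..π, cos (x * sin θ) = ∫ θ in (0 : ℝ)..π / 2, cos (x * sin θ) := by
      have := intervalIntegral.integral_comp_sub_left (a := 0) (b := π / 2)
        (fun θ => cos (x * sin θ)) π
      simp only [sin_pi_sub, sub_zero] at this
      rw [this]; congr 1; ring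
    rw [besselJZero, ← intervalIntegral.integral_add_adjacent_intervals (b := π / 2)
      (hcont.intervalIntegrable _ _) (hcont.intervalIntegrable _ _), h1, ← two_mul,
      abs_mul, abs_mul, abs_of_pos (by positivity : 0 < 1 / π), abs_two]
    have h2 := abs_integral_cos_mul_sin_le h
    have hpi := pi_gt_three
    calc _ ≤ 1 / π * (2 * ((π + 1) / √x)) := by gcongr
      _ ≤ 3 / √x := by
        rw [show 1 / π * (2 * ((π + 1) / √x)) = (2 * (π + 1) / π) / √x by ring]
        gcongr
        rw [div_le_iff₀ pi_pos]
        linarith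

theorem continuous_besselProd (b : ℕ → ℝ) : Continuous (besselProd b) := by
  unfold besselProd
  exact continuous_finsetProd _ fun k _ =>
    (continuous_besselJZero.comp (continuous_const.mul continuous_id)).abs

theorem besselProd_nonneg (b : ℕ → ℝ) (t : ℝ) : 0 ≤ besselProd b t :=
  Finset.prod_nonneg fun _ _ => abs_nonneg _

theorem besselProd_neg (b : ℕ → ℝ) (t : ℝ) : besselProd b (-t) = besselProd b t := by
  simp only [besselProd, mul_neg, besselJZero_neg]

/-- Each factor decays like `t ^ (-1/2)`, and three factors give the integrable `t ^ (-3/2)`. -/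
theorem integrableOn_besselProd {b : ℕ → ℝ} (hb : ∀ k < 3, 0 < b k) :
    IntegrableOn (besselProd b) (Set.Ioi 0) := by
  rw [← Set.Ioc_union_Ioi_eq_Ioi zero_le_one, integrableOn_union]
  constructor
  · exact ((continuous_besselProd b).continuousOn.integrableOn_compact
      (isCompact_Icc (a := (0 : ℝ)) (b := 1))).mono_set Set.Ioc_subset_Icc_self
  · have h1 : IntegrableOn (fun t : ℝ => (∏ k ∈ Finset.range 3, 3 / √(b k)) * t ^ (-(3 / 2) : ℝ))
        (Set.Ioi 1) :=
      (integrableOn_Ioi_rpow_of_lt (by norm_num) zero_lt_one).const_mul _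
    refine h1.mono' (continuous_besselProd b).aestronglyMeasurable ?_
    filter_upwards [ae_restrict_mem measurableSet_Ioi] with t ht
    have ht0 : (0 : ℝ) < t := lt_trans zero_lt_one ht
    rw [Real.norm_eq_abs, abs_of_nonneg (besselProd_nonneg b t)]
    have h2 : t ^ (-(3 / 2) : ℝ) = ∏ k ∈ Finset.range 3, 1 / √t := by
      rw [Finset.prod_const, Finset.card_range, sqrt_eq_rpow, rpow_neg ht0.le, one_div, inv_pow,
        ← rpow_natCast, ← rpow_mul ht0.le]
      norm_num
    rw [h2, ← Finset.prod_mul_distrib]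
    refine Finset.prod_le_prod (fun _ _ => abs_nonneg _) fun k hk => ?_
    have hk0 := hb k (Finset.mem_range.1 hk)
    refine (abs_besselJZero_le (mul_pos hk0 ht0)).trans_eq ?_
    rw [sqrt_mul hk0.le]
    field_simp

end Bessel

section CharacteristicFunction

variable {ι : Type*} [Fintype ι]

/-- The trigonometric polynomial `∑ b_k cos θ_k` on the torus. -/
noncomputable def cosSum (b : ι → ℝ) (z : UnitAddTorus ι) : ℝ := ∑ k, b k * torusCos k z

@[fun_prop]
theorem continuous_cosSum (b : ι → ℝ) : Continuous (cosSum b) := by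
  unfold cosSum; fun_prop

/-- The angles are averaged one at a time along coordinate directions, each average producing one
factor `J₀`. -/
theorem integral_exp_cosSum {μ : Measure (UnitAddTorus ι)} [IsProbabilityMeasure μ]
    (hμ : ∀ v : ι → ℝ, MeasurePreserving (fun z => z + torusMk v) μ μ) (b : ι → ℝ) (s : ℝ) :
    ∫ z, Complex.exp ((s * cosSum b z : ℝ) * Complex.I) ∂μ = ∏ k, (besselJZero (b k * s) : ℂ) := by
  classical
  have key : ∀ S : Finset ι, ∫ z, Complex.exp ((s * ∑ k ∈ S, b k * torusCos k z : ℝ) * Complex.I) ∂μ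
      = ∏ k ∈ S, (besselJZero (b k * s) : ℂ) := by
    intro S
    induction S using Finset.induction_on with
    | empty => simp
    | insert j S hj ih =>
      have h := integral_mul_eq_integral_average (μ := μ) (v := Pi.single j (1 : ℝ)) (fun s => hμ _)
        (f := fun z => Complex.exp ((b j * s * torusCos j z : ℝ) * Complex.I))
        (P := fun z => Complex.exp ((s * ∑ k ∈ S, b k * torusCos k z : ℝ) * Complex.I))
        (by fun_prop) (by fun_prop) (by
          intro z t
          have : ∀ k ∈ S, torusCos k (z + torusMk (t • Pi.single j (1 : ℝ))) = torusCos k z := by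
            intro k hk
            have hkj : k ≠ j := fun e => hj (e ▸ hk)
            rw [torusCos_add]
            simp [hkj]
          rw [Finset.sum_congr rfl fun k hk => by rw [this k hk]])
      have h2 : ∀ z : UnitAddTorus ι, ∫ t in (0 : ℝ)..2 * π, Complex.exp
          ((b j * s * torusCos j (z + torusMk (t • Pi.single j (1 : ℝ))) : ℝ) * Complex.I)
          = (2 * π * besselJZero (b j * s) : ℝ) := by
        intro z
        obtain ⟨w, rfl⟩ := torusMk_surjective z
        rw [← integral_exp_mul_cos (b j * s) (w j)]
        refine intervalIntegral.integral_congr fun t _ => ?_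
        simp only [← torusMk_add, torusCos_torusMk]
        simp
      simp only [h2] at h
      rw [integral_mul_const, ih] at h
      rw [Finset.prod_insert hj]
      have h3 : ∀ z, Complex.exp ((s * ∑ k ∈ insert j S, b k * torusCos k z : ℝ) * Complex.I)
          = Complex.exp ((s * ∑ k ∈ S, b k * torusCos k z : ℝ) * Complex.I)
            * Complex.exp ((b j * s * torusCos j z : ℝ) * Complex.I) := by
        intro z
        rw [Finset.sum_insert hj, ← Complex.exp_add]
        congr 1
        push_cast; ring
      simp only [h3]
      have hpi : ((2 * π : ℝ) : ℂ) ≠ 0 := by exact_mod_cast two_pi_pos.ne'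
      rw [Complex.real_smul] at h
      refine mul_left_cancel₀ hpi (h.trans ?_)
      push_cast; ring
  exact key Finset.univ

theorem integral_bump_le (f : ContDiffBump (0 : ℝ)) : ∫ x, f x ≤ 2 * f.rOut := by
  have h1 : ∫ x, f x = ∫ x in Metric.closedBall 0 f.rOut, f x := by
    refine (setIntegral_eq_integral_of_forall_compl_eq_zero fun x hx => ?_).symm
    refine f.zero_of_le_dist ?_
    rw [Metric.mem_closedBall, not_le] at hx
    exact hx.le
  rw [h1]
  refine (setIntegral_mono_on f.integrable.integrableOn (g := fun _ => 1)
    (integrableOn_const (by simp [Real.volume_closedBall, ENNReal.mul_eq_top])) measurableSet_closedBall fun x _ => f.le_one).trans ?_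
  rw [setIntegral_const, smul_eq_mul, mul_one, Real.volume_real_closedBall f.rOut_pos.le]

open scoped FourierTransform ContDiff in
/-- If all translations preserve `μ`, the density of `∑ b_k cos θ_k` is at most
`(1 / π) ∫ ∏ |J₀(b_k t)| dt`. -/
theorem integral_bump_cosSum_le {μ : Measure (UnitAddTorus ι)} [IsProbabilityMeasure μ]
    (hμ : ∀ v : ι → ℝ, MeasurePreserving (fun z => z + torusMk v) μ μ) (b : ι → ℝ)
    {B : ℕ → ℝ} (hB : IntegrableOn (besselProd B) (Set.Ioi 0))
    (hbB : ∀ t, ∏ k, |besselJZero (b k * t)| ≤ besselProd B t) (f : ContDiffBump (0 : ℝ)) :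
    ∫ z, f (cosSum b z) ∂μ ≤ 2 * f.rOut * besselR B := by
  have hcd : ContDiff ℝ ∞ fun x : ℝ => (f x : ℂ) := Complex.ofRealCLM.contDiff.comp f.contDiff
  have hcs : HasCompactSupport fun x : ℝ => (f x : ℂ) := f.hasCompactSupport.comp_left Complex.ofReal_zero
  set g : SchwartzMap ℝ ℂ := hcs.toSchwartzMap hcd with hg
  have hgf : ∀ x, g x = (f x : ℂ) := fun x => rfl
  set G : SchwartzMap ℝ ℂ := 𝓕 g with hG
  have hGn : ∀ ξ, ‖G ξ‖ ≤ ∫ x, f x := by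
    intro ξ
    have : G ξ = 𝓕 (g : ℝ → ℂ) ξ := by rw [hG, SchwartzMap.fourier_coe]
    rw [this]
    refine (VectorFourier.norm_fourierIntegral_le_integral_norm _ _ _ _ _).trans_eq ?_
    refine integral_congr_ae (Eventually.of_forall fun x => ?_)
    simp only [hgf]
    rw [Complex.norm_real, Real.norm_eq_abs, abs_of_nonneg f.nonneg]
  -- Fourier inversion turns the integral of `f` into an integral of the characteristic function of
  -- the sum against the transform `G`, which is bounded by the integral of `f`.
  have hinv : ∀ x, (f x : ℂ) = ∫ ξ, Complex.exp ((2 * π * ξ * x : ℝ) * Complex.I) * G ξ := by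
    intro x
    have h1 : 𝓕⁻ (𝓕 (g : ℝ → ℂ)) = g := by
      refine Continuous.fourierInv_fourier_eq g.continuous g.integrable ?_
      rw [← SchwartzMap.fourier_coe]
      exact G.integrable
    rw [← hgf, ← h1, Real.fourierInv_eq', ← SchwartzMap.fourier_coe]
    refine integral_congr_ae (Eventually.of_forall fun ξ => ?_)
    simp only [smul_eq_mul]
    congr 3
    simp; ring
  have hint : Integrable (Function.uncurry fun (z : UnitAddTorus ι) (ξ : ℝ) =>
      Complex.exp ((2 * π * ξ * cosSum b z : ℝ) * Complex.I) * G ξ) (μ.prod volume) := by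
    have h1 : Integrable (fun p : UnitAddTorus ι × ℝ => ‖G p.2‖) (μ.prod volume) :=
      (G.integrable.norm).comp_snd μ
    refine h1.mono' (Continuous.aestronglyMeasurable ?_) (Eventually.of_forall fun p => ?_)
    · have := G.continuous
      simp only [Function.uncurry_def]
      fun_prop
    · simp only [Function.uncurry_def]
      rw [norm_mul, Complex.norm_exp_ofReal_mul_I, one_mul]
  have h1 : ((∫ z, f (cosSum b z) ∂μ : ℝ) : ℂ)
      = ∫ ξ, (∏ k, (besselJZero (b k * (2 * π * ξ)) : ℂ)) * G ξ := by
    rw [← integral_complex_ofReal]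
    simp only [hinv]
    rw [integral_integral_swap hint]
    refine integral_congr_ae (Eventually.of_forall fun ξ => ?_)
    simp only
    rw [integral_mul_const, integral_exp_cosSum hμ]
  have hBint : Integrable (besselProd B) := by
    rw [← integrableOn_univ, ← Set.Iic_union_Ioi (a := (0 : ℝ)), integrableOn_union]
    refine ⟨?_, hB⟩
    have := hB.comp_neg
    simp only [besselProd_neg] at this
    rw [integrableOn_Iic_iff_integrableOn_Iio]
    simpa using this
  -- Rescaling contributes `1 / (2π)` and evenness doubles the half-line, giving the `1 / π` in
  -- `besselR`.
  have h2 : ∫ t, besselProd B (2 * π * t) = besselR B := by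
    rw [Measure.integral_comp_mul_left, besselR]
    have : ∫ t, besselProd B t = 2 * ∫ t in Set.Ioi (0 : ℝ), besselProd B t := by
      rw [← integral_comp_abs]
      refine integral_congr_ae (Eventually.of_forall fun t => ?_)
      rcases abs_choice t with h | h
      · simp only [h]
      · simp only [h, besselProd_neg]
    rw [this, abs_of_pos (by positivity), smul_eq_mul]
    field_simp
  have h3 : ∫ z, f (cosSum b z) ∂μ ≤ ∫ ξ, besselProd B (2 * π * ξ) * (2 * f.rOut) := by
    refine (le_abs_self _).trans ?_
    rw [← Real.norm_eq_abs, ← Complex.norm_real, h1]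
    refine norm_integral_le_of_norm_le ((hBint.comp_mul_left' two_pi_pos.ne').mul_const _)
      (Eventually.of_forall fun ξ => ?_)
    rw [norm_mul, norm_prod]
    simp only [Complex.norm_real, Real.norm_eq_abs]
    exact mul_le_mul (hbB _) ((hGn ξ).trans (integral_bump_le f)) (norm_nonneg _)
      (besselProd_nonneg _ _)
  rw [integral_mul_const, h2] at h3
  linarith

end CharacteristicFunction

end

/-! ### Integration by parts and negative moments on the torus. -/

section

open MeasureTheory UnitAddTorus Filter Topology Real

section IntegrationByParts

variable {ι : Type*}

theorem hasDerivAt_torusSin (k : ι) (z : UnitAddTorus ι) (v : ι → ℝ) :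
    HasDerivAt (fun s : ℝ => torusSin k (z + torusMk (s • v))) (torusCos k z * v k) 0 := by
  simp only [torusSin_add, Pi.smul_apply, smul_eq_mul]
  have h1 : HasDerivAt (fun s : ℝ => s * v k) (v k) 0 := by
    simpa using (hasDerivAt_id (0 : ℝ)).mul_const (v k)
  refine ((h1.cos.const_mul (torusSin k z)).add (h1.sin.const_mul (torusCos k z))).congr_deriv ?_
  simp

theorem hasDerivAt_torusCos (k : ι) (z : UnitAddTorus ι) (v : ι → ℝ) :
    HasDerivAt (fun s : ℝ => torusCos k (z + torusMk (s • v))) (-(torusSin k z * v k)) 0 := by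
  simp only [torusCos_add, Pi.smul_apply, smul_eq_mul]
  have h1 : HasDerivAt (fun s : ℝ => s * v k) (v k) 0 := by
    simpa using (hasDerivAt_id (0 : ℝ)).mul_const (v k)
  refine ((h1.cos.const_mul (torusCos k z)).sub (h1.sin.const_mul (torusSin k z))).congr_deriv ?_
  simp

variable [Fintype ι]

/-- The trigonometric polynomial `∑ a_k sin θ_k` on the torus. -/
noncomputable def sinSum (a : ι → ℝ) (z : UnitAddTorus ι) : ℝ := ∑ k, a k * torusSin k z

@[fun_prop]
theorem continuous_sinSum (a : ι → ℝ) : Continuous (sinSum a) := by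
  unfold sinSum; fun_prop

theorem hasDerivAt_sinSum (a v : ι → ℝ) (z : UnitAddTorus ι) :
    HasDerivAt (fun s : ℝ => sinSum a (z + torusMk (s • v))) (cosSum (fun k => a k * v k) z) 0 := by
  unfold sinSum cosSum
  refine (HasDerivAt.fun_sum fun k _ => (hasDerivAt_torusSin k z v).const_mul (a k)).congr_deriv ?_
  exact Finset.sum_congr rfl fun k _ => by ring

theorem hasDerivAt_cosSum (a v : ι → ℝ) (z : UnitAddTorus ι) :
    HasDerivAt (fun s : ℝ => cosSum a (z + torusMk (s • v))) (-sinSum (fun k => a k * v k) z) 0 := by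
  unfold sinSum cosSum
  refine (HasDerivAt.fun_sum fun k _ => (hasDerivAt_torusCos k z v).const_mul (a k)).congr_deriv ?_
  rw [← Finset.sum_neg_distrib]
  exact Finset.sum_congr rfl fun k _ => by ring

theorem abs_cosSum_le (a : ι → ℝ) (z : UnitAddTorus ι) : |cosSum a z| ≤ ∑ k, |a k| := by
  refine (Finset.abs_sum_le_sum_abs _ _).trans (Finset.sum_le_sum fun k _ => ?_)
  rw [abs_mul]
  exact mul_le_of_le_one_right (abs_nonneg _) (abs_torusCos_le_one k z)

theorem cosSum_zero (z : UnitAddTorus ι) : cosSum 0 z = 0 := by simp [cosSum]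

/-- Integration by parts along the invariant directions `e l`, which have disjoint supports. -/
theorem integral_comp_cosSum_le {L : Type*} [Fintype L] {μ : Measure (UnitAddTorus ι)}
    [IsProbabilityMeasure μ] {e : L → ι → ℝ}
    (hμ : ∀ l (s : ℝ), MeasurePreserving (fun z => z + torusMk (s • e l)) μ μ)
    (he : ∀ l l' k, l ≠ l' → e l k * e l' k = 0) (b : ι → ℝ) {F h : ℝ → ℝ} {B M κ : ℝ}
    (hF : ∀ x, HasDerivAt F (h x) x) (hh : Continuous h) (hh1 : ∀ x, h x ≤ 1)
    (hFB : ∀ x, |F x| ≤ B) (hM : ∀ l, ∑ k, |b k * e l k * e l k| ≤ M) (hκ : 0 < κ) :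
    ∫ z, h (cosSum b z) ∂μ ≤ (Fintype.card L * (B * M) + κ) *
      ∫ z, (∑ l, sinSum (fun k => b k * e l k) z ^ 2 + κ)⁻¹ ∂μ := by
  classical
  set Y : L → UnitAddTorus ι → ℝ := fun l => sinSum fun k => b k * e l k with hY
  set Z : L → UnitAddTorus ι → ℝ := fun l => cosSum fun k => b k * e l k * e l k with hZ
  -- The functions `Y l` may vanish simultaneously; `κ` keeps `Q` positive and can later be sent to
  -- zero.
  set Q : UnitAddTorus ι → ℝ := fun z => ∑ l, Y l z ^ 2 + κ with hQ
  have hYc : ∀ l, Continuous (Y l) := fun l => continuous_sinSum _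
  have hZc : ∀ l, Continuous (Z l) := fun l => continuous_cosSum _
  have hQc : Continuous Q := by simp only [hQ]; fun_prop
  have hQ0 : ∀ z, 0 < Q z := fun z => by
    have : 0 ≤ ∑ l, Y l z ^ 2 := Finset.sum_nonneg fun _ _ => sq_nonneg _
    simp only [hQ]; linarith
  have hQne : ∀ z, Q z ≠ 0 := fun z => (hQ0 z).ne'
  have hYQ : ∀ l z, Y l z ^ 2 ≤ Q z := fun l z => by
    have : Y l z ^ 2 ≤ ∑ l, Y l z ^ 2 :=
      Finset.single_le_sum (f := fun l => Y l z ^ 2) (fun _ _ => sq_nonneg _) (Finset.mem_univ l)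
    simp only [hQ]; linarith
  have hFc : Continuous F := continuous_iff_continuousAt.2 fun x => (hF x).continuousAt
  have hB0 : 0 ≤ B := (abs_nonneg _).trans (hFB 0)
  have hdX : ∀ l z, HasDerivAt (fun s : ℝ => cosSum b (z + torusMk (s • e l))) (-Y l z) 0 :=
    fun l z => hasDerivAt_cosSum b (e l) z
  have hdY : ∀ l z, HasDerivAt (fun s : ℝ => Y l (z + torusMk (s • e l))) (Z l z) 0 :=
    fun l z => hasDerivAt_sinSum _ (e l) z
  have hdY' : ∀ l l' z, l' ≠ l → HasDerivAt (fun s : ℝ => Y l' (z + torusMk (s • e l))) 0 0 := by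
    intro l l' z hne
    refine (hasDerivAt_sinSum _ (e l) z).congr_deriv ?_
    have : (fun k => b k * e l' k * e l k) = 0 := by
      funext k
      rw [mul_assoc, he l' l k hne, mul_zero]; rfl
    rw [this, cosSum_zero]
  have hbase : ∀ z : UnitAddTorus ι, ∀ v : ι → ℝ, z + torusMk ((0 : ℝ) • v) = z := by
    intro z v; rw [zero_smul, torusMk_zero, add_zero]
  have hdQ : ∀ l z, HasDerivAt (fun s : ℝ => Q (z + torusMk (s • e l))) (2 * Y l z * Z l z) 0 := by
    intro l z
    have h1 : ∀ l' ∈ Finset.univ, HasDerivAt (fun s : ℝ => Y l' (z + torusMk (s • e l)) ^ 2)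
        (if l' = l then 2 * Y l z * Z l z else 0) 0 := by
      intro l' _
      split_ifs with hl
      · subst hl
        refine ((hdY l' z).pow 2).congr_deriv ?_
        simp only [hbase]; ring
      · refine ((hdY' l l' z hl).pow 2).congr_deriv ?_
        simp
    refine ((HasDerivAt.fun_sum h1).add_const κ).congr_deriv ?_
    simp
  have hibp : ∀ l, ∫ z, h (cosSum b z) * (Y l z ^ 2 / Q z) ∂μ
      ≤ B * M * ∫ z, (Q z)⁻¹ ∂μ := by
    intro l
    -- The function differentiated along `e l` is `F(X) Y_l / Q`, with `X` the cosine sum. The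
    -- derivative of `X` is `-Y_l`, and by disjointness of supports only `Y_l` varies in `Q`, so the
    -- derivative of `Y_l / Q` is `Z_l (1 - 2 Y_l² / Q) / Q`, at most `M / Q` in size.
    have h1 := integral_deriv_eq_zero (hμ l) (G := fun z => F (cosSum b z) * (Y l z / Q z))
      (G' := fun z => F (cosSum b z) * (Z l z * (1 - 2 * (Y l z ^ 2 / Q z)) / Q z)
        - h (cosSum b z) * (Y l z ^ 2 / Q z))
      (by fun_prop (disch := exact hQne _)) (by fun_prop (disch := exact hQne _)) (by
        intro z
        have hX := HasDerivAt.comp (h := fun s : ℝ => cosSum b (z + torusMk (s • e l))) (0 : ℝ)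
          (hF _) (hdX l z)
        have hq := (hdY l z).div (hdQ l z) (hQne _)
        refine (hX.mul hq).congr_deriv ?_
        have := hQne z
        simp only [Function.comp, Pi.div_apply, hbase]
        field_simp
        ring)
    rw [integral_sub (integrable_continuous_torus (by fun_prop (disch := exact hQne _)))
      (integrable_continuous_torus (by fun_prop (disch := exact hQne _))), sub_eq_zero] at h1
    rw [← h1, ← integral_const_mul]
    refine integral_mono (integrable_continuous_torus (by fun_prop (disch := exact hQne _)))
      (integrable_continuous_torus (by fun_prop (disch := exact hQne _))) fun z => ?_
    have hu0 : 0 ≤ Y l z ^ 2 / Q z := div_nonneg (sq_nonneg _) (hQ0 z).le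
    have hu1 : Y l z ^ 2 / Q z ≤ 1 := (div_le_one (hQ0 z)).2 (hYQ l z)
    have hZM : |Z l z| ≤ M := (abs_cosSum_le _ z).trans (hM l)
    have hM0 : 0 ≤ M := (abs_nonneg _).trans hZM
    refine (le_abs_self _).trans ?_
    rw [abs_mul, abs_div, abs_mul, abs_of_pos (hQ0 z), div_eq_mul_inv, mul_assoc B]
    have h2 : |1 - 2 * (Y l z ^ 2 / Q z)| ≤ 1 := abs_le.2 ⟨by linarith, by linarith⟩
    have h3 : |Z l z| * |1 - 2 * (Y l z ^ 2 / Q z)| ≤ M := by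
      calc _ ≤ M * 1 := by gcongr
        _ = M := mul_one M
    have := (inv_pos.2 (hQ0 z)).le
    gcongr
    exact hFB _
  -- Because `∑ Y_l² = Q - κ`, the pieces `Y_l² / Q` sum to `1 - κ / Q`.
  have hsplit : ∀ z, h (cosSum b z)
      = ∑ l, h (cosSum b z) * (Y l z ^ 2 / Q z) + h (cosSum b z) * κ * (Q z)⁻¹ := by
    intro z
    have := hQne z
    rw [← Finset.mul_sum, ← Finset.sum_div]
    have h2 : ∑ l, Y l z ^ 2 = Q z - κ := by simp [hQ]
    rw [h2]
    field_simp
    ring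
  have hcl : ∀ l, Continuous fun z => h (cosSum b z) * (Y l z ^ 2 / Q z) := fun l => by
    fun_prop (disch := exact hQne _)
  have hlast : ∫ z, h (cosSum b z) * κ * (Q z)⁻¹ ∂μ ≤ κ * ∫ z, (Q z)⁻¹ ∂μ := by
    rw [← integral_const_mul]
    refine integral_mono (integrable_continuous_torus (by fun_prop (disch := exact hQne _)))
      (integrable_continuous_torus (by fun_prop (disch := exact hQne _))) fun z => ?_
    have := (inv_pos.2 (hQ0 z)).le
    have : h (cosSum b z) * κ ≤ κ := mul_le_of_le_one_left hκ.le (hh1 _)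
    simp only
    gcongr
  calc ∫ z, h (cosSum b z) ∂μ
      = ∑ l, ∫ z, h (cosSum b z) * (Y l z ^ 2 / Q z) ∂μ + ∫ z, h (cosSum b z) * κ * (Q z)⁻¹ ∂μ := by
        rw [← integral_finsetSum _ fun l _ => integrable_continuous_torus (hcl l), ← integral_add]
        · exact integral_congr_ae (Eventually.of_forall hsplit)
        · exact integrable_continuous_torus (continuous_finsetSum _ fun l _ => hcl l)
        · exact integrable_continuous_torus (by fun_prop (disch := exact hQne _))
    _ ≤ ∑ l : L, B * M * ∫ z, (Q z)⁻¹ ∂μ + κ * ∫ z, (Q z)⁻¹ ∂μ :=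
        add_le_add (Finset.sum_le_sum fun l _ => hibp l) hlast
    _ = _ := by
        rw [Finset.sum_const, Finset.card_univ, nsmul_eq_mul]
        ring

end IntegrationByParts

section NegativeMoments

/-- Jordan's inequality `sin(u/2) ≥ u/π` reduces the half-period to the integral of `u ^ (-1/2)`;
the other half follows by reflection. -/
theorem integral_sin_half_rpow_le {κ : ℝ} (hκ : 0 < κ) :
    ∫ u in (0 : ℝ)..2 * π, (sin (u / 2) ^ 2 + κ) ^ (-(1 / 4) : ℝ) ≤ 4 * π := by
  have hpos : ∀ u : ℝ, 0 < sin (u / 2) ^ 2 + κ := fun u => by positivity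
  have hc : Continuous fun u : ℝ => (sin (u / 2) ^ 2 + κ) ^ (-(1 / 4) : ℝ) :=
    Continuous.rpow_const (by fun_prop) fun u => Or.inl (hpos u).ne'
  have h1 : ∫ u in (0 : ℝ)..π, (sin (u / 2) ^ 2 + κ) ^ (-(1 / 4) : ℝ) ≤ 2 * π := by
    have h2 : ∫ u in (0 : ℝ)..π, √π * u ^ (-(1 / 2) : ℝ) = 2 * π := by
      rw [intervalIntegral.integral_const_mul, integral_rpow (Or.inl (by norm_num))]
      norm_num
      rw [← sqrt_eq_rpow]
      have := mul_self_sqrt pi_pos.le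
      linarith
    rw [← h2]
    refine intervalIntegral.integral_mono_on_of_le_Ioo pi_pos.le (hc.intervalIntegrable _ _)
      ((intervalIntegral.intervalIntegrable_rpow' (by norm_num)).const_mul _) fun u hu => ?_
    have hs : u / π ≤ sin (u / 2) := by
      have := mul_le_sin (x := u / 2) (by linarith [hu.1]) (by linarith [hu.2])
      calc u / π = 2 / π * (u / 2) := by ring
        _ ≤ _ := this
    have hu0 : 0 < u / π := div_pos hu.1 pi_pos
    calc (sin (u / 2) ^ 2 + κ) ^ (-(1 / 4) : ℝ) ≤ ((u / π) ^ 2) ^ (-(1 / 4) : ℝ) := by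
          refine rpow_le_rpow_of_nonpos (by positivity) ?_ (by norm_num)
          have : (u / π) ^ 2 ≤ sin (u / 2) ^ 2 := by gcongr
          linarith
      _ = √π * u ^ (-(1 / 2) : ℝ) := by
          rw [← rpow_natCast, ← rpow_mul hu0.le]
          norm_num
          rw [div_rpow hu.1.le pi_pos.le, sqrt_eq_rpow, rpow_neg pi_pos.le]
          field_simp
  rw [← intervalIntegral.integral_add_adjacent_intervals (b := π)
    (hc.intervalIntegrable _ _) (hc.intervalIntegrable _ _)]
  have h3 : ∫ u in π..2 * π, (sin (u / 2) ^ 2 + κ) ^ (-(1 / 4) : ℝ)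
      = ∫ u in (0 : ℝ)..π, (sin (u / 2) ^ 2 + κ) ^ (-(1 / 4) : ℝ) := by
    have := intervalIntegral.integral_comp_sub_left (a := 0) (b := π)
      (fun u => (sin (u / 2) ^ 2 + κ) ^ (-(1 / 4) : ℝ)) (2 * π)
    rw [show 2 * π - π = π by ring, sub_zero] at this
    rw [← this]
    refine intervalIntegral.integral_congr fun u _ => ?_
    rw [show (2 * π - u) / 2 = π - u / 2 by ring, sin_pi_sub]
  rw [h3]
  linarith

/-- The bound must be uniform in `a`, including `a = ±1` where `sin τ + a` has a double zero.
Clamping `a` to `[-1, 1]` only decreases `|sin τ + a|`; then `sin τ - sin τ₀` splits into two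
half-angle factors, which the arithmetic-geometric mean inequality separates at the cost of doubling
the exponent to `-1/4`. -/
theorem integral_sin_add_const_rpow_le {κ : ℝ} (hκ : 0 < κ) (hκ1 : κ ≤ 1) (a : ℝ) :
    ∫ τ in (0 : ℝ)..2 * π, ((sin τ + a) ^ 2 + κ) ^ (-(1 / 8) : ℝ) ≤ 16 * π := by
  set a' := max (-1) (min a 1) with ha'
  have ha1 : -1 ≤ -a' := by simp [ha']
  have ha2 : -a' ≤ 1 := by
    have : -1 ≤ a' := le_max_left _ _
    linarith
  set τ₀ := arcsin (-a') with hτ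
  have hsin : sin τ₀ = -a' := sin_arcsin ha1 ha2
  set g : ℝ → ℝ := fun u => (sin (u / 2) ^ 2 + κ) ^ (-(1 / 4) : ℝ) with hg
  have hpos : ∀ u : ℝ, 0 < sin (u / 2) ^ 2 + κ := fun u => by positivity
  have hgc : Continuous g :=
    Continuous.rpow_const (by fun_prop) fun u => Or.inl (hpos u).ne'
  have hgp : Function.Periodic g (2 * π) := by
    intro u
    simp only [hg]
    rw [show (u + 2 * π) / 2 = u / 2 + π by ring, sin_add_pi, neg_sq]
  have hshift : ∀ c, ∫ u in (0 : ℝ)..2 * π, g (c + u) ≤ 4 * π := by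
    intro c
    rw [intervalIntegral.integral_comp_add_left g c, add_zero,
      hgp.intervalIntegral_add_eq c 0, zero_add]
    exact integral_sin_half_rpow_le hκ
  have hpt : ∀ τ : ℝ, ((sin τ + a) ^ 2 + κ) ^ (-(1 / 8) : ℝ)
      ≤ 2 * (g (-τ₀ + τ) + g (τ₀ + π + τ)) := by
    intro τ
    have h1 : (sin τ + a') ^ 2 ≤ (sin τ + a) ^ 2 := by
      rw [sq_le_sq]
      have := neg_one_le_sin τ
      have := sin_le_one τ
      rcases le_total a 1 with h | h
      · rw [min_eq_left h] at ha'
        rcases le_total (-1) a with h' | h'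
        · rw [ha', max_eq_right h']
        · rw [ha', max_eq_left h', abs_of_nonpos (by linarith), abs_of_nonpos (by linarith)]
          linarith
      · rw [min_eq_right h, max_eq_right (by norm_num)] at ha'
        rw [ha', abs_of_nonneg (by linarith), abs_of_nonneg (by linarith)]
        linarith
    set x := sin ((-τ₀ + τ) / 2) ^ 2 with hx
    set y := sin ((τ₀ + π + τ) / 2) ^ 2 with hy
    have h2 : (sin τ + a') ^ 2 = 4 * x * y := by
      have : sin τ + a' = sin τ - sin τ₀ := by rw [hsin]; ring
      rw [this, sin_sub_sin, hx, hy, show (τ₀ + π + τ) / 2 = (τ + τ₀) / 2 + π / 2 by ring,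
        sin_add_pi_div_two, show (-τ₀ + τ) / 2 = (τ - τ₀) / 2 by ring]
      ring
    have hx0 : 0 ≤ x := sq_nonneg _
    have hy0 : 0 ≤ y := sq_nonneg _
    have hx1 : x ≤ 1 := sin_sq_le_one _
    have hy1 : y ≤ 1 := sin_sq_le_one _
    have h3 : (x + κ) * (y + κ) / 3 ≤ (sin τ + a) ^ 2 + κ := by
      have : κ * x ≤ κ := mul_le_of_le_one_right hκ.le hx1
      have : κ * y ≤ κ := mul_le_of_le_one_right hκ.le hy1
      have : κ * κ ≤ κ := mul_le_of_le_one_right hκ.le hκ1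
      have : 0 ≤ x * y := mul_nonneg hx0 hy0
      nlinarith
    have hgx : g (-τ₀ + τ) = (x + κ) ^ (-(1 / 4) : ℝ) := rfl
    have hgy : g (τ₀ + π + τ) = (y + κ) ^ (-(1 / 4) : ℝ) := rfl
    have hxk : 0 < x + κ := by linarith
    have hyk : 0 < y + κ := by linarith
    calc ((sin τ + a) ^ 2 + κ) ^ (-(1 / 8) : ℝ)
        ≤ ((x + κ) * (y + κ) / 3) ^ (-(1 / 8) : ℝ) :=
          rpow_le_rpow_of_nonpos (by positivity) h3 (by norm_num)
      _ = 3 ^ (1 / 8 : ℝ) * ((x + κ) ^ (-(1 / 8) : ℝ) * (y + κ) ^ (-(1 / 8) : ℝ)) := by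
          rw [div_rpow (by positivity) (by norm_num), mul_rpow hxk.le hyk.le,
            rpow_neg (by norm_num : (0 : ℝ) ≤ 3)]
          field_simp
      _ ≤ 2 * (((x + κ) ^ (-(1 / 8) : ℝ)) ^ 2 + ((y + κ) ^ (-(1 / 8) : ℝ)) ^ 2) := by
          have h4 : (3 : ℝ) ^ (1 / 8 : ℝ) ≤ 2 := by
            calc (3 : ℝ) ^ (1 / 8 : ℝ) ≤ (2 ^ (8 : ℕ) : ℝ) ^ (1 / 8 : ℝ) := by gcongr; norm_num
              _ = 2 := by
                rw [← rpow_natCast, ← rpow_mul (by norm_num)]; norm_num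
          have h5 : 0 ≤ (x + κ) ^ (-(1 / 8) : ℝ) * (y + κ) ^ (-(1 / 8) : ℝ) := by positivity
          nlinarith [sq_nonneg ((x + κ) ^ (-(1 / 8) : ℝ) - (y + κ) ^ (-(1 / 8) : ℝ)),
            mul_le_mul_of_nonneg_right h4 h5]
      _ = 2 * (g (-τ₀ + τ) + g (τ₀ + π + τ)) := by
          rw [hgx, hgy, ← rpow_natCast, ← rpow_natCast, ← rpow_mul hxk.le, ← rpow_mul hyk.le]
          norm_num
  have hc : Continuous fun τ : ℝ => ((sin τ + a) ^ 2 + κ) ^ (-(1 / 8) : ℝ) :=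
    Continuous.rpow_const (by fun_prop) fun u => Or.inl (by positivity)
  calc _ ≤ ∫ τ in (0 : ℝ)..2 * π, 2 * (g (-τ₀ + τ) + g (τ₀ + π + τ)) :=
        intervalIntegral.integral_mono_on two_pi_pos.le (hc.intervalIntegrable _ _)
          (Continuous.intervalIntegrable (by fun_prop) _ _) fun τ _ => hpt τ
    _ ≤ 16 * π := by
        rw [intervalIntegral.integral_const_mul, intervalIntegral.integral_add
          (Continuous.intervalIntegrable (by fun_prop) _ _)
          (Continuous.intervalIntegrable (by fun_prop) _ _)]
        linarith [hshift (-τ₀), hshift (τ₀ + π)]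

/-- Negative moments of sine sums over disjoint groups of independent angles. -/
theorem integral_prod_sinSum_rpow_le {L J : Type*} [Fintype L] [Fintype J]
    {ν : Measure (UnitAddTorus (L × J))} [IsProbabilityMeasure ν]
    (hν : ∀ v, MeasurePreserving (fun z => z + torusMk v) ν ν) {a : L → J → ℝ}
    (ha : ∀ l, ∃ j, |a l j| = 1) {κ : ℝ} (hκ : 0 < κ) (hκ1 : κ ≤ 1) :
    ∫ z, ∏ l, ((∑ j, a l j * torusSin (l, j) z) ^ 2 + κ) ^ (-(1 / 8) : ℝ) ∂ν
      ≤ 8 ^ Fintype.card L := by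
  classical
  set f : L → UnitAddTorus (L × J) → ℝ := fun l z =>
    ((∑ j, a l j * torusSin (l, j) z) ^ 2 + κ) ^ (-(1 / 8) : ℝ) with hf
  have hfc : ∀ l, Continuous (f l) := fun l =>
    Continuous.rpow_const (by fun_prop) fun u => Or.inl (by positivity)
  have hf0 : ∀ l z, 0 ≤ f l z := fun l z => by simp only [hf]; positivity
  have key : ∀ S : Finset L, ∫ z, ∏ l ∈ S, f l z ∂ν ≤ 8 ^ S.card := by
    intro S
    induction S using Finset.induction_on with
    | empty => simp
    | insert l S hl ih =>
      obtain ⟨j, hj⟩ := ha l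
      have hP : Continuous fun z => ∏ l ∈ S, f l z := continuous_finsetProd _ fun l _ => hfc l
      -- Only the angle with coefficient of modulus one is averaged: it occurs in block `l` alone,
      -- and the other angles of the block act as the constant `a` of the preceding lemma.
      have h := integral_mul_eq_integral_average (μ := ν) (v := Pi.single (l, j) (1 : ℝ))
        (fun s => hν _) (hfc l) hP (by
          intro z t
          refine Finset.prod_congr rfl fun l' hl' => ?_
          have hne : l' ≠ l := fun e => hl (e ▸ hl')
          simp only [hf]
          congr 3
          refine Finset.sum_congr rfl fun j' _ => ?_
          have : (l', j') ≠ (l, j) := fun e => hne (congrArg Prod.fst e)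
          rw [torusSin_add]
          simp [this])
      have h2 : ∀ z, ∫ s in (0 : ℝ)..2 * π, f l (z + torusMk (s • Pi.single (l, j) (1 : ℝ)))
          ≤ 16 * π := by
        intro z
        obtain ⟨w, rfl⟩ := torusMk_surjective z
        set A := ∑ i ∈ Finset.univ.erase j, a l i * sin (w (l, i)) with hA
        set g : ℝ → ℝ := fun τ => ((sin τ + a l j * A) ^ 2 + κ) ^ (-(1 / 8) : ℝ) with hg
        have hgp : Function.Periodic g (2 * π) := fun τ => by simp only [hg, sin_add_two_pi]
        -- A coefficient `±1` may be moved onto the constant term, because only the square of the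
        -- sum matters.
        have hsq : a l j ^ 2 = 1 := by rw [← sq_abs, hj, one_pow]
        have h3 : ∀ s : ℝ, f l (torusMk w + torusMk (s • Pi.single (l, j) (1 : ℝ)))
            = g (w (l, j) + s) := by
          intro s
          simp only [hf, hg]
          congr 2
          rw [← torusMk_add, ← Finset.add_sum_erase _ _ (Finset.mem_univ j)]
          simp only [torusSin_torusMk]
          have h4 : ∑ i ∈ Finset.univ.erase j,
              a l i * sin ((w + s • (Pi.single (l, j) 1 : L × J → ℝ)) (l, i)) = A := by
            refine Finset.sum_congr rfl fun i hi => ?_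
            have : (l, i) ≠ (l, j) := fun e => Finset.ne_of_mem_erase hi (congrArg Prod.snd e)
            simp [this]
          rw [h4]
          simp only [Pi.add_apply, Pi.smul_apply, Pi.single_eq_same, smul_eq_mul, mul_one]
          linear_combination (sin (w (l, j) + s) ^ 2 - A ^ 2) * hsq
        simp only [h3]
        rw [intervalIntegral.integral_comp_add_left g, add_zero,
          hgp.intervalIntegral_add_eq _ 0, zero_add]
        exact integral_sin_add_const_rpow_le hκ hκ1 _
      have hcI : Continuous fun z => ∫ s in (0 : ℝ)..2 * π,
          f l (z + torusMk (s • Pi.single (l, j) (1 : ℝ))) := by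
        refine intervalIntegral.continuous_parametric_intervalIntegral_of_continuous' ?_ _ _
        exact (hfc l).comp (continuous_fst.add ((continuous_line _).comp continuous_snd))
      have h5 : (2 * π) • ∫ z, (∏ l ∈ S, f l z) * f l z ∂ν ≤ 16 * π * 8 ^ S.card := by
        rw [h]
        calc _ ≤ ∫ z, 16 * π * ∏ l ∈ S, f l z ∂ν := by
              refine integral_mono (integrable_continuous_torus (hP.mul hcI))
                (integrable_continuous_torus (continuous_const.mul hP)) fun z => ?_
              have : 0 ≤ ∏ l ∈ S, f l z := Finset.prod_nonneg fun l _ => hf0 l z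
              simp only
              rw [mul_comm (16 * π)]
              gcongr
              exact h2 z
          _ ≤ _ := by
              rw [integral_const_mul]
              gcongr
      simp only [Finset.prod_insert hl, Finset.card_insert_of_notMem hl]
      rw [smul_eq_mul] at h5
      simp only [mul_comm (f l _)]
      have : 0 < 2 * π := two_pi_pos
      refine le_of_mul_le_mul_left (h5.trans_eq ?_) this
      ring
  exact key Finset.univ

end NegativeMoments

end

/-! ### Bounded rank: independent blocks and invariant directions. -/

section

open MeasureTheory UnitAddTorus Filter Topology Real

section Relations

variable {ι : Type*} [Fintype ι]

/-- Take `F` of maximal size without relations. Each `i` in `I \ F` then has a relation supported on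
`F ∪ {i}` with nonzero entry at `i`; these form a diagonal system on `I \ F`, hence are independent,
so there are at most `r` of them. -/
theorem exists_finset_no_relation {γ : ι → ℝ} {r : ℕ}
    (hr : ∀ u : Fin (r + 1) → ι → ℤ, (∀ i, ∑ k, u i k * γ k = 0) → ¬ LinearIndependent ℤ u)
    (I : Finset ι) :
    ∃ F ⊆ I, I.card ≤ F.card + r ∧
      ∀ n : ι → ℤ, (∀ k ∉ F, n k = 0) → ∑ k, n k * γ k = 0 → n = 0 := by
  classical
  set 𝒮 := I.powerset.filter fun F =>
    ∀ n : ι → ℤ, (∀ k ∉ F, n k = 0) → ∑ k, n k * γ k = 0 → n = 0 with h𝒮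
  have hne : 𝒮.Nonempty := ⟨∅, by
    simp only [h𝒮, Finset.mem_filter, Finset.empty_mem_powerset, true_and]
    intro n hn _
    funext k
    exact hn k (by simp)⟩
  obtain ⟨F, hF, hmax⟩ := Finset.exists_max_image 𝒮 Finset.card hne
  obtain ⟨hFI, hF⟩ := Finset.mem_filter.1 hF
  rw [Finset.mem_powerset] at hFI
  refine ⟨F, hFI, ?_, hF⟩
  by_contra! hlt
  have hcard : r + 1 ≤ (I \ F).card := by
    rw [Finset.card_sdiff_of_subset hFI]; omega
  have hex : ∀ i : ↥(I \ F), ∃ n : ι → ℤ, (∀ k ∉ insert (i : ι) F, n k = 0) ∧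
      ∑ k, n k * γ k = 0 ∧ n i ≠ 0 := by
    intro i
    obtain ⟨hiI, hiF⟩ := Finset.mem_sdiff.1 i.2
    have hnot : insert (i : ι) F ∉ 𝒮 := fun hmem => by
      have := hmax _ hmem
      rw [Finset.card_insert_of_notMem hiF] at this
      omega
    simp only [h𝒮, Finset.mem_filter, Finset.mem_powerset, not_and] at hnot
    have := hnot (Finset.insert_subset hiI hFI)
    push Not at this
    obtain ⟨n, hn1, hn2, hn3⟩ := this
    refine ⟨n, hn1, hn2, fun h0 => hn3 (hF n (fun k hk => ?_) hn2)⟩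
    rcases eq_or_ne k i with rfl | hki
    · exact h0
    · exact hn1 k (by simp [hki, hk])
  choose n hn1 hn2 hn3 using hex
  obtain ⟨φ⟩ : Nonempty (Fin (r + 1) ↪ ↥(I \ F)) :=
    Function.Embedding.nonempty_of_card_le (by
      rw [Fintype.card_fin, Fintype.card_coe]; exact hcard)
  refine hr (fun i => n (φ i)) (fun i => hn2 _) ?_
  rw [Fintype.linearIndependent_iff]
  intro g hg j
  have h1 := congrFun hg (φ j)
  rw [Finset.sum_apply, Finset.sum_eq_single j] at h1
  · simpa [hn3 (φ j)] using h1
  · intro i _ hij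
    have : n (φ i) (φ j) = 0 := hn1 _ _ (by
      simp only [Finset.mem_insert, not_or]
      exact ⟨fun h => hij (φ.injective (Subtype.ext h)).symm, (Finset.mem_sdiff.1 (φ j).2).2⟩)
    simp [this]
  · simp

/-- If the restrictions of relations to `r + 1` coordinates spanned the real space, some `r + 1` of
them would be a basis and the relations themselves would be independent. So the span is proper and
some nonzero functional kills it. -/
theorem exists_orthogonal_relations {γ : ι → ℝ} {r : ℕ}
    (hr : ∀ u : Fin (r + 1) → ι → ℤ, (∀ i, ∑ k, u i k * γ k = 0) → ¬ LinearIndependent ℤ u)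
    (τ : Fin (r + 1) → ι) :
    ∃ e : Fin (r + 1) → ℝ, e ≠ 0 ∧
      ∀ n : ι → ℤ, ∑ k, n k * γ k = 0 → ∑ j, n (τ j) * e j = 0 := by
  classical
  set s : Set (Fin (r + 1) → ℝ) :=
    {x | ∃ n : ι → ℤ, ∑ k, n k * γ k = 0 ∧ x = fun j => (n (τ j) : ℝ)} with hs
  by_cases htop : Submodule.span ℝ s = ⊤
  · exfalso
    obtain ⟨B, hBs, hBspan, hBli⟩ := exists_linearIndependent ℝ s
    rw [htop] at hBspan
    let bas : Module.Basis B ℝ (Fin (r + 1) → ℝ) := Module.Basis.mk hBli (by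
      rw [Subtype.range_coe, hBspan])
    let bas' := bas.reindex (bas.indexEquiv (Pi.basisFun ℝ (Fin (r + 1))))
    have hmem : ∀ i, bas' i ∈ s := by
      intro i
      simp only [bas', bas, Module.Basis.reindex_apply, Module.Basis.mk_apply]
      exact hBs (Subtype.coe_prop _)
    choose n hn1 hn2 using hmem
    refine hr n hn1 ?_
    rw [Fintype.linearIndependent_iff]
    intro g hg i
    have h1 := Fintype.linearIndependent_iff.1 bas'.linearIndependent (fun i => (g i : ℝ)) (by
      funext j
      have := congrFun hg (τ j)
      simp only [Finset.sum_apply, Pi.smul_apply, smul_eq_mul, Pi.zero_apply] at this ⊢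
      simp only [hn2]
      exact_mod_cast this) i
    exact_mod_cast h1
  · obtain ⟨f, hf0, hf⟩ := Submodule.exists_le_ker_of_lt_top _ (lt_top_iff_ne_top.2 htop)
    have hsum : ∀ x : Fin (r + 1) → ℝ, f x = ∑ j, x j * f (Pi.single j 1) := by
      intro x
      conv_lhs => rw [pi_eq_sum_univ' x]
      rw [map_sum]
      refine Finset.sum_congr rfl fun j _ => ?_
      rw [map_smul, smul_eq_mul]
    refine ⟨fun j => f (Pi.single j 1), fun h0 => hf0 ?_, fun n hn => ?_⟩
    · ext j
      simpa using congrFun h0 j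
    · rw [← hsum fun j => (n (τ j) : ℝ)]
      exact hf (Submodule.subset_span ⟨n, hn, rfl⟩)

/-- If the lattice of relations has rank at most `r`, the density of `∑ b_k cos θ_k` is
bounded in terms of `r` and a lower bound for `9 r + 8` of the coefficients. -/
theorem integral_bump_cosSum_le_of_rank_le {γ b : ι → ℝ} {r : ℕ}
    (hr : ∀ u : Fin (r + 1) → ι → ℤ, (∀ i, ∑ k, u i k * γ k = 0) → ¬ LinearIndependent ℤ u)
    {I : Finset ι} (hI : 9 * r + 8 ≤ I.card) {c : ℝ} (hc : 0 < c) (hb : ∀ k ∈ I, c ≤ b k)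
    {μ : Measure (UnitAddTorus ι)} (hμ : IsRelationMeasure γ μ) (f : ContDiffBump (0 : ℝ)) :
    ∫ z, f (cosSum b z) ∂μ ≤ 8 ^ 9 * (2 * f.rOut * ((r + 1) / c)) := by
  classical
  have := hμ.isProb
  obtain ⟨F, hFI, hFcard, hF⟩ := exists_finset_no_relation hr I
  -- There is room since `9r + 8 - r = 8(r + 1)`. Blocks of length `r + 1` guarantee an invariant
  -- direction each; eight of them let `1 / Q` be split into powers `(Y_l²) ^ (-1/8)`, whose
  -- singularity at a double zero of `Y_l` is only `|u| ^ (-1/2)`.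
  obtain ⟨σ₀⟩ : Nonempty (Fin 8 × Fin (r + 1) ↪ F) :=
    Function.Embedding.nonempty_of_card_le (by simp; omega)
  set σ : Fin 8 × Fin (r + 1) → ι := fun p => σ₀ p with hσ
  have hσinj : Function.Injective σ := Subtype.val_injective.comp σ₀.injective
  have hbσ : ∀ p, c ≤ b (σ p) := fun p => hb _ (hFI (σ₀ p).2)
  -- the directions
  have hdir : ∀ l : Fin 8, ∃ e : Fin (r + 1) → ℝ, (∃ j, |b (σ (l, j)) * e j| = 1) ∧
      (∀ j, |b (σ (l, j)) * e j| ≤ 1) ∧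
      ∀ n : ι → ℤ, ∑ k, n k * γ k = 0 → ∑ j, n (σ (l, j)) * e j = 0 := by
    intro l
    obtain ⟨e, he0, he⟩ := exists_orthogonal_relations hr fun j => σ (l, j)
    obtain ⟨j₀, _, hj₀⟩ := Finset.exists_max_image Finset.univ (fun j => |b (σ (l, j)) * e j|)
      Finset.univ_nonempty
    -- Scaling the largest `|b e|` in the block to `1` provides the unit coefficient required by the
    -- negative moment and gives `|e| ≤ 1 / c`, which controls the second derivatives.
    set m := |b (σ (l, j₀)) * e j₀| with hm
    have hm0 : 0 < m := by
      obtain ⟨j, hj⟩ := Function.ne_iff.1 he0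
      refine lt_of_lt_of_le (abs_pos.2 (mul_ne_zero ?_ hj)) (hj₀ j (Finset.mem_univ j))
      exact (lt_of_lt_of_le hc (hbσ _)).ne'
    have hdiv : ∀ j, |b (σ (l, j)) * (e j / m)| = |b (σ (l, j)) * e j| / m := fun j => by
      rw [← mul_div_assoc, abs_div, abs_of_pos hm0]
    refine ⟨fun j => e j / m, ⟨j₀, ?_⟩, fun j => ?_, fun n hn => ?_⟩
    · rw [hdiv]; exact div_self hm0.ne'
    · rw [hdiv, div_le_one hm0]; exact hj₀ j (Finset.mem_univ j)
    · simp only [← mul_div_assoc, ← Finset.sum_div]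
      rw [he n hn, zero_div]
  choose e' he1 he2 he3 using hdir
  set e : Fin 8 → ι → ℝ := fun l => Function.extend (fun j => σ (l, j)) (e' l) 0 with he
  have hinj : ∀ l, Function.Injective fun j => σ (l, j) := fun l j j' h => by
    simpa using hσinj h
  have hes : ∀ l j, e l (σ (l, j)) = e' l j := fun l j => (hinj l).extend_apply _ _ j
  have hes0 : ∀ l k, k ∉ Set.range (fun j => σ (l, j)) → e l k = 0 := fun l k hk =>
    Function.extend_apply' _ _ _ (by simpa using hk)
  have hsum : ∀ (l : Fin 8) (g : ι → ℝ → ℝ), (∀ k, g k 0 = 0) →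
      ∑ k, g k (e l k) = ∑ j, g (σ (l, j)) (e' l j) := by
    intro l g hg
    refine (Fintype.sum_of_injective _ (hinj l) _ _ (fun k hk => ?_) fun j => ?_).symm
    · rw [hes0 l k hk, hg]
    · rw [hes]
  have hinv : ∀ l (s : ℝ), MeasurePreserving (fun z => z + torusMk (s • e l)) μ μ := by
    intro l s
    refine hμ.map_add fun n hn => ?_
    have h1 := hsum l (fun k x => n k * (s * x)) (fun k => by simp)
    simp only [Pi.smul_apply, smul_eq_mul]
    rw [h1]
    have h2 := he3 l n hn
    calc _ = s * ∑ j, n (σ (l, j)) * e' l j := by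
          rw [Finset.mul_sum]; exact Finset.sum_congr rfl fun j _ => by ring
      _ = 0 := by rw [h2, mul_zero]
  have hdisj : ∀ l l' k, l ≠ l' → e l k * e l' k = 0 := by
    intro l l' k hne
    by_cases hk : k ∈ Set.range fun j => σ (l, j)
    · obtain ⟨j, rfl⟩ := hk
      rw [hes0 l', mul_zero]
      rintro ⟨j', hj'⟩
      have := hσinj hj'
      exact hne (congrArg Prod.fst this).symm
    · rw [hes0 l k hk, zero_mul]
  have hM : ∀ l, ∑ k, |b k * e l k * e l k| ≤ (r + 1) / c := by
    intro l
    rw [hsum l (fun k x => |b k * x * x|) (fun k => by simp)]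
    calc _ ≤ ∑ j : Fin (r + 1), 1 / c := Finset.sum_le_sum fun j _ => by
          have h0 : 0 < b (σ (l, j)) := lt_of_lt_of_le hc (hbσ _)
          have h1 := he2 l j
          have h2 : |e' l j| ≤ 1 / c := by
            rw [abs_mul, abs_of_pos h0] at h1
            rw [le_div_iff₀ hc, mul_comm]
            exact (mul_le_mul_of_nonneg_right (hbσ _) (abs_nonneg _)).trans h1
          rw [abs_mul]
          calc _ ≤ 1 * (1 / c) := by gcongr
            _ = 1 / c := one_mul _
      _ = (r + 1) / c := by
          rw [Finset.sum_const, Finset.card_univ, Fintype.card_fin, nsmul_eq_mul]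
          push_cast; ring
  -- the primitive of the bump function
  set Fp : ℝ → ℝ := fun x => ∫ t in (0 : ℝ)..x, f t with hFp
  have hFd : ∀ x, HasDerivAt Fp (f x) x := fun x =>
    intervalIntegral.integral_hasDerivAt_right (f.continuous.intervalIntegrable _ _)
      (f.continuous.stronglyMeasurableAtFilter _ _) f.continuous.continuousAt
  have hFB : ∀ x, |Fp x| ≤ 2 * f.rOut := by
    intro x
    refine le_trans ?_ (integral_bump_le f)
    simp only [hFp]
    rw [← Real.norm_eq_abs]
    refine (intervalIntegral.norm_integral_le_integral_norm_uIoc).trans ?_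
    refine (setIntegral_le_integral f.integrable.norm
      (Eventually.of_forall fun _ => norm_nonneg _)).trans_eq ?_
    refine integral_congr_ae (Eventually.of_forall fun t => ?_)
    exact abs_of_nonneg f.nonneg
  -- negative moments
  have hneg : ∀ κ : ℝ, 0 < κ → κ ≤ 1 →
      ∫ z, (∑ l, sinSum (fun k => b k * e l k) z ^ 2 + κ)⁻¹ ∂μ ≤ 8 ^ 8 := by
    intro κ hκ hκ1
    set a : Fin 8 → Fin (r + 1) → ℝ := fun l j => b (σ (l, j)) * e' l j with ha
    have hν := hμ.map_comp hσinj
    have hνp := hν.isProb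
    have hνinv : ∀ v : Fin 8 × Fin (r + 1) → ℝ, MeasurePreserving (fun z => z + torusMk v)
        (μ.map fun z => z ∘ σ) (μ.map fun z => z ∘ σ) := by
      intro v
      refine hν.map_add fun n hn => ?_
      -- A relation among the chosen angles extends to one supported in `F`, hence vanishes; the
      -- projected measure is thus invariant under every translation.
      have h0 : Function.extend σ n 0 = 0 := by
        refine hF _ (fun k hk => ?_) ?_
        · refine Function.extend_apply' _ _ _ ?_
          rintro ⟨p, rfl⟩
          exact hk (σ₀ p).2
        · rw [← hn]
          refine (Fintype.sum_of_injective σ hσinj _ _ (fun k hk => ?_) fun p => ?_).symm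
          · rw [Function.extend_apply' _ _ _ (by simpa using hk)]; simp
          · rw [hσinj.extend_apply]; rfl
      have h1 : n = 0 := by
        funext p
        rw [← hσinj.extend_apply n 0 p, h0]; rfl
      simp [h1]
    have h1 := integral_prod_sinSum_rpow_le hνinv (a := a) he1 hκ hκ1
    have hcm : Continuous fun z : UnitAddTorus ι => z ∘ σ :=
      continuous_pi fun j => continuous_apply _
    have hpc : Continuous fun z : UnitAddTorus (Fin 8 × Fin (r + 1)) =>
        ∏ l, ((∑ j, a l j * torusSin (l, j) z) ^ 2 + κ) ^ (-(1 / 8) : ℝ) :=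
      continuous_finsetProd _ fun l _ =>
        Continuous.rpow_const (by fun_prop) fun u => Or.inl (by positivity)
    rw [integral_map hcm.measurable.aemeasurable hpc.aestronglyMeasurable] at h1
    rw [Fintype.card_fin] at h1
    refine le_trans (integral_mono (integrable_continuous_torus ?_)
      (integrable_continuous_torus (hpc.comp hcm)) fun z => ?_) h1
    · refine Continuous.inv₀ (by fun_prop) fun z => ?_
      positivity
    · have hY : ∀ l, sinSum (fun k => b k * e l k) z = ∑ j, a l j * torusSin (l, j) (z ∘ σ) := by
        intro l
        exact hsum l (fun k x => b k * x * torusSin k z) (fun k => by simp)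
      set Q := ∑ l, sinSum (fun k => b k * e l k) z ^ 2 + κ with hQ
      have hQ0 : 0 < Q := by positivity
      -- One factor of `Q ^ (-1/8)` is assigned to each block, and all squares except that of the
      -- block are then dropped.
      have h2 : Q⁻¹ = ∏ l : Fin 8, Q ^ (-(1 / 8) : ℝ) := by
        rw [Finset.prod_const, Finset.card_univ, Fintype.card_fin, ← rpow_natCast,
          ← rpow_mul hQ0.le, ← rpow_neg_one]
        norm_num
      rw [h2]
      refine Finset.prod_le_prod (fun l _ => by positivity) fun l _ => ?_
      refine rpow_le_rpow_of_nonpos (by positivity) ?_ (by norm_num)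
      have := Finset.single_le_sum (f := fun l => sinSum (fun k => b k * e l k) z ^ 2)
        (fun _ _ => sq_nonneg _) (Finset.mem_univ l)
      rw [hY l] at this
      linarith
  have hr0 : (0 : ℝ) ≤ (r + 1) / c := by positivity
  refine le_of_forall_pos_le_add fun ε hε => ?_
  -- The term `κ · 8 ^ 8` is absorbed in `ε`; the main term carries eight blocks times the moment `8
  -- ^ 8`, which makes `8 ^ 9`.
  set κ := min 1 (ε / 8 ^ 8) with hκdef
  have hκ : 0 < κ := by positivity
  have hκ1 : κ ≤ 1 := min_le_left _ _
  have hκε : κ * 8 ^ 8 ≤ ε := by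
    have : κ ≤ ε / 8 ^ 8 := min_le_right _ _
    rwa [le_div_iff₀ (by positivity)] at this
  have hrout := f.rOut_pos
  have hmain := integral_comp_cosSum_le hinv hdisj b hFd f.continuous (fun x => f.le_one) hFB hM hκ
  rw [Fintype.card_fin] at hmain
  calc _ ≤ _ := hmain
    _ ≤ ((8 : ℕ) * (2 * f.rOut * ((r + 1) / c)) + κ) * 8 ^ 8 := by
        gcongr
        exact hneg κ hκ hκ1
    _ ≤ _ := by push_cast; linarith

end Relations

end

/-! ### From torus integrals to upper densities. -/

section

open MeasureTheory UnitAddTorus Filter Topology Real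

section Density

theorem not_linearIndependent_of_rank_resonanceLattice_le {γ : ℕ → ℝ} {r : ℕ}
    (hr : Module.rank ℤ (resonanceLattice γ) ≤ (r : Cardinal)) (K : ℕ)
    (u : Fin (r + 1) → Fin K → ℤ) (hu : ∀ i, ∑ k, u i k * γ k = 0) : ¬ LinearIndependent ℤ u := by
  intro hli
  let E : (Fin K → ℤ) →ₗ[ℤ] (ℕ →₀ ℤ) :=
    (Finsupp.lmapDomain ℤ ℤ (Fin.val : Fin K → ℕ)) ∘ₗ
      (Finsupp.linearEquivFunOnFinite ℤ ℤ (Fin K)).symm.toLinearMap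
  have hE : Function.Injective E :=
    (Finsupp.mapDomain_injective Fin.val_injective).comp (LinearEquiv.injective _)
  have hmem : ∀ i, E (u i) ∈ resonanceLattice γ := by
    intro i
    rw [resonanceLattice, LinearMap.mem_ker]
    simp only [E, LinearMap.comp_apply, Finsupp.lmapDomain_apply]
    rw [Finsupp.linearCombination_mapDomain, Finsupp.linearCombination_apply, Finsupp.sum_fintype _ _ (by simp)]
    rw [← hu i]
    refine Finset.sum_congr rfl fun k _ => ?_
    simp [Finsupp.linearEquivFunOnFinite]
  have h1 : LinearIndependent ℤ fun i => (⟨E (u i), hmem i⟩ : resonanceLattice γ) := by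
    refine LinearIndependent.of_comp (resonanceLattice γ).subtype ?_
    exact hli.map' E (LinearMap.ker_eq_bot.2 hE)
  have h2 := h1.cardinal_le_rank.trans hr
  rw [Cardinal.mk_fin] at h2
  have : r + 1 ≤ r := by exact_mod_cast h2
  omega

theorem cosSum_torusMk {ι : Type*} [Fintype ι] (b γ : ι → ℝ) (t : ℝ) :
    cosSum b (torusMk (t • γ)) = ∑ k, b k * cos (γ k * t) := by
  unfold cosSum
  refine Finset.sum_congr rfl fun k _ => ?_
  rw [torusCos_torusMk, Pi.smul_apply, smul_eq_mul, mul_comm t]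

/-- The upper density of a set on which `∑ b_k cos(γ_k t)` is small, in terms of the
relation measure. -/
theorem upperCesaroDensity_le_integral {ι : Type*} [Fintype ι] {b γ : ι → ℝ}
    {μ : Measure (UnitAddTorus ι)} (hμ : IsRelationMeasure γ μ) (f : ContDiffBump (0 : ℝ))
    {A : Set ℝ} (hA : ∀ t ∈ A, |∑ k, b k * cos (γ k * t)| ≤ f.rIn) :
    upperCesaroDensity A ≤ ∫ z, f (cosSum b z) ∂μ := by
  have hlim := hμ.tendsto_average_real (Φ := fun z => f (cosSum b z))
    (f.continuous.comp (continuous_cosSum b))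
  simp only [cosSum_torusMk] at hlim
  set X : ℝ → ℝ := fun t => ∑ k, b k * cos (γ k * t) with hX
  have hXc : Continuous X := by simp only [hX]; fun_prop
  rw [← hlim.limsup_eq, upperCesaroDensity]
  refine limsup_le_limsup ?_ ?_ hlim.isBoundedUnder_le
  · filter_upwards [eventually_gt_atTop 0] with T hT
    rw [div_eq_inv_mul]
    refine mul_le_mul_of_nonneg_left ?_ (inv_pos.2 hT).le
    set M : Set ℝ := {t | |X t| ≤ f.rIn} ∩ Set.Icc 0 T with hM
    have hMm : MeasurableSet M :=
      (isClosed_le hXc.abs continuous_const).measurableSet.inter measurableSet_Icc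
    have hfin : volume M ≠ ⊤ :=
      ((measure_mono Set.inter_subset_right).trans_lt isCompact_Icc.measure_lt_top).ne
    have hfi : IntegrableOn (fun t => f (X t)) (Set.Icc 0 T) :=
      (f.continuous.comp hXc).continuousOn.integrableOn_compact isCompact_Icc
    calc volume.real (A ∩ Set.Icc 0 T) ≤ volume.real M :=
          measureReal_mono (Set.inter_subset_inter_left _ fun t ht => hA t ht) hfin
      _ = ∫ t in M, (1 : ℝ) := by simp
      _ = ∫ t in M, f (X t) := setIntegral_congr_fun hMm fun t ht => by
          refine (f.one_of_mem_closedBall ?_).symm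
          rw [mem_closedBall_zero_iff]
          exact ht.1
      _ ≤ ∫ t in Set.Icc 0 T, f (X t) :=
          setIntegral_mono_set hfi (Eventually.of_forall fun t => f.nonneg)
            (LE.le.eventuallyLE Set.inter_subset_right)
      _ = ∫ t in (0 : ℝ)..T, f (X t) := by
          rw [intervalIntegral.integral_of_le hT.le, integral_Icc_eq_integral_Ioc]
  -- Comparing upper limits in `ℝ` requires a lower bound for the smaller function; here it is
  -- nonnegativity of the ratios.
  · refine IsBoundedUnder.isCoboundedUnder_le ⟨0, ?_⟩
    rw [eventually_map]
    filter_upwards [eventually_gt_atTop 0] with T hT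
    exact div_nonneg measureReal_nonneg hT.le

/-- The hypothesis concerns finite truncations with `D` independent of `K`, so the truncation error
can be made to disappear: work with any `e > ε`, then let `e` decrease to `ε`. -/
theorem upperCesaroDensity_abs_shiftedSum_le {g : ℂ → ℂ} (hg : HasInfinitelyManyOrdinates g)
    {D : ℝ} {K₀ : ℕ}
    (hD : ∀ K ≥ K₀, ∀ (μ : Measure (UnitAddTorus (Fin K))),
      IsRelationMeasure (fun k : Fin K => ordinate g k) μ → ∀ f : ContDiffBump (0 : ℝ),
        ∫ z, f (cosSum (fun k : Fin K => ordinateWeight g k) z) ∂μ ≤ 2 * f.rOut * D)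
    {ε : ℝ} (hε : 0 ≤ ε) {A : Set ℝ} (hA : ∀ t ∈ A, |shiftedSum g t| ≤ ε) :
    upperCesaroDensity A ≤ 4 * ε * D := by
  have key : ∀ e : ℝ, ε < e → upperCesaroDensity A ≤ 4 * e * D := by
    intro e he
    have hb := hg.summable_ordinateWeight
    obtain ⟨K, hK⟩ := ((((tendsto_sum_nat_add (ordinateWeight g)).eventually
      (gt_mem_nhds (sub_pos.2 he))).and (eventually_ge_atTop K₀))).exists
    obtain ⟨μ, hμ⟩ := exists_isRelationMeasure (fun k : Fin K => ordinate g k)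
    have he0 : 0 < e := hε.trans_lt he
    -- The outer radius `2 e` is where the factor `4` comes from: `2 · rOut = 4 e`.
    let f : ContDiffBump (0 : ℝ) := ⟨e, 2 * e, he0, by linarith⟩
    have h1 := upperCesaroDensity_le_integral (b := fun k : Fin K => ordinateWeight g k) hμ f
      (A := A) (by
        intro t ht
        have hs := hg.hasSum_ordinateWeight_mul_cos t
        have h2 := hs.summable.sum_add_tsum_nat_add K
        rw [hs.tsum_eq] at h2
        have h3 : |∑' k, ordinateWeight g (k + K) * cos (ordinate g (k + K) * t)|
            ≤ ∑' k, ordinateWeight g (k + K) := by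
          rw [← Real.norm_eq_abs]
          refine tsum_of_norm_bounded ((summable_nat_add_iff K).2 hb).hasSum fun k => ?_
          rw [norm_mul, Real.norm_eq_abs, abs_of_pos (hg.ordinateWeight_pos _)]
          exact mul_le_of_le_one_right (hg.ordinateWeight_pos _).le (abs_cos_le_one _)
        rw [Fin.sum_univ_eq_sum_range
          (fun k => ordinateWeight g k * cos (ordinate g k * t)) K]
        have h4 := hA t ht
        change _ ≤ e
        calc _ = |shiftedSum g t
              - ∑' k, ordinateWeight g (k + K) * cos (ordinate g (k + K) * t)| := by
              rw [← h2]; congr 1; ring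
          _ ≤ |shiftedSum g t|
              + |∑' k, ordinateWeight g (k + K) * cos (ordinate g (k + K) * t)| := abs_sub _ _
          _ ≤ e := by linarith [hK.1])
    refine h1.trans ((hD K hK.2 μ hμ f).trans_eq ?_)
    change 2 * (2 * e) * D = 4 * e * D
    ring
  have hlim : Tendsto (fun e : ℝ => 4 * e * D) (𝓝[>] ε) (𝓝 (4 * ε * D)) :=
    tendsto_nhdsWithin_of_tendsto_nhds (Continuous.tendsto (by fun_prop) ε)
  exact ge_of_tendsto hlim (eventually_nhdsWithin_of_forall fun e he => key e he)

theorem abs_shiftedSum_riemannZeta_le (δ : ℝ) :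
    |shiftedSum riemannZeta δ| ≤ weightSum riemannZeta := by
  rw [← Real.norm_eq_abs]
  refine tsum_of_norm_bounded summable_multWeight_riemannZeta.hasSum fun ρ => ?_
  have h := multWeight_nonneg ρ.2
  rw [norm_mul, Real.norm_eq_abs, abs_of_nonneg h]
  exact mul_le_of_le_one_right h (abs_cos_le_one _)

theorem weightSum_riemannZeta_nonneg : 0 ≤ weightSum riemannZeta :=
  tsum_nonneg fun ρ => multWeight_nonneg ρ.2

theorem abs_shiftedSum_quadL_le_of_normForm_pos {d : ℕ} [NeZero d] {δ : ℝ}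
    (h : 0 < normForm d δ) :
    |shiftedSum (quadL d) δ| ≤ weightSum riemannZeta / √d := by
  have hd : (0 : ℝ) < d := by exact_mod_cast NeZero.pos d
  have hW := weightSum_riemannZeta_nonneg
  have h1 : shiftedSum riemannZeta δ ^ 2 ≤ weightSum riemannZeta ^ 2 := by
    rw [sq_le_sq, abs_of_nonneg hW]
    exact abs_shiftedSum_riemannZeta_le δ
  rw [normForm] at h
  refine abs_le_of_sq_le_sq ?_ (by positivity)
  rw [div_pow, sq_sqrt hd.le, le_div_iff₀ hd]
  linarith

theorem integrableOn_besselProd_ordinateWeight {g : ℂ → ℂ} (hg : HasInfinitelyManyOrdinates g) :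
    IntegrableOn (besselProd (ordinateWeight g)) (Set.Ioi 0) :=
  integrableOn_besselProd fun k _ => hg.ordinateWeight_pos k

end Density

end

/-! ### Assembly of the main theorem. -/

theorem mainTheorem4 :
    -- all the series and integrals below converge, and the ordinates are enumerated
    (Summable (fun ρ : upperZeros riemannZeta => multWeight riemannZeta ρ) ∧
      ∀ (d : ℕ) [NeZero d], Squarefree d → 1 < d →
        Summable (fun ρ : upperZeros (quadL d) => multWeight (quadL d) ρ) ∧
        StrictMono (ordinate (quadL d)) ∧
        Set.range (ordinate (quadL d)) = ordinateSet (quadL d) ∧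
        MeasureTheory.IntegrableOn (besselProd (ordinateWeight (quadL d))) (Set.Ioi 0)) ∧
    -- rank zero: the explicit bound
    (∀ (d : ℕ) [NeZero d], Squarefree d → 1 < d →
      Module.rank ℤ (resonanceLattice (ordinate (quadL d))) = 0 →
        upperCesaroDensity {δ | 0 < normForm d δ} ≤
          4 * besselR (ordinateWeight (quadL d)) * weightSum riemannZeta / Real.sqrt d) ∧
    -- finite rank: the rate, with a constant that depends only on the rank
    (∀ r : ℕ, ∃ C : ℝ, ∀ (d : ℕ) [NeZero d], Squarefree d → 1 < d →
      Module.rank ℤ (resonanceLattice (ordinate (quadL d))) ≤ (r : Cardinal) →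
        upperCesaroDensity {δ | 0 < normForm d δ} ≤ C / Real.sqrt d) := by
  have hW := weightSum_riemannZeta_nonneg
  refine ⟨⟨summable_multWeight_riemannZeta, fun d _ hd h1 => ?_⟩, fun d _ hd h1 hrank => ?_,
    fun r => ?_⟩
  · have hg := hasInfinitelyManyOrdinates_quadL hd h1
    exact ⟨summable_multWeight_quadL hd h1, hg.strictMono_ordinate, hg.range_ordinate,
      integrableOn_besselProd_ordinateWeight hg⟩
  · have hg := hasInfinitelyManyOrdinates_quadL hd h1
    have hD := upperCesaroDensity_abs_shiftedSum_le hg (D := besselR (ordinateWeight (quadL d)))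
      (K₀ := 3) (by
        intro K hK μ hμ f
        have := hμ.isProb
        have hrel : ∀ n : Fin K → ℤ, ∑ k, n k * ordinate (quadL d) k = 0 → n = 0 := by
          intro n hn
          by_contra hne
          -- A single nonzero relation is already an independent family, contradicting rank zero.
          refine not_linearIndependent_of_rank_resonanceLattice_le (r := 0)
            (by rw [hrank]; simp) K (fun _ => n) (fun _ => hn) ?_
          rw [Fintype.linearIndependent_iff]
          intro c hc i
          obtain ⟨k, hk⟩ := Function.ne_iff.1 hne
          have hi : i = 0 := Fin.ext (by omega)
          subst hi
          simpa [show n k ≠ 0 from hk] using congrFun hc k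
        refine integral_bump_cosSum_le (fun v => hμ.map_add fun n hn => ?_) _
          (integrableOn_besselProd_ordinateWeight hg) (fun t => ?_) f
        · simp [hrel n hn]
        -- All factors beyond the first three are discarded using `|J₀| ≤ 1`, so the bound does not
        -- depend on `K`.
        · obtain ⟨m, rfl⟩ := Nat.exists_eq_add_of_le hK
          rw [Fin.prod_univ_eq_prod_range
            (fun k => |besselJZero (ordinateWeight (quadL d) k * t)|) (3 + m),
            Finset.prod_range_add]
          exact mul_le_of_le_one_right (Finset.prod_nonneg fun _ _ => abs_nonneg _)
            (Finset.prod_le_one (fun _ _ => abs_nonneg _) fun _ _ => abs_besselJZero_le_one _))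
      (ε := weightSum riemannZeta / √d) (by positivity) (A := {δ | 0 < normForm d δ})
      (fun t ht => abs_shiftedSum_quadL_le_of_normForm_pos ht)
    refine hD.trans_eq ?_
    ring
  · obtain ⟨c, hc, hcb⟩ := exists_le_ordinateWeight_quadL (9 * r + 8)
    refine ⟨4 * weightSum riemannZeta * (8 ^ 9 * ((r + 1) / c)), fun d _ hd h1 hrank => ?_⟩
    have hg := hasInfinitelyManyOrdinates_quadL hd h1
    have hD := upperCesaroDensity_abs_shiftedSum_le hg (D := 8 ^ 9 * ((r + 1) / c))
      (K₀ := 9 * r + 8) (by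
        intro K hK μ hμ f
        have h2 := integral_bump_cosSum_le_of_rank_le (γ := fun k : Fin K => ordinate (quadL d) k)
          (b := fun k : Fin K => ordinateWeight (quadL d) k) (r := r)
          (not_linearIndependent_of_rank_resonanceLattice_le hrank K)
          (I := Finset.univ.map (Fin.castLEEmb hK)) (by simp) hc (by
            intro k hk
            obtain ⟨j, _, rfl⟩ := Finset.mem_map.1 hk
            exact hcb d hd h1 _ j.2) hμ f
        refine h2.trans_eq ?_
        ring)
      (ε := weightSum riemannZeta / √d) (by positivity) (A := {δ | 0 < normForm d δ})
      (fun t ht => abs_shiftedSum_quadL_le_of_normForm_pos ht)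
    refine hD.trans_eq ?_
    ring
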